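/- Let $k$ be an algebraically closed field of characteristic $0$ and let $T$ be a rigid semisimple tensor category over $k$, that is, an abelian $k$-linear monoidal category with bilinear tensor product in which every object has a left and a right dual, all $\mathrm{Hom}$-spaces are finite-dimensional and every object is a finite direct sum of simple objects. *The bicategory $M(T)$.* A finite-dimensional Hopf algebra $A$ is *realized inside $T$* if there is given a fully faithful $k$-linear monoidal functor $F$ from its category of finite-dimensional modules to $T$. Multiples $X\otimes V=V\otimes X$ of objects $X$ of $T$ by finite-dimensional vector spaces $V$ are used freely. For Hopf algebras $A$, $B$ realized in $T$ by $F$, $G$, an *$A$-$B$ module* is an object $X$ of $T$ with trivializing isomorphisms $F(V)\otimes X\cong X\otimes V$ and $X\otimes G(W)\cong W\otimes X$ that are natural and multiplicative in the $A$-module $V$ and the $B$-module $W$ and commute with each other; morphisms of modules are morphisms of $T$ that commute with them. The unit $A$-$A$ module is $\mathfrak A=\bigoplus_V F(V)\otimes V^*$ (sum over representatives of the irreducible $A$-modules; $\mathfrak A$ is $F$ of the module $A^*=\bigoplus_V V\otimes V^*$ of functionals on $A$, and $F(U)$ acts by multiplication of matrix coefficients), and likewise $\mathfrak B$ for $B$.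 The tensor product $X\otimes_B Y$ of an $A$-$B$ module $X$ and a $B$-$C$ module $Y$ is the coequalizer of the two actions $X\otimes\mathfrak B\otimes Y\rightrightarrows X\otimes Y$. The bicategory $M(T)$ has as 0-cells the finite-dimensional Hopf algebras realized inside $T$, as 1-cells the modules with composition $X\otimes_B Y$, and as 2-cells the morphisms of modules. Its unit constraints $\mathfrak A\otimes_A X\to X$ and $X\otimes_B\mathfrak B\to X$ are the morphisms induced by the sums (without weights) of the canonical morphisms $F(V)\otimes V^*\otimes X\to X$ and $X\otimes G(W)\otimes W^*\to X$, multiplied by $\omega_A$ and $\omega_B$ respectively, where $\omega=\{\omega_A\}$ is an arbitrary family of nonzero scalars, indexed by the Hopf algebras realized inside $T$. *The morphisms $\epsilon$, $\delta$ and $e$.* Let $X$ be an $A$-$B$ module and let $X^*$ be a dual object of $X$ in $T$ with rigidity pair $\epsilon_X:X\otimes X^*\to I$, $\delta_X:I\to X^*\otimes X$. Let $G(W)\otimes X^*\to X^*\otimes W$ and $X^*\otimes F(V)\to V\otimes X^*$ be the transposes of the trivializing isomorphisms $W^*\otimes X\to X\otimes G(W^*)$ and $X\otimes V^*\to F(V^*)\otimes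 X$. Define $$\epsilon:X\otimes X^*\to\mathfrak A,\qquad \epsilon=\sum_V \dim(V)\,\bigl(X\otimes X^*\to X\otimes V\otimes V^*\otimes X^*\to F(V)\otimes X\otimes X^*\otimes V^*\xrightarrow{\epsilon_X}F(V)\otimes V^*\bigr),$$ and let $\delta:\mathfrak B\to X^*\otimes X$ be the sum, without weights, of the morphisms $$G(W)\otimes W^*\xrightarrow{\delta_X}G(W)\otimes X^*\otimes X\otimes W^*\to X^*\otimes W\otimes W^*\otimes X\to X^*\otimes X .$$ For an $A$-$B$ module $X$ and a $B$-$C$ module $Y$ let $e_B$ be the endomorphism $\dim(B)^{-1}\sum_W\dim(W)\,\bigl(X\otimes Y\to X\otimes G(W)^*\otimes G(W)\otimes Y\to W^*\otimes X\otimes Y\otimes W\to X\otimes Y\bigr)$ of $X\otimes Y$. **Proposition.** (1) The bicategory $M(T)$ is rigid: every 1-cell $X$ has a left adjoint and a right adjoint in $M(T)$. (2) More precisely, for every $A$-$B$ module $X$ and every dual object $X^*$ of $X$ with rigidity pair $(\epsilon_X,\delta_X)$, the transposed morphisms make $X^*$ into a $B$-$A$ module; $\epsilon$ and $\delta$ are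 supported by $e_B$ and $e_A$, that is, $\epsilon\, e_B=\epsilon$ and $e_A\,\delta=\delta$; and a rigidity pair for $X$ in $M(T)$ is given by $(\epsilon,c\,\delta)$ with $$c=\Bigl(\dim(A)\,\frac{\omega_A}{\omega_B}\Bigr)^{-1}=\frac{\omega_B}{\dim(A)\,\omega_A}.$$ In detail, $X^*$ is left adjoint to $X$ in $M(T)$, where the counit is the morphism $X\otimes_B X^*\to\mathfrak A$ of $A$-$A$ modules that is induced by $\epsilon$, and the unit is $c$ times the composite $\mathfrak B\to X^*\otimes_A X$ of $\delta$ and the projection, which is a morphism of $B$-$B$ modules. (3) For every $A$ realized inside $T$, $\mathfrak A$ is the direct sum of the objects $F(V)\otimes V^*$ by the matrix coefficients; and for every $A$-$B$ module $X$ and every $B$-$C$ module $Y$ the endomorphism $e_B$ of $X\otimes Y$ is idempotent and its image is $X\otimes_B Y$. -/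

import Mathlib

open CategoryTheory CategoryTheory.Limits MonoidalCategory TensorProduct

universe u v w

set_option linter.unusedSectionVars false

/-- A finite-dimensional (left) module over the Hopf algebra `A`. -/
structure HopfRep (k : Type u) [Field k] (A : Type u) [Ring A] [HopfAlgebra k A] where
  carrier : Type u
  [grp : AddCommGroup carrier]
  [mod : Module k carrier]
  [fin : Module.Finite k carrier]
  /-- the action of `A` -/
  ρ : A →ₐ[k] Module.End k carrier

namespace HopfRep

attribute [instance] HopfRep.grp HopfRep.mod HopfRep.fin

variable {k : Type u} [Field k] {A : Type u} [Ring A] [HopfAlgebra k A]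

/-- `A`-linear maps. -/
@[ext]
structure Hom (V W : HopfRep k A) where
  lin : V.carrier →ₗ[k] W.carrier
  comm : ∀ a : A, lin ∘ₗ V.ρ a = W.ρ a ∘ₗ lin

instance : Category (HopfRep k A) where
  Hom V W := Hom V W
  id V := ⟨LinearMap.id, fun _ => rfl⟩
  comp f g := ⟨g.lin ∘ₗ f.lin, fun a => by
    rw [LinearMap.comp_assoc, f.comm, ← LinearMap.comp_assoc, g.comm, LinearMap.comp_assoc]⟩

@[ext]
lemma hom_ext {V W : HopfRep k A} {f g : V ⟶ W} (h : f.lin = g.lin) : f = g := Hom.ext h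

@[simp] lemma id_lin (V : HopfRep k A) : Hom.lin (𝟙 V) = LinearMap.id := rfl
@[simp] lemma comp_lin {U V W : HopfRep k A} (f : U ⟶ V) (g : V ⟶ W) :
    (f ≫ g).lin = g.lin ∘ₗ f.lin := rfl

/-- The submodule of `A`-linear maps. -/
def homSubmodule (V W : HopfRep k A) : Submodule k (V.carrier →ₗ[k] W.carrier) where
  carrier := {f | ∀ a : A, f ∘ₗ V.ρ a = W.ρ a ∘ₗ f}
  add_mem' hf hg a := by rw [LinearMap.add_comp, LinearMap.comp_add, hf a, hg a]
  zero_mem' a := by simp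
  smul_mem' c f hf a := by rw [LinearMap.smul_comp, LinearMap.comp_smul, hf a]

/-- `A`-linear maps form a vector space. -/
def homEquiv (V W : HopfRep k A) : (V ⟶ W) ≃ homSubmodule V W where
  toFun f := ⟨f.lin, f.comm⟩
  invFun f := ⟨f.1, f.2⟩

instance (V W : HopfRep k A) : AddCommGroup (V ⟶ W) := (homEquiv V W).addCommGroup
instance (V W : HopfRep k A) : Module k (V ⟶ W) := (homEquiv V W).module k

@[simp] lemma add_lin {V W : HopfRep k A} (f g : V ⟶ W) : (f + g).lin = f.lin + g.lin := rfl
@[simp] lemma smul_lin {V W : HopfRep k A} (c : k) (f : V ⟶ W) : (c • f).lin = c • f.lin := rfl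

instance : Preadditive (HopfRep k A) where
  add_comp _ _ _ f f' g := by ext; simp
  comp_add _ _ _ f g g' := by ext; simp

instance : Linear k (HopfRep k A) where
  smul_comp _ _ _ r f g := by ext; simp
  comp_smul _ _ _ f r g := by ext; simp

/-- The isomorphism given by an `A`-linear bijection. -/
def isoMk {V W : HopfRep k A} (e : V.carrier ≃ₗ[k] W.carrier)
    (h : ∀ a : A, e.toLinearMap ∘ₗ V.ρ a = W.ρ a ∘ₗ e.toLinearMap) : V ≅ W where
  hom := ⟨e.toLinearMap, h⟩
  inv := ⟨e.symm.toLinearMap, fun a => by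
    ext x
    apply e.injective
    have := LinearMap.congr_fun (h a) (e.symm x)
    simpa using this.symm⟩
  hom_inv_id := by ext; simp
  inv_hom_id := by ext; simp

section unbundled

variable {U V W : Type*} [AddCommGroup U] [Module k U] [AddCommGroup V] [Module k V]
  [AddCommGroup W] [Module k W]

/-- The algebra `A` acts on a tensor product through the comultiplication. -/
def tensorAct (ρ : A →ₐ[k] Module.End k V) (σ : A →ₐ[k] Module.End k W) :
    A →ₐ[k] Module.End k (V ⊗[k] W) :=
  (Module.endTensorEndAlgHom (R := k) (S := k) (A := k)).comp
    ((Algebra.TensorProduct.map ρ σ).comp (Bialgebra.comulAlgHom k A))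

/-- The algebra `A` acts on `k` through the counit. -/
def trivAct (k : Type u) [Field k] (A : Type u) [Ring A] [HopfAlgebra k A] :
    A →ₐ[k] Module.End k k :=
  (Algebra.lmul k k).comp (Bialgebra.counitAlgHom k A)

lemma tensorAct_eq (ρ : A →ₐ[k] Module.End k V) (σ : A →ₐ[k] Module.End k W) (a : A) :
    tensorAct ρ σ a = TensorProduct.homTensorHomMap (.id k) V W V W
      (TensorProduct.map ρ.toLinearMap σ.toLinearMap (Coalgebra.comul a)) := by
  simp only [tensorAct, AlgHom.comp_apply, Bialgebra.comulAlgHom_apply]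
  generalize (Coalgebra.comul a : A ⊗[k] A) = x
  induction x with
  | zero => simp
  | tmul x y => rfl
  | add x y hx hy => simp only [map_add, hx, hy]

lemma tensorAct_repr (ρ : A →ₐ[k] Module.End k V) (σ : A →ₐ[k] Module.End k W)
    {ι : Type*} {a : A} (r : Coalgebra.Repr k a ι) :
    tensorAct ρ σ a = ∑ i ∈ r.index, TensorProduct.map (ρ (r.left i)) (σ (r.right i)) := by
  rw [tensorAct_eq, ← r.eq]
  simp

@[simp] lemma trivAct_apply (a : A) (x : k) :
    trivAct k A a x = Coalgebra.counit (R := k) a * x := rfl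

lemma assoc_tensorAct (ρ : A →ₐ[k] Module.End k U) (σ : A →ₐ[k] Module.End k V)
    (τ : A →ₐ[k] Module.End k W) (a : A) :
    (TensorProduct.assoc k U V W).toLinearMap ∘ₗ tensorAct (tensorAct ρ σ) τ a =
      tensorAct ρ (tensorAct σ τ) a ∘ₗ (TensorProduct.assoc k U V W).toLinearMap := by
  ext x y z
  let Φ : A ⊗[k] (A ⊗[k] A) →ₗ[k] U ⊗[k] (V ⊗[k] W) :=
    TensorProduct.map ((LinearMap.applyₗ x).comp ρ.toLinearMap)
      (TensorProduct.map ((LinearMap.applyₗ y).comp σ.toLinearMap)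
        ((LinearMap.applyₗ z).comp τ.toLinearMap))
  have h := congrArg Φ (Coalgebra.coassoc_apply (R := k) a)
  have h1 : ∀ t : A ⊗[k] A, Φ (TensorProduct.assoc k A A A
      (TensorProduct.map Coalgebra.comul LinearMap.id t)) =
      TensorProduct.assoc k U V W (TensorProduct.homTensorHomMap (.id k) _ _ _ _
        (TensorProduct.map (tensorAct ρ σ).toLinearMap τ.toLinearMap t) ((x ⊗ₜ y) ⊗ₜ z)) := by
    intro t
    induction t with
    | zero => simp
    | add p q hp hq => simp only [map_add, hp, hq, LinearMap.add_apply]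
    | tmul p q =>
      simp only [TensorProduct.map_tmul, LinearMap.id_apply, AlgHom.toLinearMap_apply,
        tensorAct_eq, TensorProduct.homTensorHomMap_apply]
      generalize (Coalgebra.comul p : A ⊗[k] A) = s
      induction s with
      | zero => simp
      | add p q hp hq => simp only [map_add, hp, hq, LinearMap.add_apply, TensorProduct.add_tmul]
      | tmul p q => simp [Φ]
  have h2 : ∀ t : A ⊗[k] A, Φ (TensorProduct.map LinearMap.id Coalgebra.comul t) =
      TensorProduct.homTensorHomMap (.id k) _ _ _ _
        (TensorProduct.map ρ.toLinearMap (tensorAct σ τ).toLinearMap t) (x ⊗ₜ (y ⊗ₜ z)) := by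
    intro t
    induction t with
    | zero => simp
    | add p q hp hq => simp only [map_add, hp, hq, LinearMap.add_apply]
    | tmul p q =>
      simp only [TensorProduct.map_tmul, LinearMap.id_apply, AlgHom.toLinearMap_apply,
        tensorAct_eq, TensorProduct.homTensorHomMap_apply]
      generalize (Coalgebra.comul q : A ⊗[k] A) = s
      induction s with
      | zero => simp
      | add p q hp hq => simp only [map_add, hp, hq, LinearMap.add_apply, TensorProduct.tmul_add]
      | tmul p q => simp [Φ]
  have e1 := h1 (Coalgebra.comul a)
  have e2 := h2 (Coalgebra.comul a)
  rw [← tensorAct_eq] at e1 e2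
  exact (e1.symm.trans h).trans e2

lemma lid_tensorAct (ρ : A →ₐ[k] Module.End k V) (a : A) :
    (TensorProduct.lid k V).toLinearMap ∘ₗ tensorAct (trivAct k A) ρ a =
      ρ a ∘ₗ (TensorProduct.lid k V).toLinearMap := by
  ext x
  have h := congrArg (fun t => ρ (TensorProduct.lid k A t) x) (Coalgebra.rTensor_counit_comul (R := k) a)
  simp only [TensorProduct.lid_tmul, one_smul] at h
  rw [← (Coalgebra.Repr.arbitrary k a).eq] at h
  simp only [map_sum] at h
  rw [tensorAct_repr _ _ (Coalgebra.Repr.arbitrary k a)]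
  simpa using h

lemma rid_tensorAct (ρ : A →ₐ[k] Module.End k V) (a : A) :
    (TensorProduct.rid k V).toLinearMap ∘ₗ tensorAct ρ (trivAct k A) a =
      ρ a ∘ₗ (TensorProduct.rid k V).toLinearMap := by
  ext x
  have h := congrArg (fun t => ρ (TensorProduct.rid k A t) x) (Coalgebra.lTensor_counit_comul (R := k) a)
  simp only [TensorProduct.rid_tmul, one_smul] at h
  rw [← (Coalgebra.Repr.arbitrary k a).eq] at h
  simp only [map_sum] at h
  rw [tensorAct_repr _ _ (Coalgebra.Repr.arbitrary k a)]
  simpa using h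

end unbundled

/-- `V ⊗ W`, the algebra `A` acting through the comultiplication. -/
abbrev tensor (V W : HopfRep k A) : HopfRep k A := ⟨V.carrier ⊗[k] W.carrier, tensorAct V.ρ W.ρ⟩

/-- The trivial module `k`, the algebra `A` acting through the counit. -/
abbrev triv (k : Type u) [Field k] (A : Type u) [Ring A] [HopfAlgebra k A] : HopfRep k A :=
  ⟨k, trivAct k A⟩

lemma map_comm {V V' W W' : HopfRep k A} (f : V ⟶ V') (g : W ⟶ W') (a : A) :
    TensorProduct.map f.lin g.lin ∘ₗ tensorAct V.ρ W.ρ a =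
      tensorAct V'.ρ W'.ρ a ∘ₗ TensorProduct.map f.lin g.lin := by
  rw [tensorAct_repr _ _ (Coalgebra.Repr.arbitrary k a),
    tensorAct_repr _ _ (Coalgebra.Repr.arbitrary k a)]
  have hf (b : A) (x) : f.lin (V.ρ b x) = V'.ρ b (f.lin x) := LinearMap.congr_fun (f.comm b) x
  have hg (b : A) (x) : g.lin (W.ρ b x) = W'.ρ b (g.lin x) := LinearMap.congr_fun (g.comm b) x
  refine TensorProduct.ext' fun x y => ?_
  simp [hf, hg]

instance : MonoidalCategoryStruct (HopfRep k A) where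
  tensorObj V W := tensor V W
  tensorUnit := triv k A
  tensorHom f g := ⟨TensorProduct.map f.lin g.lin, map_comm f g⟩
  whiskerLeft U V W f := ⟨TensorProduct.map LinearMap.id f.lin, map_comm (𝟙 U) f⟩
  whiskerRight f U := ⟨TensorProduct.map f.lin LinearMap.id, map_comm f (𝟙 U)⟩
  associator U V W := isoMk (TensorProduct.assoc k U.carrier V.carrier W.carrier)
    (assoc_tensorAct U.ρ V.ρ W.ρ)
  leftUnitor V := isoMk (TensorProduct.lid k V.carrier) (lid_tensorAct V.ρ)
  rightUnitor V := isoMk (TensorProduct.rid k V.carrier) (rid_tensorAct V.ρ)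

section
variable {V V' W W' U : HopfRep k A}
lemma tensorHom_lin (f : V ⟶ V') (g : W ⟶ W') :
  (f ⊗ₘ g).lin = TensorProduct.map f.lin g.lin := rfl
lemma whiskerLeft_lin (f : V ⟶ V')  :
  (W ◁ f).lin = TensorProduct.map LinearMap.id f.lin := rfl
lemma whiskerRight_lin (f : V ⟶ V')  :
  (f ▷ W).lin = TensorProduct.map f.lin LinearMap.id := rfl
lemma associator_lin : (α_ U V W).hom.lin =
  (TensorProduct.assoc k U.carrier V.carrier W.carrier).toLinearMap := rfl
lemma leftUnitor_lin : (λ_ V).hom.lin = (TensorProduct.lid k V.carrier).toLinearMap := rfl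
lemma rightUnitor_lin : (ρ_ V).hom.lin = (TensorProduct.rid k V.carrier).toLinearMap := rfl
end

instance : MonoidalCategory (HopfRep k A) where
  tensorHom_def f g := by
    apply hom_ext
    exact TensorProduct.ext' fun x y => rfl
  id_tensorHom_id V W := by
    apply hom_ext
    exact TensorProduct.ext' fun x y => rfl
  tensorHom_comp_tensorHom f g f' g' := by
    apply hom_ext
    exact TensorProduct.ext' fun x y => rfl
  whiskerLeft_id V W := by
    apply hom_ext
    exact TensorProduct.ext' fun x y => rfl
  id_whiskerRight V W := by
    apply hom_ext
    exact TensorProduct.ext' fun x y => rfl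
  associator_naturality f g h := by
    apply hom_ext
    exact TensorProduct.ext_threefold fun x y z => rfl
  leftUnitor_naturality {V W} f := by
    apply hom_ext
    refine TensorProduct.ext' fun x y => ?_
    exact (f.lin.map_smul x y).symm
  rightUnitor_naturality f := by
    apply hom_ext
    refine TensorProduct.ext' fun x y => ?_
    exact (f.lin.map_smul y x).symm
  pentagon U V W X := by
    apply hom_ext
    exact TensorProduct.ext_fourfold fun x y z w => rfl
  triangle V W := by
    apply hom_ext
    refine TensorProduct.ext_threefold fun x y z => ?_
    exact (TensorProduct.smul_tmul y x z).symm

end HopfRep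

section antipode

open HopfAlgebra

variable (k : Type u) [Field k] {A : Type u} [Ring A] [HopfAlgebra k A]

/-- The square of the antipode is an algebra endomorphism. -/
noncomputable def antipodeSq : A →ₐ[k] A :=
  AlgHom.ofLinearMap (antipode k ∘ₗ antipode k) (by simp)
    (fun x y => by simp [antipode_mul_antidistrib])

variable {k}

lemma antipodeSq_apply (a : A) : antipodeSq k a = antipode k (antipode k a) := rfl

/-- A linear map that commutes with the antipodes of all elements is `A`-linear. -/
lemma comm_of_comm_antipode {V W : Type*} [AddCommGroup V] [Module k V] [AddCommGroup W]
    [Module k W] (ρ : A →ₐ[k] Module.End k V) (σ : A →ₐ[k] Module.End k W) (f : V →ₗ[k] W)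
    (h : ∀ a x, f (ρ (antipode k a) x) = σ (antipode k a) (f x)) (a : A) (x : V) :
    f (ρ a x) = σ a (f x) := by
  -- both sides are `a₁ f(S(a₂) a₃ x) = a₁ S(a₂) f(a₃ x)`
  let Φ : A ⊗[k] (A ⊗[k] A) →ₗ[k] W := TensorProduct.lift (LinearMap.mk₂ k
    (fun p t => σ p (TensorProduct.lift (LinearMap.mk₂ k
      (fun q r => f (ρ (antipode k q * r) x))
      (fun _ _ _ => by simp [add_mul]) (fun _ _ _ => by simp)
      (fun _ _ _ => by simp [mul_add]) (fun _ _ _ => by simp)) t))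
    (fun _ _ _ => by simp) (fun _ _ _ => by simp) (fun _ _ _ => by simp)
    (fun _ _ _ => by simp))
  have e := congrArg Φ (Coalgebra.coassoc_apply (R := k) a)
  have h1 : ∀ t : A ⊗[k] A, Φ (TensorProduct.map LinearMap.id Coalgebra.comul t) =
      σ (TensorProduct.rid k A (TensorProduct.map LinearMap.id Coalgebra.counit t)) (f x) := by
    intro t
    induction t with
    | zero => simp
    | add p q hp hq => simp only [map_add, hp, hq, LinearMap.add_apply]
    | tmul p q =>
      have key : ∀ s : A ⊗[k] A, Φ (p ⊗ₜ s) =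
          σ p (f (ρ (LinearMap.mul' k A ((antipode k).rTensor A s)) x)) := by
        intro s
        induction s with
        | zero => simp
        | add u v hu hv =>
          rw [TensorProduct.tmul_add, map_add, hu, hv]; simp
        | tmul u v => simp [Φ]
      simp [key, Algebra.algebraMap_eq_smul_one]
  have h2 : ∀ t : A ⊗[k] A, Φ (TensorProduct.assoc k A A A
      (TensorProduct.map Coalgebra.comul LinearMap.id t)) =
      f (ρ (TensorProduct.lid k A (TensorProduct.map Coalgebra.counit LinearMap.id t)) x) := by
    intro t
    induction t with
    | zero => simp
    | add p q hp hq => simp only [map_add, hp, hq, LinearMap.add_apply]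
    | tmul p q =>
      have key : ∀ s : A ⊗[k] A, Φ (TensorProduct.assoc k A A A (s ⊗ₜ q)) =
          σ (LinearMap.mul' k A ((antipode k).lTensor A s)) (f (ρ q x)) := by
        intro s
        induction s with
        | zero => simp
        | add u v hu hv =>
          rw [TensorProduct.add_tmul, map_add, map_add, hu, hv]; simp
        | tmul u v => simp [Φ, h]
      simp [key, Algebra.algebraMap_eq_smul_one]
  have e1 := h1 (Coalgebra.comul a)
  have e2 := h2 (Coalgebra.comul a)
  have c1 : TensorProduct.map LinearMap.id (Coalgebra.counit (R := k)) (Coalgebra.comul a) =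
      a ⊗ₜ[k] (1 : k) := Coalgebra.lTensor_counit_comul a
  have c2 : TensorProduct.map (Coalgebra.counit (R := k)) LinearMap.id (Coalgebra.comul a) =
      (1 : k) ⊗ₜ[k] a := Coalgebra.rTensor_counit_comul a
  rw [c1] at e1
  rw [c2] at e2
  simp only [TensorProduct.rid_tmul, TensorProduct.lid_tmul, one_smul] at e1 e2
  exact e2.symm.trans (Eq.trans e e1)

/-- The dual of a representation, through the antipode. -/
noncomputable def dualAct {V : Type*} [AddCommGroup V] [Module k V]
    (ρ : A →ₐ[k] Module.End k V) : A →ₐ[k] Module.End k (Module.Dual k V) :=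
  AlgHom.ofLinearMap (Module.Dual.transpose ∘ₗ ρ.toLinearMap ∘ₗ antipode k)
    (by ext; simp [Module.Dual.transpose])
    (fun x y => by ext; simp [Module.Dual.transpose, antipode_mul_antidistrib])

@[simp] lemma dualAct_apply {V : Type*} [AddCommGroup V] [Module k V]
    (ρ : A →ₐ[k] Module.End k V) (a : A) (φ : Module.Dual k V) (x : V) :
    dualAct ρ a φ x = φ (ρ (antipode k a) x) := rfl

lemma comm_of_comm_antipodeSq {V W : Type*} [AddCommGroup V] [Module k V] [AddCommGroup W]
    [Module k W] (ρ : A →ₐ[k] Module.End k V) (σ : A →ₐ[k] Module.End k W) (f : V →ₗ[k] W)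
    (h : ∀ a x, f (ρ (antipodeSq k a) x) = σ (antipodeSq k a) (f x)) (a : A) (x : V) :
    f (ρ a x) = σ a (f x) := by
  refine comm_of_comm_antipode ρ σ f (fun a x => ?_) a x
  rw [← sub_eq_zero, ← Module.forall_dual_apply_eq_zero_iff k]
  intro φ
  have := LinearMap.congr_fun (comm_of_comm_antipode (dualAct σ) (dualAct ρ)
    (Module.Dual.transpose f) (fun b ψ => by
      ext y
      simp only [dualAct_apply, Module.Dual.transpose_apply, LinearMap.comp_apply]
      rw [← antipodeSq_apply, h]) a φ) x
  simp only [dualAct_apply, Module.Dual.transpose_apply, LinearMap.comp_apply] at this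
  rw [map_sub, this, sub_self]

lemma comm_of_comm_antipodeSq_pow {V W : Type*} [AddCommGroup V] [Module k V] [AddCommGroup W]
    [Module k W] (n : ℕ) : ∀ (ρ : A →ₐ[k] Module.End k V) (σ : A →ₐ[k] Module.End k W)
    (f : V →ₗ[k] W)
    (_ : ∀ a x, f (ρ ((antipodeSq k ^ n) a) x) = σ ((antipodeSq k ^ n) a) (f x)) (a : A) (x : V),
    f (ρ a x) = σ a (f x) := by
  induction n with
  | zero => intro ρ σ f h a x; simpa using h a x
  | succ n ih =>
    intro ρ σ f h a x
    refine comm_of_comm_antipodeSq ρ σ f (fun a x => ?_) a x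
    exact ih (ρ.comp (antipodeSq k)) (σ.comp (antipodeSq k)) f (fun a x => by
      simpa [pow_succ'] using h a x) a x

/-- The antipode of a finite-dimensional Hopf algebra is injective. -/
lemma antipode_injective [Module.Finite k A] : Function.Injective (antipode k : A →ₗ[k] A) := by
  obtain ⟨n, hn, hn1⟩ := ((Module.End.eventually_disjoint_ker_pow_range_pow
    (antipodeSq k : A →ₐ[k] A).toLinearMap).and (Filter.eventually_ge_atTop 1)).exists
  set P : A →ₐ[k] A := antipodeSq k ^ n with hP
  have hPl : ((antipodeSq k : A →ₐ[k] A).toLinearMap) ^ n = P.toLinearMap := by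
    ext x
    rw [hP]
    clear hn hn1 hP P
    induction n generalizing x with
    | zero => rfl
    | succ n ih => rw [pow_succ, pow_succ]; simpa using ih _
  rw [hPl] at hn
  -- `P` restricts to an automorphism of its range
  let P' : P.range →ₐ[k] P.range := (P.comp P.range.val).codRestrict P.range (fun x => ⟨x, rfl⟩)
  have hP' : Function.Injective P' := by
    rw [injective_iff_map_eq_zero]
    rintro ⟨x, hx⟩ h
    have h0 : P x = 0 := congrArg Subtype.val h
    have := Submodule.disjoint_def.1 hn x h0 (by obtain ⟨y, hy⟩ := hx; exact ⟨y, hy⟩)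
    exact Subtype.ext this
  have hb : Function.Bijective P' := ⟨hP', (LinearMap.injective_iff_surjective
    (f := P'.toLinearMap)).1 hP'⟩
  let e := AlgEquiv.ofBijective P' hb
  let q : A →ₐ[k] A := P.range.val.comp (e.symm.toAlgHom.comp P.rangeRestrict)
  have hq : ∀ a, q (P a) = P a := by
    intro a
    have : e.symm (P.rangeRestrict (P a)) = P.rangeRestrict a := by
      rw [AlgEquiv.symm_apply_eq]
      exact Subtype.ext rfl
    exact congrArg Subtype.val this
  have key := comm_of_comm_antipodeSq_pow n (Algebra.lmul k A) ((Algebra.lmul k A).comp q)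
    LinearMap.id (fun a x => by
      rw [← hP]
      simp [hq])
  rw [injective_iff_map_eq_zero]
  intro a ha
  have h0 : P a = 0 := by
    obtain ⟨m, rfl⟩ := Nat.exists_eq_add_of_le' hn1
    rw [hP, pow_succ]
    simp [antipodeSq_apply, ha]
  have h1 : q a = 0 := by
    have : P.rangeRestrict a = 0 := Subtype.ext h0
    simp [q, this]
  simpa [h1] using key a 1

end antipode

section duals

open HopfAlgebra

variable {k : Type u} [Field k] {A : Type u} [Ring A] [HopfAlgebra k A] [Module.Finite k A]

/-- The inverse of the antipode. -/
noncomputable def antipodeInv (k : Type u) [Field k] {A : Type u} [Ring A] [HopfAlgebra k A]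
    [Module.Finite k A] : A →ₗ[k] A :=
  (LinearEquiv.ofInjectiveEndo (antipode k : A →ₗ[k] A) antipode_injective).symm.toLinearMap

@[simp] lemma antipode_antipodeInv (a : A) : antipode k (antipodeInv k a) = a :=
  (LinearEquiv.ofInjectiveEndo (antipode k : A →ₗ[k] A) antipode_injective).apply_symm_apply a

@[simp] lemma antipodeInv_antipode (a : A) : antipodeInv k (antipode k a) = a :=
  antipode_injective (antipode_antipodeInv _)

/-- The dual of a representation, through the inverse of the antipode. -/
noncomputable def predualAct {V : Type*} [AddCommGroup V] [Module k V]
    (ρ : A →ₐ[k] Module.End k V) : A →ₐ[k] Module.End k (Module.Dual k V) :=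
  AlgHom.ofLinearMap (Module.Dual.transpose ∘ₗ ρ.toLinearMap ∘ₗ antipodeInv k)
    (by
      have : antipodeInv k (1 : A) = 1 := antipode_injective (k := k) (by simp)
      ext; simp [Module.Dual.transpose, this])
    (fun x y => by
      have : antipodeInv k (x * y) = antipodeInv k y * antipodeInv k x :=
        antipode_injective (k := k) (by simp [antipode_mul_antidistrib])
      ext; simp [Module.Dual.transpose, this])

@[simp] lemma predualAct_apply {V : Type*} [AddCommGroup V] [Module k V]
    (ρ : A →ₐ[k] Module.End k V) (a : A) (φ : Module.Dual k V) (x : V) :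
    predualAct ρ a φ x = φ (ρ (antipodeInv k a) x) := rfl

lemma sum_antipodeInv_mul {ι : Type*} {a : A} (r : Coalgebra.Repr k a ι) :
    ∑ i ∈ r.index, antipodeInv k (r.right i) * r.left i = Coalgebra.counit (R := k) a • (1 : A) := by
  apply antipode_injective (k := k)
  simp only [map_sum, antipode_mul_antidistrib, antipode_antipodeInv, map_smul, antipode_one]
  exact sum_antipode_mul_eq_smul r

lemma sum_mul_antipodeInv {ι : Type*} {a : A} (r : Coalgebra.Repr k a ι) :
    ∑ i ∈ r.index, r.right i * antipodeInv k (r.left i) = Coalgebra.counit (R := k) a • (1 : A) := by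
  apply antipode_injective (k := k)
  simp only [map_sum, antipode_mul_antidistrib, antipode_antipodeInv, map_smul, antipode_one]
  exact sum_mul_antipode_eq_smul r

end duals

namespace HopfRep

open HopfAlgebra

section

variable {k : Type u} [Field k]

/-- The functional `x ⊗ y ↦ f x * g y`. -/
noncomputable def dtens {V W : Type*} [AddCommGroup V] [Module k V] [AddCommGroup W] [Module k W]
    (f : Module.Dual k V) (g : Module.Dual k W) : Module.Dual k (V ⊗[k] W) :=
  LinearMap.mul' k k ∘ₗ TensorProduct.map f g

@[simp] lemma dtens_tmul {V W : Type*} [AddCommGroup V] [Module k V] [AddCommGroup W] [Module k W]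
    (f : Module.Dual k V) (g : Module.Dual k W) (x : V) (y : W) :
    dtens f g (x ⊗ₜ y) = f x * g y := rfl

/-- The canonical element `∑ i, v i ⊗ v^i`. -/
noncomputable def canon (V : Type*) [AddCommGroup V] [Module k V] [Module.Finite k V] :
    V ⊗[k] Module.Dual k V :=
  ∑ i, Module.finBasis k V i ⊗ₜ (Module.finBasis k V).coord i

/-- The contraction of `f v_i ⊗ g v^i` with `x`. -/
lemma rid_map_canon {V : Type*} [AddCommGroup V] [Module k V] [Module.Finite k V]
    (f : V →ₗ[k] V) (g : Module.Dual k V →ₗ[k] Module.Dual k V) (g' : V →ₗ[k] V) (x : V)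
    (h : ∀ φ, g φ x = φ (g' x)) :
    TensorProduct.rid k V (TensorProduct.map LinearMap.id (Module.Dual.eval k V x)
      (TensorProduct.map f g (canon V))) = f (g' x) := by
  have e := congrArg f ((Module.finBasis k V).sum_repr (g' x))
  simp only [map_sum, map_smul] at e
  rw [← e]
  simp [canon, h]

lemma rid_canon {V : Type*} [AddCommGroup V] [Module k V] [Module.Finite k V] (x : V) :
    TensorProduct.rid k V (TensorProduct.map LinearMap.id (Module.Dual.eval k V x)
      (canon V)) = x := by
  have := rid_map_canon (k := k) (V := V) LinearMap.id LinearMap.id LinearMap.id x (fun _ => rfl)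
  simpa using this

/-- Tensors in `V ⊗ V*` are separated by the contractions with vectors of `V`. -/
lemma ext_tmul_dual {V : Type*} [AddCommGroup V] [Module k V] [Module.Finite k V]
    {s t : V ⊗[k] Module.Dual k V}
    (h : ∀ x : V, TensorProduct.rid k V (TensorProduct.map LinearMap.id (Module.Dual.eval k V x) s) =
      TensorProduct.rid k V (TensorProduct.map LinearMap.id (Module.Dual.eval k V x) t)) :
    s = t := by
  have key : ∀ s : V ⊗[k] Module.Dual k V, s = ∑ i,
      TensorProduct.rid k V (TensorProduct.map LinearMap.id
        (Module.Dual.eval k V (Module.finBasis k V i)) s) ⊗ₜ (Module.finBasis k V).coord i := by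
    intro s
    induction s with
    | zero => simp
    | add p q hp hq =>
      nth_rewrite 1 [hp, hq]
      simp only [map_add, TensorProduct.add_tmul, Finset.sum_add_distrib]
    | tmul x φ =>
      simp only [TensorProduct.map_tmul, LinearMap.id_apply, TensorProduct.rid_tmul,
        Module.Dual.eval_apply]
      simp only [TensorProduct.smul_tmul, ← TensorProduct.tmul_sum]
      congr 1
      refine (Module.finBasis k V).ext fun j => ?_
      simp
  rw [key s, key t]
  exact Finset.sum_congr rfl fun i _ => by rw [h]

end

variable {k : Type u} [Field k] {A : Type u} [Ring A] [HopfAlgebra k A]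

lemma lin_ρ {V W : HopfRep k A} (f : V ⟶ W) (a : A) (x : V.carrier) :
    f.lin (V.ρ a x) = W.ρ a (f.lin x) := LinearMap.congr_fun (f.comm a) x

/-- The dual module `V*`, `A` acting through the antipode; it has an invariant
pairing `V* ⊗ V → k`. -/
noncomputable abbrev dual (V : HopfRep k A) : HopfRep k A := ⟨Module.Dual k V.carrier, dualAct V.ρ⟩

/-- The invariant pairing `V* ⊗ V → k`. -/
noncomputable def ev (V : HopfRep k A) : V.dual ⊗ V ⟶ 𝟙_ (HopfRep k A) :=
  ⟨contractLeft k V.carrier, fun a => by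
    refine TensorProduct.ext' fun φ x => ?_
    change contractLeft k V.carrier (tensorAct (dualAct V.ρ) V.ρ a (φ ⊗ₜ x)) =
      Coalgebra.counit (R := k) a * φ x
    have h := congrArg (fun t => φ (V.ρ t x)) (mul_antipode_rTensor_comul_apply (R := k) a)
    rw [← (Coalgebra.Repr.arbitrary k a).eq] at h
    rw [tensorAct_repr _ _ (Coalgebra.Repr.arbitrary k a)]
    simpa [Algebra.algebraMap_eq_smul_one] using h⟩

/-- The invariant copairing `k → V ⊗ V*`. -/
noncomputable def coev (V : HopfRep k A) : 𝟙_ (HopfRep k A) ⟶ V ⊗ V.dual :=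
  ⟨LinearMap.toSpanSingleton k _ (canon V.carrier), fun a => by
    refine LinearMap.ext_ring ?_
    change LinearMap.toSpanSingleton k _ (canon V.carrier) (Coalgebra.counit (R := k) a * 1) =
      tensorAct V.ρ (dualAct V.ρ) a ((1 : k) • canon V.carrier)
    refine ext_tmul_dual fun x => ?_
    have h := congrArg (fun t => V.ρ t x)
      (sum_mul_antipode_eq_smul (Coalgebra.Repr.arbitrary k a))
    simp only [map_sum, LinearMap.sum_apply, map_mul, Module.End.mul_apply, map_smul, map_one,
      LinearMap.smul_apply, Module.End.one_apply] at h
    rw [tensorAct_repr _ _ (Coalgebra.Repr.arbitrary k a)]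
    simp only [LinearMap.toSpanSingleton_apply, LinearMap.sum_apply, mul_one, one_smul, map_smul,
      map_sum]
    rw [rid_canon, ← h]
    refine Finset.sum_congr rfl fun i _ => ?_
    exact (rid_map_canon _ _ (V.ρ (antipode k _)) x (fun φ => rfl)).symm⟩

/-- The coregular module: functionals on `A` with `(a φ)(b) = φ(b a)`. -/
noncomputable def coregAct (k : Type u) [Field k] (A : Type u) [Ring A] [HopfAlgebra k A] :
    A →ₐ[k] Module.End k (Module.Dual k A) :=
  AlgHom.ofLinearMap (Module.Dual.transpose ∘ₗ (LinearMap.mul k A).flip)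
    (by ext; simp [Module.Dual.transpose]) (fun x y => by ext; simp [Module.Dual.transpose, mul_assoc])

@[simp] lemma coregAct_apply (a b : A) (φ : Module.Dual k A) :
    coregAct k A a φ b = φ (b * a) := rfl

variable [Module.Finite k A]

/-- The dual module `*V`, `A` acting through the inverse of the antipode; it has an invariant
pairing `V ⊗ *V → k`. -/
noncomputable abbrev predual (V : HopfRep k A) : HopfRep k A :=
  ⟨Module.Dual k V.carrier, predualAct V.ρ⟩

/-- The invariant pairing `V ⊗ *V → k`. -/
noncomputable def ev' (V : HopfRep k A) : V ⊗ V.predual ⟶ 𝟙_ (HopfRep k A) :=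
  ⟨contractRight k V.carrier, fun a => by
    refine TensorProduct.ext' fun x φ => ?_
    change contractRight k V.carrier (tensorAct V.ρ (predualAct V.ρ) a (x ⊗ₜ φ)) =
      Coalgebra.counit (R := k) a * φ x
    have h := congrArg (fun t => φ (V.ρ t x)) (sum_antipodeInv_mul (Coalgebra.Repr.arbitrary k a))
    rw [tensorAct_repr _ _ (Coalgebra.Repr.arbitrary k a)]
    simpa using h⟩

/-- The invariant copairing `k → *V ⊗ V`. -/
noncomputable def coev' (V : HopfRep k A) : 𝟙_ (HopfRep k A) ⟶ V.predual ⊗ V :=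
  ⟨LinearMap.toSpanSingleton k _ (TensorProduct.comm k _ _ (canon V.carrier)), fun a => by
    refine LinearMap.ext_ring ?_
    change LinearMap.toSpanSingleton k _ (TensorProduct.comm k _ _ (canon V.carrier))
        (Coalgebra.counit (R := k) a * 1) =
      tensorAct (predualAct V.ρ) V.ρ a ((1 : k) • TensorProduct.comm k _ _ (canon V.carrier))
    apply (TensorProduct.comm k _ _).injective
    refine ext_tmul_dual fun x => ?_
    have h := congrArg (fun t => V.ρ t x)
      (sum_mul_antipodeInv (Coalgebra.Repr.arbitrary k a))
    simp only [map_sum, LinearMap.sum_apply, map_mul, Module.End.mul_apply, map_smul, map_one,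
      LinearMap.smul_apply, Module.End.one_apply] at h
    have hc : ∀ (f : Module.Dual k V.carrier →ₗ[k] Module.Dual k V.carrier)
        (g : V.carrier →ₗ[k] V.carrier) (t : V.carrier ⊗[k] Module.Dual k V.carrier),
        TensorProduct.comm k _ _ (TensorProduct.map f g (TensorProduct.comm k _ _ t)) =
          TensorProduct.map g f t := by
      intro f g t
      induction t with
      | zero => simp
      | add p q hp hq => simp only [map_add, hp, hq]
      | tmul p q => simp
    rw [tensorAct_repr _ _ (Coalgebra.Repr.arbitrary k a)]
    simp only [LinearMap.toSpanSingleton_apply, LinearMap.sum_apply, mul_one, one_smul, map_smul,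
      map_sum, hc]
    rw [← TensorProduct.comm_symm, LinearEquiv.symm_apply_apply, rid_canon, ← h]
    refine Finset.sum_congr rfl fun i _ => ?_
    exact (rid_map_canon _ _ (V.ρ (antipodeInv k _)) x (fun φ => rfl)).symm⟩

/-- The coregular module. -/
noncomputable abbrev coreg (k : Type u) [Field k] (A : Type u) [Ring A] [HopfAlgebra k A]
    [Module.Finite k A] : HopfRep k A := ⟨Module.Dual k A, coregAct k A⟩

/-- Evaluation at `1 : A`. -/
noncomputable def evOne (k : Type u) [Field k] (A : Type u) [Ring A] [HopfAlgebra k A] :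
   Module.Dual k (Module.Dual k A) := Module.Dual.eval k A 1

/-- The matrix coefficients `b ↦ f (b x)` of the module `V` for the functional `f`. -/
noncomputable def mc {V : HopfRep k A} (f : Module.Dual k V.carrier) : V ⟶ coreg k A :=
  ⟨(LinearMap.mk₂ k (fun x b => f (V.ρ b x)) (by simp) (by simp) (by simp) (by simp)),
    fun a => by ext x b; simp⟩

@[simp] lemma mc_apply {V : HopfRep k A} (f : Module.Dual k V.carrier) (x : V.carrier) (b : A) :
    (mc f).lin x b = f (V.ρ b x) := rfl

/-- A morphism to the coregular module is a matrix coefficient. -/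
lemma eq_mc {V : HopfRep k A} (f : V ⟶ coreg k A) : f = mc (evOne k A ∘ₗ f.lin) := by
  apply hom_ext
  ext x b
  change f.lin x b = f.lin (V.ρ b x) 1
  rw [lin_ρ]
  simp

lemma evOne_mc {V : HopfRep k A} (f : Module.Dual k V.carrier) : evOne k A ∘ₗ (mc f).lin = f := by
  ext x
  change f (V.ρ 1 x) = f x
  simp

lemma mc_ext {V : HopfRep k A} {f g : V ⟶ coreg k A}
    (h : evOne k A ∘ₗ f.lin = evOne k A ∘ₗ g.lin) : f = g := by
  rw [eq_mc f, eq_mc g, h]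

end HopfRep

namespace HopfRep

section pairings

variable {k : Type u} [Field k] {A : Type u} [Ring A] [HopfAlgebra k A]

lemma coev_apply (V : HopfRep k A) : (coev V).lin 1 = canon V.carrier := one_smul _ _

lemma sum_coord_tmul {V : Type*} [AddCommGroup V] [Module k V] [Module.Finite k V]
    (φ : Module.Dual k V) :
    ∑ i, φ (Module.finBasis k V i) • (Module.finBasis k V).coord i = φ := by
  refine (Module.finBasis k V).ext fun j => ?_
  simp

lemma sum_one_tmul {V : Type*} [AddCommGroup V] [Module k V] {n : ℕ} (c : Fin n → k)
    (x : Fin n → V) : ∑ i, c i ⊗ₜ[k] x i = (1 : k) ⊗ₜ[k] ∑ i, c i • x i := by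
  rw [TensorProduct.tmul_sum]
  refine Finset.sum_congr rfl fun i _ => ?_
  rw [← TensorProduct.smul_tmul, smul_eq_mul, mul_one]

lemma sum_tmul_one {V : Type*} [AddCommGroup V] [Module k V] {n : ℕ} (c : Fin n → k)
    (x : Fin n → V) : ∑ i, x i ⊗ₜ[k] c i = (∑ i, c i • x i) ⊗ₜ[k] (1 : k) := by
  rw [TensorProduct.sum_tmul]
  refine Finset.sum_congr rfl fun i _ => ?_
  rw [TensorProduct.smul_tmul, smul_eq_mul, mul_one]

lemma contract_canon {V : Type*} [AddCommGroup V] [Module k V] [Module.Finite k V] (c : k) (x : V) :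
    TensorProduct.map LinearMap.id (contractLeft k V)
      (TensorProduct.assoc k _ _ _ ((c • canon V) ⊗ₜ x)) = (c • x) ⊗ₜ[k] (1 : k) := by
  rw [← TensorProduct.smul_tmul', map_smul, map_smul, ← TensorProduct.smul_tmul']
  congr 1
  simp only [canon, TensorProduct.sum_tmul, map_sum, TensorProduct.assoc_tmul,
    TensorProduct.map_tmul, LinearMap.id_apply, contractLeft_apply]
  rw [sum_tmul_one]
  congr 1
  exact (Module.finBasis k V).sum_repr x

lemma zigzag_dual (V : HopfRep k A) :
    coev V ▷ V ≫ (α_ _ _ _).hom ≫ V ◁ ev V = (λ_ V).hom ≫ (ρ_ V).inv := by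
  apply hom_ext
  refine TensorProduct.ext' fun c x => ?_
  exact contract_canon c x

/-- The rigidity pair `V* ⊗ V → k`, `k → V ⊗ V*`. -/
noncomputable instance exactPairing (V : HopfRep k A) : ExactPairing V V.dual where
  coevaluation' := coev V
  evaluation' := ev V
  coevaluation_evaluation' := by
    apply hom_ext
    refine TensorProduct.ext' fun φ c => ?_
    change TensorProduct.map (contractLeft k V.carrier) LinearMap.id
      ((TensorProduct.assoc k _ _ _).symm (φ ⊗ₜ (c • canon V.carrier))) =
        (1 : k) ⊗ₜ[k] (c • φ)
    rw [TensorProduct.tmul_smul, map_smul, map_smul, TensorProduct.tmul_smul]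
    congr 1
    simp only [canon, TensorProduct.tmul_sum, map_sum, TensorProduct.assoc_symm_tmul,
      TensorProduct.map_tmul, LinearMap.id_apply, contractLeft_apply]
    rw [sum_one_tmul, sum_coord_tmul]
  evaluation_coevaluation' := zigzag_dual V

variable [Module.Finite k A]

/-- The rigidity pair `V ⊗ *V → k`, `k → *V ⊗ V`. -/
noncomputable instance exactPairing' (V : HopfRep k A) : ExactPairing V.predual V where
  coevaluation' := coev' V
  evaluation' := ev' V
  coevaluation_evaluation' := by
    apply hom_ext
    refine TensorProduct.ext' fun x c => ?_
    change TensorProduct.map (contractRight k V.carrier) LinearMap.id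
      ((TensorProduct.assoc k _ _ _).symm (x ⊗ₜ (c • TensorProduct.comm k _ _ (canon V.carrier)))) =
        (1 : k) ⊗ₜ[k] (c • x)
    rw [TensorProduct.tmul_smul, map_smul, map_smul, TensorProduct.tmul_smul]
    congr 1
    simp only [canon, TensorProduct.tmul_sum, map_sum, TensorProduct.assoc_symm_tmul,
      TensorProduct.map_tmul, LinearMap.id_apply, contractRight_apply, TensorProduct.comm_tmul]
    rw [sum_one_tmul]
    congr 1
    exact (Module.finBasis k V.carrier).sum_repr x
  evaluation_coevaluation' := by
    apply hom_ext
    refine TensorProduct.ext' fun c φ => ?_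
    change TensorProduct.map LinearMap.id (contractRight k V.carrier)
      (TensorProduct.assoc k _ _ _ ((c • TensorProduct.comm k _ _ (canon V.carrier)) ⊗ₜ φ)) =
        (c • φ) ⊗ₜ[k] (1 : k)
    rw [← TensorProduct.smul_tmul', map_smul, map_smul, ← TensorProduct.smul_tmul']
    congr 1
    simp only [canon, TensorProduct.sum_tmul, map_sum, TensorProduct.assoc_tmul,
      TensorProduct.map_tmul, LinearMap.id_apply, contractRight_apply, TensorProduct.comm_tmul]
    rw [sum_tmul_one, sum_coord_tmul]

end pairings

end HopfRep

section monoidal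

variable {T : Type v} [Category.{w} T] [MonoidalCategory T]

/-- A monoidal functor transports rigidity pairs. -/
@[reducible] def mapPairing {C : Type*} [Category C] [MonoidalCategory C] (F : C ⥤ T) [F.Monoidal]
    (X Y : C) [ExactPairing X Y] : ExactPairing (F.obj X) (F.obj Y) where
  coevaluation' := Functor.LaxMonoidal.ε F ≫ F.map (η_ X Y) ≫ Functor.OplaxMonoidal.δ F X Y
  evaluation' := Functor.LaxMonoidal.μ F Y X ≫ F.map (ε_ X Y) ≫ Functor.OplaxMonoidal.η F
  coevaluation_evaluation' := by
    have h := congrArg F.map (ExactPairing.coevaluation_evaluation X Y)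
    simp only [Functor.map_comp, Functor.Monoidal.map_whiskerLeft,
      Functor.Monoidal.map_whiskerRight, Functor.Monoidal.map_associator_inv,
      Functor.Monoidal.map_leftUnitor_inv, Functor.Monoidal.map_rightUnitor] at h
    have h' := congrArg (fun t => F.obj Y ◁ Functor.LaxMonoidal.ε F ≫
      Functor.LaxMonoidal.μ F _ _ ≫ t ≫ Functor.OplaxMonoidal.δ F _ _ ≫
        Functor.OplaxMonoidal.η F ▷ F.obj Y) h
    simp only [Category.assoc, Functor.Monoidal.μ_δ_assoc,
      Functor.Monoidal.whiskerRight_ε_η, Functor.Monoidal.whiskerLeft_ε_η_assoc,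
      Category.comp_id] at h'
    simpa only [MonoidalCategory.whiskerLeft_comp, comp_whiskerRight, Category.assoc] using h'
  evaluation_coevaluation' := by
    have h := congrArg F.map (ExactPairing.evaluation_coevaluation X Y)
    simp only [Functor.map_comp, Functor.Monoidal.map_whiskerLeft,
      Functor.Monoidal.map_whiskerRight, Functor.Monoidal.map_associator,
      Functor.Monoidal.map_leftUnitor, Functor.Monoidal.map_rightUnitor_inv] at h
    have h' := congrArg (fun t => Functor.LaxMonoidal.ε F ▷ F.obj X ≫
      Functor.LaxMonoidal.μ F _ _ ≫ t ≫ Functor.OplaxMonoidal.δ F _ _ ≫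
        F.obj X ◁ Functor.OplaxMonoidal.η F) h
    simp only [Category.assoc, Functor.Monoidal.μ_δ_assoc,
      Functor.Monoidal.whiskerLeft_ε_η,
      Functor.Monoidal.whiskerRight_ε_η_assoc,
      Category.comp_id] at h'
    simpa only [MonoidalCategory.whiskerLeft_comp, comp_whiskerRight, Category.assoc] using h'

variable [Preadditive T] [MonoidalPreadditive T]

lemma left_inverse_aux {P Q : T} [ExactPairing P Q] {X : T} {n : ℕ}
    (c : Fin n → (P ⊗ X ⟶ X)) (e : Fin n → (Q ⊗ X ⟶ X))
    (h : ∑ i, (Q ◁ c i) ≫ e i = (α_ Q P X).inv ≫ (ε_ P Q) ▷ X ≫ (λ_ X).hom) :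
    ∑ i, c i ≫ (λ_ X).inv ≫ (η_ P Q) ▷ X ≫ (α_ P Q X).hom ≫ P ◁ e i = 𝟙 (P ⊗ X) := by
  have h1 : ∀ i, c i ≫ (λ_ X).inv ≫ (η_ P Q) ▷ X ≫ (α_ P Q X).hom ≫ P ◁ e i =
      (λ_ (P ⊗ X)).inv ≫ (η_ P Q) ▷ (P ⊗ X) ≫ (α_ P Q (P ⊗ X)).hom ≫ P ◁ ((Q ◁ c i) ≫ e i) := by
    intro i
    rw [leftUnitor_inv_naturality_assoc, whisker_exchange_assoc, MonoidalCategory.whiskerLeft_comp,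
      associator_naturality_right_assoc]
  simp only [h1, ← Preadditive.comp_sum, ← whiskerLeft_sum, h]
  calc _ = 𝟙 _ ⊗≫ ((η_ P Q ▷ P ≫ (α_ P Q P).hom ≫ P ◁ ε_ P Q) ▷ X) ⊗≫ 𝟙 _ := by monoidal
    _ = _ := by rw [ExactPairing.evaluation_coevaluation]; monoidal

lemma right_inverse_aux {P Q : T} [ExactPairing P Q] {X : T} {n : ℕ}
    (c : Fin n → (X ⊗ Q ⟶ X)) (e : Fin n → (X ⊗ P ⟶ X))
    (h : ∑ i, (c i ▷ P) ≫ e i = (α_ X Q P).hom ≫ X ◁ (ε_ P Q) ≫ (ρ_ X).hom) :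
    ∑ i, c i ≫ (ρ_ X).inv ≫ X ◁ (η_ P Q) ≫ (α_ X P Q).inv ≫ e i ▷ Q = 𝟙 (X ⊗ Q) := by
  have h1 : ∀ i, c i ≫ (ρ_ X).inv ≫ X ◁ (η_ P Q) ≫ (α_ X P Q).inv ≫ e i ▷ Q =
      (ρ_ (X ⊗ Q)).inv ≫ (X ⊗ Q) ◁ (η_ P Q) ≫ (α_ (X ⊗ Q) P Q).inv ≫ ((c i ▷ P) ≫ e i) ▷ Q := by
    intro i
    rw [rightUnitor_inv_naturality_assoc, ← whisker_exchange_assoc, comp_whiskerRight,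
      associator_inv_naturality_left_assoc]
  simp only [h1, ← Preadditive.comp_sum, ← sum_whiskerRight, h]
  calc _ = 𝟙 _ ⊗≫ (X ◁ (Q ◁ η_ P Q ≫ (α_ Q P Q).inv ≫ ε_ P Q ▷ Q)) ⊗≫ 𝟙 _ := by monoidal
    _ = _ := by rw [ExactPairing.coevaluation_evaluation]; monoidal

end monoidal

namespace HopfRep

variable {k : Type u} [Field k] {A : Type u} [Ring A] [HopfAlgebra k A]

lemma dtens_coev (V : HopfRep k A) (f : Module.Dual k V.carrier) (x : V.carrier) :
    dtens f (Module.Dual.eval k V.carrier x) ∘ₗ (η_ V V.dual).lin =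
      f x • (LinearMap.id : k →ₗ[k] k) := by
  refine LinearMap.ext_ring ?_
  change dtens f (Module.Dual.eval k V.carrier x) ((1 : k) • canon V.carrier) = f x • (1 : k)
  have h := congrArg f ((Module.finBasis k V.carrier).sum_repr x)
  simp only [map_sum, map_smul] at h
  rw [← h]
  simp [canon, mul_comm]

lemma sum_dtens_ev (V : HopfRep k A) :
    ∑ i, dtens (Module.Dual.eval k V.carrier (Module.finBasis k V.carrier i))
      ((Module.finBasis k V.carrier).coord i) = (LinearMap.id : k →ₗ[k] k) ∘ₗ (ε_ V V.dual).lin := by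
  refine TensorProduct.ext' fun φ x => ?_
  change _ = φ x
  have h := congrArg φ ((Module.finBasis k V.carrier).sum_repr x)
  simp only [map_sum, map_smul] at h
  rw [← h]
  simp [mul_comm, LinearMap.sum_apply]

variable [Module.Finite k A]

lemma dtens_coev' (V : HopfRep k A) (f : Module.Dual k V.carrier) (x : V.carrier) :
    dtens (Module.Dual.eval k V.carrier x) f ∘ₗ (η_ V.predual V).lin =
      f x • (LinearMap.id : k →ₗ[k] k) := by
  refine LinearMap.ext_ring ?_
  change dtens (Module.Dual.eval k V.carrier x) f
    ((1 : k) • TensorProduct.comm k _ _ (canon V.carrier)) = f x • (1 : k)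
  have h := congrArg f ((Module.finBasis k V.carrier).sum_repr x)
  simp only [map_sum, map_smul] at h
  rw [← h]
  simp [canon]

lemma sum_dtens_ev' (V : HopfRep k A) :
    ∑ i, dtens ((Module.finBasis k V.carrier).coord i)
      (Module.Dual.eval k V.carrier (Module.finBasis k V.carrier i)) =
        (LinearMap.id : k →ₗ[k] k) ∘ₗ (ε_ V.predual V).lin := by
  refine TensorProduct.ext' fun x φ => ?_
  change _ = φ x
  have h := congrArg φ ((Module.finBasis k V.carrier).sum_repr x)
  simp only [map_sum, map_smul] at h
  rw [← h]
  simp [LinearMap.sum_apply]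

end HopfRep

open Functor.LaxMonoidal Functor.OplaxMonoidal

/-- A finite-dimensional Hopf algebra realized inside the tensor category `T`: its tensor category
of finite-dimensional modules is embedded in `T` by a fully faithful `k`-linear monoidal functor. -/
structure Realization (k : Type u) [Field k] (T : Type v) [Category.{w} T] [Preadditive T]
    [Linear k T] [MonoidalCategory T] where
  A : Type u
  [ring : Ring A]
  [hopf : HopfAlgebra k A]
  [finite : Module.Finite k A]
  F : HopfRep k A ⥤ T
  [monoidal : F.Monoidal]
  [additive : F.Additive]
  [linear : F.Linear k]
  [full : F.Full]
  [faithful : F.Faithful]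

attribute [instance] Realization.ring Realization.hopf Realization.finite Realization.monoidal
  Realization.additive Realization.linear Realization.full Realization.faithful

section bimodules

variable {k : Type u} [Field k] {T : Type v} [Category.{w} T] [Preadditive T]
  [Linear k T] [MonoidalCategory T]

/-- The finite-dimensional modules over the Hopf algebra of a realization. -/
abbrev Realization.Mod (𝒜 : Realization k T) := HopfRep k 𝒜.A

/-- Multiplicative actions of two realized Hopf algebras on an object `X` of `T`.
Given a vector space `V` and objects `X, Y` of `T`, a morphism from `Y` to the multiple `X ⊗ V` is
the same thing as a linear map `V* → Hom(Y, X)`; and a morphism from `X ⊗ V` to `Y` is the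
same thing as a linear map `V → Hom(X, Y)`. In this way `lact V` is
a morphism `F(V) ⊗ X → X ⊗ V` and `ract W` is a morphism `X ⊗ G(W) → W ⊗ X`, where `V` and `W`
on the right hand sides are the underlying vector spaces. -/
structure ActStr (𝒜 ℬ : Realization k T) (X : T) where
  lact (V : 𝒜.Mod) : Module.Dual k V.carrier →ₗ[k] (𝒜.F.obj V ⊗ X ⟶ X)
  ract (W : ℬ.Mod) : Module.Dual k W.carrier →ₗ[k] (X ⊗ ℬ.F.obj W ⟶ X)
  lact_nat {V V' : 𝒜.Mod} (g : V ⟶ V') (f : Module.Dual k V'.carrier) :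
    𝒜.F.map g ▷ X ≫ lact V' f = lact V (f ∘ₗ g.lin)
  ract_nat {W W' : ℬ.Mod} (g : W ⟶ W') (f : Module.Dual k W'.carrier) :
    X ◁ ℬ.F.map g ≫ ract W' f = ract W (f ∘ₗ g.lin)
  lact_unit : ε 𝒜.F ▷ X ≫ lact (𝟙_ _) (LinearMap.id : k →ₗ[k] k) = (λ_ X).hom
  ract_unit : X ◁ ε ℬ.F ≫ ract (𝟙_ _) (LinearMap.id : k →ₗ[k] k) = (ρ_ X).hom
  lact_tensor (V V' : 𝒜.Mod) (f : Module.Dual k V.carrier) (f' : Module.Dual k V'.carrier) :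
    μ 𝒜.F V V' ▷ X ≫ lact (V ⊗ V') (HopfRep.dtens f f') =
      (α_ _ _ _).hom ≫ 𝒜.F.obj V ◁ lact V' f' ≫ lact V f
  ract_tensor (W W' : ℬ.Mod) (f : Module.Dual k W.carrier) (f' : Module.Dual k W'.carrier) :
    X ◁ μ ℬ.F W W' ≫ ract (W ⊗ W') (HopfRep.dtens f f') =
      (α_ _ _ _).inv ≫ ract W f ▷ ℬ.F.obj W' ≫ ract W' f'
  lact_ract (V : 𝒜.Mod) (W : ℬ.Mod) (f : Module.Dual k V.carrier) (f' : Module.Dual k W.carrier) :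
    lact V f ▷ ℬ.F.obj W ≫ ract W f' = (α_ _ _ _).hom ≫ 𝒜.F.obj V ◁ ract W f' ≫ lact V f

/-- The structure of an `𝒜`-`ℬ` module on an object `X` of `T`: trivializing isomorphisms
`F(V) ⊗ X ≅ X ⊗ V` and `X ⊗ G(W) ≅ W ⊗ X` that are natural and multiplicative in `V` and `W` and
commute with each other. The inverse isomorphisms are `lcoact` and `rcoact`. -/
structure BimodStr (𝒜 ℬ : Realization k T) (X : T) extends ActStr 𝒜 ℬ X where
  lcoact (V : 𝒜.Mod) : V.carrier →ₗ[k] (X ⟶ 𝒜.F.obj V ⊗ X)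
  rcoact (W : ℬ.Mod) : W.carrier →ₗ[k] (X ⟶ X ⊗ ℬ.F.obj W)
  lcoact_lact (V : 𝒜.Mod) (x : V.carrier) (f : Module.Dual k V.carrier) :
    lcoact V x ≫ lact V f = f x • 𝟙 X
  lact_lcoact (V : 𝒜.Mod) :
    ∑ i, lact V ((Module.finBasis k V.carrier).coord i) ≫
      lcoact V (Module.finBasis k V.carrier i) = 𝟙 _
  rcoact_ract (W : ℬ.Mod) (x : W.carrier) (f : Module.Dual k W.carrier) :
    rcoact W x ≫ ract W f = f x • 𝟙 X
  ract_rcoact (W : ℬ.Mod) :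
    ∑ i, ract W ((Module.finBasis k W.carrier).coord i) ≫
      rcoact W (Module.finBasis k W.carrier i) = 𝟙 _

namespace ActStr

variable [MonoidalPreadditive T] [MonoidalLinear k T] {𝒜 ℬ : Realization k T} {X : T}

/-- Since modules have duals, the actions are automatically invertible. -/
noncomputable def toBimodStr (S : ActStr 𝒜 ℬ X) : BimodStr 𝒜 ℬ X where
  toActStr := S
  lcoact V :=
    { toFun := fun x => (λ_ X).inv ≫ (ε 𝒜.F ≫ 𝒜.F.map (η_ V V.dual) ≫ δ 𝒜.F V V.dual) ▷ X ≫
        (α_ _ _ _).hom ≫ 𝒜.F.obj V ◁ S.lact V.dual (Module.Dual.eval k V.carrier x)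
      map_add' := fun x y => by simp
      map_smul' := fun c x => by simp }
  rcoact W :=
    { toFun := fun x => (ρ_ X).inv ≫ X ◁ (ε ℬ.F ≫ ℬ.F.map (η_ W.predual W) ≫ δ ℬ.F W.predual W) ≫
        (α_ _ _ _).inv ≫ S.ract W.predual (Module.Dual.eval k W.carrier x) ▷ ℬ.F.obj W
      map_add' := fun x y => by simp
      map_smul' := fun c x => by simp }
  lcoact_lact V x f := by
    have h := S.lact_tensor V V.dual f (Module.Dual.eval k V.carrier x)
    have h2 : δ 𝒜.F V V.dual ▷ X ≫ (α_ _ _ _).hom ≫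
        𝒜.F.obj V ◁ S.lact V.dual (Module.Dual.eval k V.carrier x) ≫ S.lact V f =
        S.lact (V ⊗ V.dual) (HopfRep.dtens f (Module.Dual.eval k V.carrier x)) := by
      rw [← h, ← comp_whiskerRight_assoc, Functor.Monoidal.δ_μ]; simp
    have h3 := S.lact_nat (η_ V V.dual) (HopfRep.dtens f (Module.Dual.eval k V.carrier x))
    rw [HopfRep.dtens_coev, map_smul] at h3
    simp only [LinearMap.coe_mk, AddHom.coe_mk, comp_whiskerRight, Category.assoc, h2, h3,
      Linear.comp_smul, S.lact_unit, Iso.inv_hom_id]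
  lact_lcoact V := by
    let _ := mapPairing 𝒜.F V V.dual
    refine left_inverse_aux (P := 𝒜.F.obj V) (Q := 𝒜.F.obj V.dual)
      (fun i => S.lact V ((Module.finBasis k V.carrier).coord i))
      (fun i => S.lact V.dual (Module.Dual.eval k V.carrier (Module.finBasis k V.carrier i))) ?_
    have h : ∀ i, 𝒜.F.obj V.dual ◁ S.lact V ((Module.finBasis k V.carrier).coord i) ≫
        S.lact V.dual (Module.Dual.eval k V.carrier (Module.finBasis k V.carrier i)) =
        (α_ _ _ _).inv ≫ μ 𝒜.F V.dual V ▷ X ≫ S.lact (V.dual ⊗ V) (HopfRep.dtens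
          (Module.Dual.eval k V.carrier (Module.finBasis k V.carrier i))
          ((Module.finBasis k V.carrier).coord i)) := by
      intro i
      rw [S.lact_tensor, Iso.inv_hom_id_assoc]
    simp only [h, ← Preadditive.comp_sum, ← map_sum]
    refine (congrArg (fun t => (α_ _ _ _).inv ≫ μ 𝒜.F V.dual V ▷ X ≫ S.lact (V.dual ⊗ V) t)
      (HopfRep.sum_dtens_ev V)).trans ?_
    have h3 := S.lact_nat (ε_ V V.dual) (LinearMap.id : k →ₗ[k] k)
    have h4 : η 𝒜.F ▷ X ≫ (λ_ X).hom = S.lact (𝟙_ _) (LinearMap.id : k →ₗ[k] k) := by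
      rw [← S.lact_unit, ← comp_whiskerRight_assoc, Functor.Monoidal.η_ε]; simp
    change _ = (α_ _ _ _).inv ≫ (μ 𝒜.F V.dual V ≫ 𝒜.F.map (ε_ V V.dual) ≫ η 𝒜.F) ▷ X ≫ _
    rw [← h3, ← h4]
    simp only [comp_whiskerRight, Category.assoc]
  rcoact_ract V x f := by
    have h := S.ract_tensor V.predual V (Module.Dual.eval k V.carrier x) f
    have h2 : X ◁ δ ℬ.F V.predual V ≫ (α_ _ _ _).inv ≫
        S.ract V.predual (Module.Dual.eval k V.carrier x) ▷ ℬ.F.obj V ≫ S.ract V f =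
        S.ract (V.predual ⊗ V) (HopfRep.dtens (Module.Dual.eval k V.carrier x) f) := by
      rw [← h, ← MonoidalCategory.whiskerLeft_comp_assoc, Functor.Monoidal.δ_μ]; simp
    have h3 := S.ract_nat (η_ V.predual V) (HopfRep.dtens (Module.Dual.eval k V.carrier x) f)
    rw [HopfRep.dtens_coev', map_smul] at h3
    simp only [LinearMap.coe_mk, AddHom.coe_mk, MonoidalCategory.whiskerLeft_comp, Category.assoc, h2, h3,
      Linear.comp_smul, S.ract_unit, Iso.inv_hom_id]
  ract_rcoact V := by
    let _ := mapPairing ℬ.F V.predual V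
    refine right_inverse_aux (P := ℬ.F.obj V.predual) (Q := ℬ.F.obj V)
      (fun i => S.ract V ((Module.finBasis k V.carrier).coord i))
      (fun i => S.ract V.predual (Module.Dual.eval k V.carrier (Module.finBasis k V.carrier i))) ?_
    have h : ∀ i, S.ract V ((Module.finBasis k V.carrier).coord i) ▷ ℬ.F.obj V.predual ≫
        S.ract V.predual (Module.Dual.eval k V.carrier (Module.finBasis k V.carrier i)) =
        (α_ _ _ _).hom ≫ X ◁ μ ℬ.F V V.predual ≫ S.ract (V ⊗ V.predual) (HopfRep.dtens
          ((Module.finBasis k V.carrier).coord i)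
          (Module.Dual.eval k V.carrier (Module.finBasis k V.carrier i))) := by
      intro i
      rw [S.ract_tensor, Iso.hom_inv_id_assoc]
    simp only [h, ← Preadditive.comp_sum, ← map_sum]
    refine (congrArg (fun t => (α_ _ _ _).hom ≫ X ◁ μ ℬ.F V V.predual ≫ S.ract (V ⊗ V.predual) t)
      (HopfRep.sum_dtens_ev' V)).trans ?_
    have h3 := S.ract_nat (ε_ V.predual V) (LinearMap.id : k →ₗ[k] k)
    have h4 : X ◁ η ℬ.F ≫ (ρ_ X).hom = S.ract (𝟙_ _) (LinearMap.id : k →ₗ[k] k) := by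
      rw [← S.ract_unit, ← MonoidalCategory.whiskerLeft_comp_assoc, Functor.Monoidal.η_ε]; simp
    change _ = (α_ _ _ _).hom ≫ X ◁ (μ ℬ.F V V.predual ≫ ℬ.F.map (ε_ V.predual V) ≫ η ℬ.F) ≫ _
    rw [← h3, ← h4]
    simp only [MonoidalCategory.whiskerLeft_comp, Category.assoc]

end ActStr

end bimodules

namespace HopfRep

variable {k : Type u} [Field k] {A : Type u} [Ring A] [HopfAlgebra k A] [Module.Finite k A]

lemma comp_mc {V W : HopfRep k A} (g : V ⟶ W) (f : Module.Dual k W.carrier) :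
    g ≫ mc f = mc (f ∘ₗ g.lin) := by
  apply mc_ext
  rw [comp_lin, ← LinearMap.comp_assoc, evOne_mc, evOne_mc]

lemma mc_add {V : HopfRep k A} (f g : Module.Dual k V.carrier) : mc (f + g) = mc f + mc g := by
  apply mc_ext
  rw [add_lin, LinearMap.comp_add, evOne_mc, evOne_mc, evOne_mc]

lemma mc_smul {V : HopfRep k A} (c : k) (f : Module.Dual k V.carrier) : mc (c • f) = c • mc f := by
  apply mc_ext
  rw [smul_lin, LinearMap.comp_smul, evOne_mc, evOne_mc]

end HopfRep

section dtens

variable {k : Type u} [Field k] {V W V' W' : Type*} [AddCommGroup V] [Module k V]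
  [AddCommGroup W] [Module k W] [AddCommGroup V'] [Module k V'] [AddCommGroup W'] [Module k W']

open HopfRep

lemma HopfRep.dtens_add_left (f f' : Module.Dual k V) (g : Module.Dual k W) :
    dtens (f + f') g = dtens f g + dtens f' g :=
  TensorProduct.ext' fun _ _ => by simp [add_mul]

lemma HopfRep.dtens_add_right (f : Module.Dual k V) (g g' : Module.Dual k W) :
    dtens f (g + g') = dtens f g + dtens f g' :=
  TensorProduct.ext' fun _ _ => by simp [mul_add]

lemma HopfRep.dtens_smul_left (c : k) (f : Module.Dual k V) (g : Module.Dual k W) :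
    dtens (c • f) g = c • dtens f g :=
  TensorProduct.ext' fun _ _ => by simp [mul_assoc]

lemma HopfRep.dtens_smul_right (c : k) (f : Module.Dual k V) (g : Module.Dual k W) :
    dtens f (c • g) = c • dtens f g :=
  TensorProduct.ext' fun _ _ => by simp [mul_left_comm]

lemma HopfRep.dtens_comp (f : Module.Dual k V) (g : Module.Dual k W) (p : V' →ₗ[k] V)
    (q : W' →ₗ[k] W) : dtens f g ∘ₗ TensorProduct.map p q = dtens (f ∘ₗ p) (g ∘ₗ q) :=
  TensorProduct.ext' fun _ _ => rfl

end dtens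

section unitObject

open HopfRep

variable {k : Type u} [Field k] {T : Type v} [Category.{w} T] [Preadditive T]
  [Linear k T] [MonoidalCategory T]

/-- The underlying object of the unit `𝒜`-`𝒜` module `𝔄 = ⨁ F(V) ⊗ V*`: it is the image of
the coregular module `A* = ⨁ V ⊗ V*`, the inclusion of the copy of `F(V)` that belongs to a
functional `f` in `V*` being the morphism `F(mc f)` of matrix coefficients. -/
noncomputable abbrev Realization.unitObj (𝒜 : Realization k T) : T := 𝒜.F.obj (coreg k 𝒜.A)

/-- The actions on `𝔄` by multiplication of matrix coefficients. -/
noncomputable def Realization.unitAct (𝒜 : Realization k T) : ActStr 𝒜 𝒜 𝒜.unitObj where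
  lact V :=
    { toFun := fun f => μ 𝒜.F V (coreg k 𝒜.A) ≫ 𝒜.F.map (mc (V := V ⊗ coreg k 𝒜.A)
        (dtens f (evOne k 𝒜.A)))
      map_add' := fun f g => by
        rw [dtens_add_left, mc_add, Functor.map_add, Preadditive.comp_add]
      map_smul' := fun c f => by
        rw [dtens_smul_left, mc_smul, Functor.map_smul, Linear.comp_smul, RingHom.id_apply] }
  ract W :=
    { toFun := fun f => μ 𝒜.F (coreg k 𝒜.A) W ≫ 𝒜.F.map (mc (V := coreg k 𝒜.A ⊗ W)
        (dtens (evOne k 𝒜.A) f))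
      map_add' := fun f g => by
        rw [dtens_add_right, mc_add, Functor.map_add, Preadditive.comp_add]
      map_smul' := fun c f => by
        rw [dtens_smul_right, mc_smul, Functor.map_smul, Linear.comp_smul, RingHom.id_apply] }
  lact_nat {V V'} g f := by
    simp only [LinearMap.coe_mk, AddHom.coe_mk]
    rw [Functor.LaxMonoidal.μ_natural_left_assoc, ← Functor.map_comp, comp_mc]
    exact congrArg (fun t => _ ≫ 𝒜.F.map (mc (V := V ⊗ coreg k 𝒜.A) t)) (dtens_comp _ _ _ _)
  ract_nat {V V'} g f := by
    simp only [LinearMap.coe_mk, AddHom.coe_mk]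
    rw [Functor.LaxMonoidal.μ_natural_right_assoc, ← Functor.map_comp, comp_mc]
    exact congrArg (fun t => _ ≫ 𝒜.F.map (mc (V := coreg k 𝒜.A ⊗ V) t)) (dtens_comp _ _ _ _)
  lact_unit := by
    simp only [LinearMap.coe_mk, AddHom.coe_mk]
    rw [Functor.LaxMonoidal.left_unitality]
    congr 3
    apply mc_ext
    rw [evOne_mc]
    exact TensorProduct.ext' fun _ _ => rfl
  ract_unit := by
    simp only [LinearMap.coe_mk, AddHom.coe_mk]
    rw [Functor.LaxMonoidal.right_unitality]
    congr 3
    apply mc_ext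
    rw [evOne_mc]
    exact TensorProduct.ext' fun _ _ => mul_comm _ _
  lact_tensor V V' f f' := by
    simp only [LinearMap.coe_mk, AddHom.coe_mk]
    rw [MonoidalCategory.whiskerLeft_comp, Category.assoc,
      Functor.LaxMonoidal.μ_natural_right_assoc, ← Functor.map_comp,
      ← Functor.LaxMonoidal.associativity_assoc, ← Functor.map_comp]
    congr 3
    apply mc_ext
    rw [evOne_mc, comp_lin, comp_lin, ← LinearMap.comp_assoc, ← LinearMap.comp_assoc, evOne_mc]
    refine TensorProduct.ext_threefold fun x y φ => ?_
    have h := LinearMap.congr_fun (evOne_mc (V := V' ⊗ coreg k 𝒜.A) (dtens f' (evOne k 𝒜.A)))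
      (y ⊗ₜ φ)
    exact (mul_assoc (f x) (f' y) (φ 1)).trans (congrArg (f x * ·) h.symm)
  ract_tensor V V' f f' := by
    simp only [LinearMap.coe_mk, AddHom.coe_mk]
    rw [MonoidalCategory.comp_whiskerRight, Category.assoc,
      Functor.LaxMonoidal.μ_natural_left_assoc, ← Functor.map_comp,
      ← Functor.LaxMonoidal.associativity_inv_assoc, ← Functor.map_comp]
    congr 3
    apply mc_ext
    rw [evOne_mc, comp_lin, comp_lin, ← LinearMap.comp_assoc, ← LinearMap.comp_assoc, evOne_mc]
    refine TensorProduct.ext_threefold' fun φ x y => ?_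
    have h := LinearMap.congr_fun (evOne_mc (V := coreg k 𝒜.A ⊗ V) (dtens (evOne k 𝒜.A) f))
      (φ ⊗ₜ x)
    exact (mul_assoc (φ 1) (f x) (f' y)).symm.trans (congrArg (· * f' y) h.symm)
  lact_ract V V' f f' := by
    simp only [LinearMap.coe_mk, AddHom.coe_mk]
    rw [MonoidalCategory.comp_whiskerRight, Category.assoc,
      Functor.LaxMonoidal.μ_natural_left_assoc, MonoidalCategory.whiskerLeft_comp, Category.assoc,
      Functor.LaxMonoidal.μ_natural_right_assoc, ← Functor.map_comp, ← Functor.map_comp,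
      ← Functor.LaxMonoidal.associativity_assoc, ← Functor.map_comp]
    congr 3
    apply mc_ext
    rw [comp_lin, comp_lin, comp_lin, ← LinearMap.comp_assoc, ← LinearMap.comp_assoc,
      ← LinearMap.comp_assoc, evOne_mc, evOne_mc]
    refine TensorProduct.ext_threefold fun x φ y => ?_
    have h := LinearMap.congr_fun (evOne_mc (V := coreg k 𝒜.A ⊗ V') (dtens (evOne k 𝒜.A) f'))
      (φ ⊗ₜ y)
    have h' := LinearMap.congr_fun (evOne_mc (V := V ⊗ coreg k 𝒜.A) (dtens f (evOne k 𝒜.A)))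
      (x ⊗ₜ φ)
    exact (congrArg (· * f' y) h').trans ((mul_assoc (f x) (φ 1) (f' y)).trans
      (congrArg (f x * ·) h.symm))

end unitObject

section rigidColimits

variable {T : Type v} [Category.{w} T] [MonoidalCategory T] [RigidCategory T]

instance epi_whiskerLeft_of_rigid (P : T) {X Y : T} (f : X ⟶ Y) [Epi f] : Epi (P ◁ f) :=
  haveI := (tensorLeftAdjunction (ᘁP) P).leftAdjoint_preservesColimits
  inferInstanceAs (Epi ((tensorLeft P).map f))

instance epi_whiskerRight_of_rigid (P : T) {X Y : T} (f : X ⟶ Y) [Epi f] : Epi (f ▷ P) :=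
  haveI := (tensorRightAdjunction P (Pᘁ)).leftAdjoint_preservesColimits
  inferInstanceAs (Epi ((tensorRight P).map f))

variable [HasCoequalizers T]

/-- Tensor products with `P` preserve coequalizers: morphisms out of `P ⊗ coequalizer f g`. -/
noncomputable def descLeft (P : T) {B C Z : T} {f g : B ⟶ C} (h : P ⊗ C ⟶ Z)
    (w : P ◁ f ≫ h = P ◁ g ≫ h) : P ⊗ coequalizer f g ⟶ Z :=
  haveI := (tensorLeftAdjunction (ᘁP) P).leftAdjoint_preservesColimits
  (isColimitOfHasCoequalizerOfPreservesColimit (tensorLeft P) f g).desc (Cofork.ofπ h w)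

lemma π_descLeft (P : T) {B C Z : T} {f g : B ⟶ C} (h : P ⊗ C ⟶ Z)
    (w : P ◁ f ≫ h = P ◁ g ≫ h) : P ◁ coequalizer.π f g ≫ descLeft P h w = h :=
  haveI := (tensorLeftAdjunction (ᘁP) P).leftAdjoint_preservesColimits
  (isColimitOfHasCoequalizerOfPreservesColimit (tensorLeft P) f g).fac (Cofork.ofπ h w)
    WalkingParallelPair.one

/-- Tensor products with `P` preserve coequalizers: morphisms out of `coequalizer f g ⊗ P`. -/
noncomputable def descRight (P : T) {B C Z : T} {f g : B ⟶ C} (h : C ⊗ P ⟶ Z)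
    (w : f ▷ P ≫ h = g ▷ P ≫ h) : coequalizer f g ⊗ P ⟶ Z :=
  haveI := (tensorRightAdjunction P (Pᘁ)).leftAdjoint_preservesColimits
  (isColimitOfHasCoequalizerOfPreservesColimit (tensorRight P) f g).desc (Cofork.ofπ h w)

lemma π_descRight (P : T) {B C Z : T} {f g : B ⟶ C} (h : C ⊗ P ⟶ Z)
    (w : f ▷ P ≫ h = g ▷ P ≫ h) : coequalizer.π f g ▷ P ≫ descRight P h w = h :=
  haveI := (tensorRightAdjunction P (Pᘁ)).leftAdjoint_preservesColimits
  (isColimitOfHasCoequalizerOfPreservesColimit (tensorRight P) f g).fac (Cofork.ofπ h w)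
    WalkingParallelPair.one

end rigidColimits

section bimoduleCategory

open HopfRep

variable {k : Type u} [Field k] {T : Type v} [Category.{w} T] [Preadditive T]
  [Linear k T] [MonoidalCategory T]

/-- An `𝒜`-`ℬ` module in `T`. -/
structure HopfBimod (𝒜 ℬ : Realization k T) where
  obj : T
  str : BimodStr 𝒜 ℬ obj

namespace HopfBimod

variable {𝒜 ℬ 𝒞 𝒟 : Realization k T}

/-- Morphisms of modules: morphisms of `T` that commute with the trivializing isomorphisms. -/
@[ext]
structure Hom (X Y : HopfBimod 𝒜 ℬ) where
  hom : X.obj ⟶ Y.obj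
  left (V : 𝒜.Mod) (f : Module.Dual k V.carrier) :
    𝒜.F.obj V ◁ hom ≫ Y.str.lact V f = X.str.lact V f ≫ hom
  right (W : ℬ.Mod) (f : Module.Dual k W.carrier) :
    hom ▷ ℬ.F.obj W ≫ Y.str.ract W f = X.str.ract W f ≫ hom

instance : Category (HopfBimod 𝒜 ℬ) where
  Hom X Y := Hom X Y
  id X := ⟨𝟙 X.obj, fun V f => by simp, fun W f => by simp⟩
  comp p q := ⟨p.hom ≫ q.hom,
    fun V f => by
      rw [MonoidalCategory.whiskerLeft_comp, Category.assoc, q.left, ← Category.assoc, p.left,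
        Category.assoc],
    fun W f => by
      rw [MonoidalCategory.comp_whiskerRight, Category.assoc, q.right, ← Category.assoc, p.right,
        Category.assoc]⟩
  id_comp p := Hom.ext (Category.id_comp p.hom)
  comp_id p := Hom.ext (Category.comp_id p.hom)
  assoc p q r := Hom.ext (Category.assoc p.hom q.hom r.hom)

@[ext]
lemma hom_ext {X Y : HopfBimod 𝒜 ℬ} {p q : X ⟶ Y} (h : p.hom = q.hom) : p = q := Hom.ext h

@[simp] lemma id_hom (X : HopfBimod 𝒜 ℬ) : Hom.hom (𝟙 X) = 𝟙 X.obj := rfl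
@[simp] lemma comp_hom {X Y Z : HopfBimod 𝒜 ℬ} (p : X ⟶ Y) (q : Y ⟶ Z) :
    (p ≫ q).hom = p.hom ≫ q.hom := rfl

/-- A morphism of modules that is invertible in `T` is an isomorphism of modules. -/
def isoMk {X Y : HopfBimod 𝒜 ℬ} (p : X ⟶ Y) (q : Y.obj ⟶ X.obj) (h : p.hom ≫ q = 𝟙 _)
    (h' : q ≫ p.hom = 𝟙 _) : X ≅ Y where
  hom := p
  inv := ⟨q,
    fun V f => by
      rw [← Category.comp_id (X.str.lact V f), ← h, ← Category.assoc (X.str.lact V f), ← p.left,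
        Category.assoc, ← MonoidalCategory.whiskerLeft_comp_assoc, h']
      simp,
    fun W f => by
      rw [← Category.comp_id (X.str.ract W f), ← h, ← Category.assoc (X.str.ract W f), ← p.right,
        Category.assoc, ← MonoidalCategory.comp_whiskerRight_assoc, h']
      simp⟩
  hom_inv_id := hom_ext h
  inv_hom_id := hom_ext h'

variable [MonoidalPreadditive T] [MonoidalLinear k T]

/-- The unit `𝒜`-`𝒜` module `𝔄`. -/
noncomputable def unit (𝒜 : Realization k T) : HopfBimod 𝒜 𝒜 where
  obj := 𝒜.unitObj
  str := 𝒜.unitAct.toBimodStr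

/-- The inclusion in `𝔄` of the copy of `F(V)` that belongs to the functional `f`. -/
noncomputable def unitMc (𝒜 : Realization k T) {V : 𝒜.Mod} (f : Module.Dual k V.carrier) :
    𝒜.F.obj V ⟶ (unit 𝒜).obj := 𝒜.F.map (mc f)

/-- The action of `𝔄` on a left module: it sends the copy of `F(V)` that belongs to the functional
`f` by `X.str.lact V f`, that is, it is the sum of the canonical
morphisms `F(V) ⊗ V* ⊗ X → X`. -/
noncomputable def actL (X : HopfBimod 𝒜 ℬ) : (unit 𝒜).obj ⊗ X.obj ⟶ X.obj :=
  X.str.lact (coreg k 𝒜.A) (evOne k 𝒜.A)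

/-- The action of `𝔅` on a right module, the sum of the canonical
morphisms `X ⊗ G(W) ⊗ W* → X`. -/
noncomputable def actR (X : HopfBimod 𝒜 ℬ) : X.obj ⊗ (unit ℬ).obj ⟶ X.obj :=
  X.str.ract (coreg k ℬ.A) (evOne k ℬ.A)

lemma lact_actR (X : HopfBimod 𝒜 ℬ) (V : 𝒜.Mod) (f : Module.Dual k V.carrier) :
    X.str.lact V f ▷ (unit ℬ).obj ≫ X.actR = (α_ _ _ _).hom ≫ 𝒜.F.obj V ◁ X.actR ≫ X.str.lact V f :=
  X.str.lact_ract V _ f _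

lemma actL_ract (X : HopfBimod 𝒜 ℬ) (W : ℬ.Mod) (f : Module.Dual k W.carrier) :
    X.actL ▷ ℬ.F.obj W ≫ X.str.ract W f =
      (α_ _ _ _).hom ≫ (unit 𝒜).obj ◁ X.str.ract W f ≫ X.actL :=
  X.str.lact_ract _ W _ f

lemma mc_actL (X : HopfBimod 𝒜 ℬ) (V : 𝒜.Mod) (f : Module.Dual k V.carrier) :
    unitMc 𝒜 f ▷ X.obj ≫ X.actL = X.str.lact V f := by
  have h := X.str.lact_nat (mc f) (evOne k 𝒜.A)
  rwa [evOne_mc] at h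

lemma mc_actR (X : HopfBimod 𝒜 ℬ) (W : ℬ.Mod) (f : Module.Dual k W.carrier) :
    X.obj ◁ unitMc ℬ f ≫ X.actR = X.str.ract W f := by
  have h := X.str.ract_nat (mc f) (evOne k ℬ.A)
  rwa [evOne_mc] at h

section tensor

variable [HasCoequalizers T]

/-- The underlying object of the relative tensor product `X ⊗_ℬ Y`. -/
noncomputable def tobj (X : HopfBimod 𝒜 ℬ) (Y : HopfBimod ℬ 𝒞) : T :=
  coequalizer (X.actR ▷ Y.obj) ((α_ X.obj (unit ℬ).obj Y.obj).hom ≫ X.obj ◁ Y.actL)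

/-- The projection `X ⊗ Y → X ⊗_ℬ Y`. -/
noncomputable def proj (X : HopfBimod 𝒜 ℬ) (Y : HopfBimod ℬ 𝒞) : X.obj ⊗ Y.obj ⟶ tobj X Y :=
  coequalizer.π _ _

instance (X : HopfBimod 𝒜 ℬ) (Y : HopfBimod ℬ 𝒞) : Epi (proj X Y) :=
  inferInstanceAs (Epi (coequalizer.π _ _))

lemma proj_cond' (X : HopfBimod 𝒜 ℬ) (Y : HopfBimod ℬ 𝒞) :
    X.actR ▷ Y.obj ≫ proj X Y = (α_ _ _ _).hom ≫ X.obj ◁ Y.actL ≫ proj X Y := by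
  have h : X.actR ▷ Y.obj ≫ proj X Y =
      ((α_ X.obj (unit ℬ).obj Y.obj).hom ≫ X.obj ◁ Y.actL) ≫ proj X Y := coequalizer.condition _ _
  rw [h, Category.assoc]

lemma proj_cond (X : HopfBimod 𝒜 ℬ) (Y : HopfBimod ℬ 𝒞) (W : ℬ.Mod)
    (f : Module.Dual k W.carrier) :
    X.str.ract W f ▷ Y.obj ≫ proj X Y =
      (α_ _ _ _).hom ≫ X.obj ◁ Y.str.lact W f ≫ proj X Y := by
  rw [← mc_actR, ← mc_actL, MonoidalCategory.comp_whiskerRight, Category.assoc, proj_cond']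
  simp

/-- Morphisms out of `X ⊗_ℬ Y`. -/
noncomputable def desc (X : HopfBimod 𝒜 ℬ) (Y : HopfBimod ℬ 𝒞) {Z : T} (h : X.obj ⊗ Y.obj ⟶ Z)
    (w : X.actR ▷ Y.obj ≫ h = (α_ _ _ _).hom ≫ X.obj ◁ Y.actL ≫ h) : tobj X Y ⟶ Z :=
  coequalizer.desc h (by rw [w, Category.assoc])

@[simp] lemma proj_desc (X : HopfBimod 𝒜 ℬ) (Y : HopfBimod ℬ 𝒞) {Z : T}
    (h : X.obj ⊗ Y.obj ⟶ Z)
    (w : X.actR ▷ Y.obj ≫ h = (α_ _ _ _).hom ≫ X.obj ◁ Y.actL ≫ h) :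
    proj X Y ≫ desc X Y h w = h := coequalizer.π_desc _ _

variable [RigidCategory T]

/-- Morphisms out of `P ⊗ (X ⊗_ℬ Y)`. -/
noncomputable def descL (P : T) (X : HopfBimod 𝒜 ℬ) (Y : HopfBimod ℬ 𝒞) {Z : T}
    (h : P ⊗ X.obj ⊗ Y.obj ⟶ Z)
    (w : P ◁ (X.actR ▷ Y.obj) ≫ h = P ◁ (α_ _ _ _).hom ≫ P ◁ X.obj ◁ Y.actL ≫ h) :
    P ⊗ tobj X Y ⟶ Z :=
  descLeft P h (by rw [w]; simp)

@[simp] lemma proj_descL (P : T) (X : HopfBimod 𝒜 ℬ) (Y : HopfBimod ℬ 𝒞) {Z : T}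
    (h : P ⊗ X.obj ⊗ Y.obj ⟶ Z)
    (w : P ◁ (X.actR ▷ Y.obj) ≫ h = P ◁ (α_ _ _ _).hom ≫ P ◁ X.obj ◁ Y.actL ≫ h) :
    P ◁ proj X Y ≫ descL P X Y h w = h := π_descLeft P h _

/-- Morphisms out of `(X ⊗_ℬ Y) ⊗ P`. -/
noncomputable def descR (P : T) (X : HopfBimod 𝒜 ℬ) (Y : HopfBimod ℬ 𝒞) {Z : T}
    (h : (X.obj ⊗ Y.obj) ⊗ P ⟶ Z)
    (w : X.actR ▷ Y.obj ▷ P ≫ h = (α_ _ _ _).hom ▷ P ≫ (X.obj ◁ Y.actL) ▷ P ≫ h) :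
    tobj X Y ⊗ P ⟶ Z :=
  descRight P h (by rw [w]; simp)

@[simp] lemma proj_descR (P : T) (X : HopfBimod 𝒜 ℬ) (Y : HopfBimod ℬ 𝒞) {Z : T}
    (h : (X.obj ⊗ Y.obj) ⊗ P ⟶ Z)
    (w : X.actR ▷ Y.obj ▷ P ≫ h = (α_ _ _ _).hom ▷ P ≫ (X.obj ◁ Y.actL) ▷ P ≫ h) :
    proj X Y ▷ P ≫ descR P X Y h w = h := π_descRight P h _

/-- The left action of `F(V)` on `X ⊗_ℬ Y`, through the one on `X`. -/
noncomputable def tlact (X : HopfBimod 𝒜 ℬ) (Y : HopfBimod ℬ 𝒞) (V : 𝒜.Mod)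
    (f : Module.Dual k V.carrier) : 𝒜.F.obj V ⊗ tobj X Y ⟶ tobj X Y :=
  descL (𝒜.F.obj V) X Y ((α_ _ _ _).inv ≫ X.str.lact V f ▷ Y.obj ≫ proj X Y) (by
    have h1 : 𝒜.F.obj V ◁ (X.actR ▷ Y.obj) ≫ (α_ _ _ _).inv ≫ X.str.lact V f ▷ Y.obj =
        𝒜.F.obj V ◁ (α_ _ _ _).hom ≫ (α_ _ _ _).inv ≫ X.str.lact V f ▷ ((unit ℬ).obj ⊗ Y.obj) ≫
          (α_ _ _ _).inv ≫ X.actR ▷ Y.obj := by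
      have h2 := congrArg (fun t => t ▷ Y.obj) (X.lact_actR V f)
      simp only [comp_whiskerRight, MonoidalCategory.whisker_assoc, Category.assoc] at h2
      simp [h2]
    have h3 := X.proj_cond' Y
    rw [reassoc_of% h1, h3, Iso.inv_hom_id_assoc, ← whisker_exchange_assoc]
    simp)

lemma proj_tlact (X : HopfBimod 𝒜 ℬ) (Y : HopfBimod ℬ 𝒞) (V : 𝒜.Mod)
    (f : Module.Dual k V.carrier) : 𝒜.F.obj V ◁ proj X Y ≫ tlact X Y V f =
      (α_ _ _ _).inv ≫ X.str.lact V f ▷ Y.obj ≫ proj X Y := proj_descL _ _ _ _ _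

/-- The right action of `G(W)` on `X ⊗_ℬ Y`, through the one on `Y`. -/
noncomputable def tract (X : HopfBimod 𝒜 ℬ) (Y : HopfBimod ℬ 𝒞) (W : 𝒞.Mod)
    (f : Module.Dual k W.carrier) : tobj X Y ⊗ 𝒞.F.obj W ⟶ tobj X Y :=
  descR (𝒞.F.obj W) X Y ((α_ _ _ _).hom ≫ X.obj ◁ Y.str.ract W f ≫ proj X Y) (by
    have h1 : (X.obj ◁ Y.actL) ▷ 𝒞.F.obj W ≫ (α_ _ _ _).hom ≫ X.obj ◁ Y.str.ract W f =
        (α_ _ _ _).inv ▷ 𝒞.F.obj W ≫ (α_ _ _ _).hom ≫ (X.obj ⊗ (unit ℬ).obj) ◁ Y.str.ract W f ≫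
          (α_ _ _ _).hom ≫ X.obj ◁ Y.actL := by
      have h2 := congrArg (fun t => X.obj ◁ t) (Y.actL_ract W f)
      simp only [MonoidalCategory.whiskerLeft_comp] at h2
      simp [h2]
    have h3 := X.proj_cond' Y
    rw [reassoc_of% h1, ← h3, hom_inv_whiskerRight_assoc, whisker_exchange_assoc]
    simp)

lemma proj_tract (X : HopfBimod 𝒜 ℬ) (Y : HopfBimod ℬ 𝒞) (W : 𝒞.Mod)
    (f : Module.Dual k W.carrier) : proj X Y ▷ 𝒞.F.obj W ≫ tract X Y W f =
      (α_ _ _ _).hom ≫ X.obj ◁ Y.str.ract W f ≫ proj X Y := proj_descR _ _ _ _ _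

end tensor

end HopfBimod

end bimoduleCategory

section bimoduleTensor

open HopfRep

variable {k : Type u} [Field k] {T : Type v} [Category.{w} T] [Preadditive T]
  [Linear k T] [MonoidalCategory T] [HasCoequalizers T] [RigidCategory T]
  [MonoidalPreadditive T] [MonoidalLinear k T] {𝒜 ℬ 𝒞 𝒟 : Realization k T}

namespace HopfBimod

lemma lact_nat_tensor (X : HopfBimod 𝒜 ℬ) (Y : HopfBimod ℬ 𝒞) {V V' : 𝒜.Mod} (g : V ⟶ V')
    (f : Module.Dual k V'.carrier) :
    𝒜.F.map g ▷ tobj X Y ≫ tlact X Y V' f = tlact X Y V (f ∘ₗ g.lin) := by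
  rw [← cancel_epi (𝒜.F.obj V ◁ proj X Y), whisker_exchange_assoc, proj_tlact, proj_tlact,
    ← X.str.lact_nat]
  simp

lemma ract_nat_tensor (X : HopfBimod 𝒜 ℬ) (Y : HopfBimod ℬ 𝒞) {V V' : 𝒞.Mod} (g : V ⟶ V')
    (f : Module.Dual k V'.carrier) :
    tobj X Y ◁ 𝒞.F.map g ≫ tract X Y V' f = tract X Y V (f ∘ₗ g.lin) := by
  rw [← cancel_epi (proj X Y ▷ 𝒞.F.obj V), ← whisker_exchange_assoc, proj_tract, proj_tract,
    ← Y.str.ract_nat]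
  simp

lemma lact_unit_tensor (X : HopfBimod 𝒜 ℬ) (Y : HopfBimod ℬ 𝒞) :
    ε 𝒜.F ▷ tobj X Y ≫ tlact X Y (𝟙_ _) (LinearMap.id : k →ₗ[k] k) = (λ_ _).hom := by
  rw [← cancel_epi (𝟙_ T ◁ proj X Y), whisker_exchange_assoc, proj_tlact]
  have h := congrArg (fun t => t ▷ Y.obj) X.str.lact_unit
  simp only [comp_whiskerRight] at h
  simp [reassoc_of% h]

lemma ract_unit_tensor (X : HopfBimod 𝒜 ℬ) (Y : HopfBimod ℬ 𝒞) :
    tobj X Y ◁ ε 𝒞.F ≫ tract X Y (𝟙_ _) (LinearMap.id : k →ₗ[k] k) = (ρ_ _).hom := by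
  rw [← cancel_epi (proj X Y ▷ 𝟙_ T), ← whisker_exchange_assoc, proj_tract]
  have h := congrArg (fun t => X.obj ◁ t) Y.str.ract_unit
  simp only [MonoidalCategory.whiskerLeft_comp] at h
  simp [reassoc_of% h]

lemma lact_tensor_tensor (X : HopfBimod 𝒜 ℬ) (Y : HopfBimod ℬ 𝒞) (V V' : 𝒜.Mod)
    (f : Module.Dual k V.carrier) (f' : Module.Dual k V'.carrier) :
    μ 𝒜.F V V' ▷ tobj X Y ≫ tlact X Y (V ⊗ V') (dtens f f') =
      (α_ _ _ _).hom ≫ 𝒜.F.obj V ◁ tlact X Y V' f' ≫ tlact X Y V f := by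
  rw [← cancel_epi ((𝒜.F.obj V ⊗ 𝒜.F.obj V') ◁ proj X Y), whisker_exchange_assoc, proj_tlact]
  have h := congrArg (fun t => t ▷ Y.obj) (X.str.lact_tensor V V' f f')
  simp only [comp_whiskerRight] at h
  have h2 := congrArg (fun t => 𝒜.F.obj V ◁ t) (X.proj_tlact Y V' f')
  simp only [MonoidalCategory.whiskerLeft_comp] at h2
  have h3 := X.proj_tlact Y V f
  simp [reassoc_of% h, reassoc_of% h2, h3]

lemma ract_tensor_tensor (X : HopfBimod 𝒜 ℬ) (Y : HopfBimod ℬ 𝒞) (W W' : 𝒞.Mod)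
    (f : Module.Dual k W.carrier) (f' : Module.Dual k W'.carrier) :
    tobj X Y ◁ μ 𝒞.F W W' ≫ tract X Y (W ⊗ W') (dtens f f') =
      (α_ _ _ _).inv ≫ tract X Y W f ▷ 𝒞.F.obj W' ≫ tract X Y W' f' := by
  rw [← cancel_epi (proj X Y ▷ (𝒞.F.obj W ⊗ 𝒞.F.obj W')), ← whisker_exchange_assoc, proj_tract]
  have h := congrArg (fun t => X.obj ◁ t) (Y.str.ract_tensor W W' f f')
  simp only [MonoidalCategory.whiskerLeft_comp] at h
  have h2 := congrArg (fun t => t ▷ 𝒞.F.obj W') (X.proj_tract Y W f)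
  simp only [comp_whiskerRight] at h2
  have h3 := X.proj_tract Y W' f'
  simp [reassoc_of% h, reassoc_of% h2, h3]

lemma lact_ract_tensor (X : HopfBimod 𝒜 ℬ) (Y : HopfBimod ℬ 𝒞) (V : 𝒜.Mod) (W : 𝒞.Mod)
    (f : Module.Dual k V.carrier) (f' : Module.Dual k W.carrier) :
    tlact X Y V f ▷ 𝒞.F.obj W ≫ tract X Y W f' =
      (α_ _ _ _).hom ≫ 𝒜.F.obj V ◁ tract X Y W f' ≫ tlact X Y V f := by
  rw [← cancel_epi ((𝒜.F.obj V ◁ proj X Y) ▷ 𝒞.F.obj W)]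
  have h2 := congrArg (fun t => t ▷ 𝒞.F.obj W) (X.proj_tlact Y V f)
  simp only [comp_whiskerRight] at h2
  have h3 := congrArg (fun t => 𝒜.F.obj V ◁ t) (X.proj_tract Y W f')
  simp only [MonoidalCategory.whiskerLeft_comp] at h3
  rw [reassoc_of% h2, proj_tract]
  simp only [MonoidalCategory.whisker_assoc, Category.assoc, Iso.inv_hom_id_assoc]
  rw [reassoc_of% h3, proj_tlact]
  simp only [associator_naturality_left_assoc,
    ← whisker_exchange_assoc, associator_inv_naturality_right_assoc]
  simp

lemma tlact_add (X : HopfBimod 𝒜 ℬ) (Y : HopfBimod ℬ 𝒞) (V : 𝒜.Mod)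
    (f g : Module.Dual k V.carrier) : tlact X Y V (f + g) = tlact X Y V f + tlact X Y V g := by
  rw [← cancel_epi (𝒜.F.obj V ◁ proj X Y), Preadditive.comp_add, proj_tlact, proj_tlact,
    proj_tlact]
  simp

lemma tlact_smul (X : HopfBimod 𝒜 ℬ) (Y : HopfBimod ℬ 𝒞) (V : 𝒜.Mod) (c : k)
    (f : Module.Dual k V.carrier) : tlact X Y V (c • f) = c • tlact X Y V f := by
  rw [← cancel_epi (𝒜.F.obj V ◁ proj X Y), Linear.comp_smul, proj_tlact, proj_tlact]
  simp

lemma tract_add (X : HopfBimod 𝒜 ℬ) (Y : HopfBimod ℬ 𝒞) (W : 𝒞.Mod)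
    (f g : Module.Dual k W.carrier) : tract X Y W (f + g) = tract X Y W f + tract X Y W g := by
  rw [← cancel_epi (proj X Y ▷ 𝒞.F.obj W), Preadditive.comp_add, proj_tract, proj_tract,
    proj_tract]
  simp

lemma tract_smul (X : HopfBimod 𝒜 ℬ) (Y : HopfBimod ℬ 𝒞) (W : 𝒞.Mod) (c : k)
    (f : Module.Dual k W.carrier) : tract X Y W (c • f) = c • tract X Y W f := by
  rw [← cancel_epi (proj X Y ▷ 𝒞.F.obj W), Linear.comp_smul, proj_tract, proj_tract]
  simp

/-- The relative tensor product `X ⊗_ℬ Y`. -/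
noncomputable def tensor (X : HopfBimod 𝒜 ℬ) (Y : HopfBimod ℬ 𝒞) : HopfBimod 𝒜 𝒞 where
  obj := tobj X Y
  str := ActStr.toBimodStr
    { lact := fun V => ⟨⟨tlact X Y V, tlact_add X Y V⟩, tlact_smul X Y V⟩
      ract := fun W => ⟨⟨tract X Y W, tract_add X Y W⟩, tract_smul X Y W⟩
      lact_nat := lact_nat_tensor X Y
      ract_nat := ract_nat_tensor X Y
      lact_unit := lact_unit_tensor X Y
      ract_unit := ract_unit_tensor X Y
      lact_tensor := lact_tensor_tensor X Y
      ract_tensor := ract_tensor_tensor X Y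
      lact_ract := lact_ract_tensor X Y }

/-- The projection `X ⊗ Y → X ⊗_ℬ Y`. -/
noncomputable def prj (X : HopfBimod 𝒜 ℬ) (Y : HopfBimod ℬ 𝒞) :
    X.obj ⊗ Y.obj ⟶ (tensor X Y).obj := proj X Y

instance (X : HopfBimod 𝒜 ℬ) (Y : HopfBimod ℬ 𝒞) : Epi (prj X Y) :=
  inferInstanceAs (Epi (proj X Y))

lemma prj_cond (X : HopfBimod 𝒜 ℬ) (Y : HopfBimod ℬ 𝒞) :
    X.actR ▷ Y.obj ≫ prj X Y = (α_ _ _ _).hom ≫ X.obj ◁ Y.actL ≫ prj X Y := proj_cond' X Y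

/-- Morphisms out of `X ⊗_ℬ Y`. -/
noncomputable def tdesc (X : HopfBimod 𝒜 ℬ) (Y : HopfBimod ℬ 𝒞) {Z : T} (h : X.obj ⊗ Y.obj ⟶ Z)
    (w : X.actR ▷ Y.obj ≫ h = (α_ _ _ _).hom ≫ X.obj ◁ Y.actL ≫ h) : (tensor X Y).obj ⟶ Z :=
  desc X Y h w

@[simp] lemma prj_tdesc (X : HopfBimod 𝒜 ℬ) (Y : HopfBimod ℬ 𝒞) {Z : T}
    (h : X.obj ⊗ Y.obj ⟶ Z)
    (w : X.actR ▷ Y.obj ≫ h = (α_ _ _ _).hom ≫ X.obj ◁ Y.actL ≫ h) :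
    prj X Y ≫ tdesc X Y h w = h := proj_desc X Y h w

lemma prj_lact (X : HopfBimod 𝒜 ℬ) (Y : HopfBimod ℬ 𝒞) (V : 𝒜.Mod)
    (f : Module.Dual k V.carrier) : 𝒜.F.obj V ◁ prj X Y ≫ (tensor X Y).str.lact V f =
      (α_ _ _ _).inv ≫ X.str.lact V f ▷ Y.obj ≫ prj X Y := proj_tlact X Y V f

lemma prj_ract (X : HopfBimod 𝒜 ℬ) (Y : HopfBimod ℬ 𝒞) (W : 𝒞.Mod)
    (f : Module.Dual k W.carrier) : prj X Y ▷ 𝒞.F.obj W ≫ (tensor X Y).str.ract W f =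
      (α_ _ _ _).hom ≫ X.obj ◁ Y.str.ract W f ≫ prj X Y := proj_tract X Y W f

end HopfBimod

end bimoduleTensor

section bimoduleBicategory

open HopfRep

variable {k : Type u} [Field k] {T : Type v} [Category.{w} T] [Preadditive T]
  [Linear k T] [MonoidalCategory T] [HasCoequalizers T] [RigidCategory T]
  [MonoidalPreadditive T] [MonoidalLinear k T] {𝒜 ℬ 𝒞 𝒟 : Realization k T}

namespace HopfBimod

/-- Morphisms out of `X ⊗_ℬ Y` are determined by their composites with the projection. -/
lemma prj_ext {X : HopfBimod 𝒜 ℬ} {Y : HopfBimod ℬ 𝒞} {Z : HopfBimod 𝒜 𝒞}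
    {p q : tensor X Y ⟶ Z} (h : prj X Y ≫ p.hom = prj X Y ≫ q.hom) : p = q :=
  hom_ext ((cancel_epi (prj X Y)).1 h)

/-- A morphism `X ⊗ Y → Z` that is balanced over `ℬ` and commutes with the outer actions
descends to a morphism of modules. -/
noncomputable def descHom (X : HopfBimod 𝒜 ℬ) (Y : HopfBimod ℬ 𝒞) (Z : HopfBimod 𝒜 𝒞)
    (h : X.obj ⊗ Y.obj ⟶ Z.obj)
    (w : X.actR ▷ Y.obj ≫ h = (α_ _ _ _).hom ≫ X.obj ◁ Y.actL ≫ h)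
    (hl : ∀ (V : 𝒜.Mod) (f : Module.Dual k V.carrier),
      𝒜.F.obj V ◁ h ≫ Z.str.lact V f = (α_ _ _ _).inv ≫ X.str.lact V f ▷ Y.obj ≫ h)
    (hr : ∀ (W : 𝒞.Mod) (f : Module.Dual k W.carrier),
      h ▷ 𝒞.F.obj W ≫ Z.str.ract W f = (α_ _ _ _).hom ≫ X.obj ◁ Y.str.ract W f ≫ h) :
    tensor X Y ⟶ Z where
  hom := tdesc X Y h w
  left V f := by
    rw [← cancel_epi (𝒜.F.obj V ◁ prj X Y), ← MonoidalCategory.whiskerLeft_comp_assoc,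
      reassoc_of% (prj_lact X Y V f)]
    simp only [prj_tdesc, hl]
  right W f := by
    rw [← cancel_epi (prj X Y ▷ 𝒞.F.obj W), ← comp_whiskerRight_assoc,
      reassoc_of% (prj_ract X Y W f)]
    simp only [prj_tdesc, hr]

@[simp] lemma prj_descHom (X : HopfBimod 𝒜 ℬ) (Y : HopfBimod ℬ 𝒞) (Z : HopfBimod 𝒜 𝒞)
    (h : X.obj ⊗ Y.obj ⟶ Z.obj) (w) (hl) (hr) : prj X Y ≫ (descHom X Y Z h w hl hr).hom = h :=
  prj_tdesc X Y h w

lemma hom_actL {X Y : HopfBimod 𝒜 ℬ} (p : X ⟶ Y) :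
    (unit 𝒜).obj ◁ p.hom ≫ Y.actL = X.actL ≫ p.hom := p.left _ _

lemma hom_actR {X Y : HopfBimod 𝒜 ℬ} (p : X ⟶ Y) :
    p.hom ▷ (unit ℬ).obj ≫ Y.actR = X.actR ≫ p.hom := p.right _ _

/-- The functoriality of `X ⊗_ℬ Y` in `X` and `Y`. -/
noncomputable def tensorMap {X X' : HopfBimod 𝒜 ℬ} {Y Y' : HopfBimod ℬ 𝒞} (p : X ⟶ X')
    (q : Y ⟶ Y') : tensor X Y ⟶ tensor X' Y' :=
  descHom X Y (tensor X' Y') ((p.hom ⊗ₘ q.hom) ≫ prj X' Y')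
    (by
      have h1 := congrArg (fun t => t ▷ Y.obj) (hom_actR p)
      have h2 := congrArg (fun t => X'.obj ◁ t) (hom_actL q)
      have h3 := prj_cond X' Y'
      simp only [comp_whiskerRight, MonoidalCategory.whiskerLeft_comp] at h1 h2
      rw [MonoidalCategory.tensorHom_def, Category.assoc, ← reassoc_of% h1, ← whisker_exchange_assoc, h3,
        whisker_exchange_assoc, ← reassoc_of% h2]
      simp)
    (fun V f => by
      have h1 := congrArg (fun t => t ▷ Y.obj) (p.left V f)
      simp only [comp_whiskerRight] at h1
      rw [MonoidalCategory.whiskerLeft_comp, Category.assoc, prj_lact, MonoidalCategory.tensorHom_def,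
        Category.assoc, ← reassoc_of% h1, ← whisker_exchange_assoc]
      simp)
    (fun W f => by
      have h1 := congrArg (fun t => X'.obj ◁ t) (q.right W f)
      simp only [MonoidalCategory.whiskerLeft_comp] at h1
      rw [MonoidalCategory.comp_whiskerRight, Category.assoc, prj_ract,
        MonoidalCategory.tensorHom_def, Category.assoc, whisker_exchange_assoc, ← reassoc_of% h1]
      simp)


@[simp] lemma prj_tensorMap {X X' : HopfBimod 𝒜 ℬ} {Y Y' : HopfBimod ℬ 𝒞} (p : X ⟶ X')
    (q : Y ⟶ Y') : prj X Y ≫ (tensorMap p q).hom = (p.hom ⊗ₘ q.hom) ≫ prj X' Y' :=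
  prj_descHom _ _ _ _ _ _ _

lemma prj_actL (X : HopfBimod 𝒜 ℬ) (Y : HopfBimod ℬ 𝒞) :
    (unit 𝒜).obj ◁ prj X Y ≫ (tensor X Y).actL = (α_ _ _ _).inv ≫ X.actL ▷ Y.obj ≫ prj X Y :=
  prj_lact X Y _ _

lemma prj_actR (X : HopfBimod 𝒜 ℬ) (Y : HopfBimod ℬ 𝒞) :
    prj X Y ▷ (unit 𝒞).obj ≫ (tensor X Y).actR = (α_ _ _ _).hom ≫ X.obj ◁ Y.actR ≫ prj X Y :=
  prj_ract X Y _ _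

/-- Morphisms out of `(X ⊗_ℬ Y) ⊗ P`. -/
noncomputable def tdescR (P : T) (X : HopfBimod 𝒜 ℬ) (Y : HopfBimod ℬ 𝒞) {Z : T}
    (h : (X.obj ⊗ Y.obj) ⊗ P ⟶ Z)
    (w : X.actR ▷ Y.obj ▷ P ≫ h = (α_ _ _ _).hom ▷ P ≫ (X.obj ◁ Y.actL) ▷ P ≫ h) :
    (tensor X Y).obj ⊗ P ⟶ Z := descR P X Y h w

@[simp] lemma prj_tdescR (P : T) (X : HopfBimod 𝒜 ℬ) (Y : HopfBimod ℬ 𝒞) {Z : T}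
    (h : (X.obj ⊗ Y.obj) ⊗ P ⟶ Z)
    (w : X.actR ▷ Y.obj ▷ P ≫ h = (α_ _ _ _).hom ▷ P ≫ (X.obj ◁ Y.actL) ▷ P ≫ h) :
    prj X Y ▷ P ≫ tdescR P X Y h w = h := proj_descR _ _ _ _ _

/-- Morphisms out of `P ⊗ (X ⊗_ℬ Y)`. -/
noncomputable def tdescL (P : T) (X : HopfBimod 𝒜 ℬ) (Y : HopfBimod ℬ 𝒞) {Z : T}
    (h : P ⊗ X.obj ⊗ Y.obj ⟶ Z)
    (w : P ◁ (X.actR ▷ Y.obj) ≫ h = P ◁ (α_ _ _ _).hom ≫ P ◁ X.obj ◁ Y.actL ≫ h) :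
    P ⊗ (tensor X Y).obj ⟶ Z := descL P X Y h w

@[simp] lemma prj_tdescL (P : T) (X : HopfBimod 𝒜 ℬ) (Y : HopfBimod ℬ 𝒞) {Z : T}
    (h : P ⊗ X.obj ⊗ Y.obj ⟶ Z)
    (w : P ◁ (X.actR ▷ Y.obj) ≫ h = P ◁ (α_ _ _ _).hom ≫ P ◁ X.obj ◁ Y.actL ≫ h) :
    P ◁ prj X Y ≫ tdescL P X Y h w = h := proj_descL _ _ _ _ _

/-- The associativity isomorphism before passing to the outer quotient. -/
noncomputable def assocPre (X : HopfBimod 𝒜 ℬ) (Y : HopfBimod ℬ 𝒞) (Z : HopfBimod 𝒞 𝒟) :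
    (tensor X Y).obj ⊗ Z.obj ⟶ (tensor X (tensor Y Z)).obj :=
  tdescR Z.obj X Y ((α_ _ _ _).hom ≫ X.obj ◁ prj Y Z ≫ prj X (tensor Y Z)) (by
    have h1 := prj_cond X (tensor Y Z)
    have h2 := congrArg (fun t => X.obj ◁ t) (prj_actL Y Z)
    simp only [MonoidalCategory.whiskerLeft_comp] at h2
    rw [associator_naturality_left_assoc, ← whisker_exchange_assoc, h1]
    simp [reassoc_of% h2])

lemma prj_assocPre (X : HopfBimod 𝒜 ℬ) (Y : HopfBimod ℬ 𝒞) (Z : HopfBimod 𝒞 𝒟) :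
    prj X Y ▷ Z.obj ≫ assocPre X Y Z =
      (α_ _ _ _).hom ≫ X.obj ◁ prj Y Z ≫ prj X (tensor Y Z) := prj_tdescR _ _ _ _ _

/-- The associativity morphism `(X ⊗_ℬ Y) ⊗_𝒞 Z → X ⊗_ℬ (Y ⊗_𝒞 Z)`. -/
noncomputable def assocHom (X : HopfBimod 𝒜 ℬ) (Y : HopfBimod ℬ 𝒞) (Z : HopfBimod 𝒞 𝒟) :
    tensor (tensor X Y) Z ⟶ tensor X (tensor Y Z) :=
  descHom (tensor X Y) Z (tensor X (tensor Y Z)) (assocPre X Y Z)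
    (by
      rw [← cancel_epi (prj X Y ▷ (unit 𝒞).obj ▷ Z.obj)]
      have h1 := congrArg (fun t => t ▷ Z.obj) (prj_actR X Y)
      have h2 := congrArg (fun t => X.obj ◁ t) (prj_cond Y Z)
      simp only [comp_whiskerRight, MonoidalCategory.whiskerLeft_comp] at h1 h2
      rw [reassoc_of% h1, associator_naturality_left_assoc, ← whisker_exchange_assoc,
        prj_assocPre]
      simp [reassoc_of% h2])
    (fun V f => by
      rw [← cancel_epi (𝒜.F.obj V ◁ prj X Y ▷ Z.obj)]
      have h1 := congrArg (fun t => 𝒜.F.obj V ◁ t) (prj_assocPre X Y Z)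
      have h2 := congrArg (fun t => t ▷ Z.obj) (prj_lact X Y V f)
      simp only [comp_whiskerRight, MonoidalCategory.whiskerLeft_comp] at h1 h2
      rw [reassoc_of% h1, prj_lact, associator_inv_naturality_middle_assoc, reassoc_of% h2,
        prj_assocPre, associator_inv_naturality_right_assoc, whisker_exchange_assoc]
      simp)
    (fun W f => by
      rw [← cancel_epi (prj X Y ▷ Z.obj ▷ 𝒟.F.obj W)]
      have h1 := congrArg (fun t => t ▷ 𝒟.F.obj W) (prj_assocPre X Y Z)
      have h2 := congrArg (fun t => X.obj ◁ t) (prj_ract Y Z W f)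
      simp only [comp_whiskerRight, MonoidalCategory.whiskerLeft_comp] at h1 h2
      rw [reassoc_of% h1, prj_ract, associator_naturality_left_assoc, ← whisker_exchange_assoc,
        prj_assocPre]
      simp [reassoc_of% h2])

lemma prj_assocHom (X : HopfBimod 𝒜 ℬ) (Y : HopfBimod ℬ 𝒞) (Z : HopfBimod 𝒞 𝒟) :
    prj X Y ▷ Z.obj ≫ prj (tensor X Y) Z ≫ (assocHom X Y Z).hom =
      (α_ _ _ _).hom ≫ X.obj ◁ prj Y Z ≫ prj X (tensor Y Z) := by
  rw [assocHom, prj_descHom, prj_assocPre]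

/-- The inverse of the associativity isomorphism before passing to the outer quotient. -/
noncomputable def assocInvPre (X : HopfBimod 𝒜 ℬ) (Y : HopfBimod ℬ 𝒞) (Z : HopfBimod 𝒞 𝒟) :
    X.obj ⊗ (tensor Y Z).obj ⟶ (tensor (tensor X Y) Z).obj :=
  tdescL X.obj Y Z ((α_ _ _ _).inv ≫ prj X Y ▷ Z.obj ≫ prj (tensor X Y) Z) (by
    have h1 := prj_cond (tensor X Y) Z
    have h2 := congrArg (fun t => t ▷ Z.obj) (prj_actR X Y)
    simp only [comp_whiskerRight] at h2
    rw [associator_inv_naturality_right_assoc, whisker_exchange_assoc]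
    have h3 : (tensor X Y).obj ◁ Z.actL ≫ prj (tensor X Y) Z =
      (α_ _ _ _).inv ≫ (tensor X Y).actR ▷ Z.obj ≫ prj (tensor X Y) Z := by rw [h1]; simp
    rw [h3, associator_inv_naturality_left_assoc, reassoc_of% h2]
    simp)

lemma prj_assocInvPre (X : HopfBimod 𝒜 ℬ) (Y : HopfBimod ℬ 𝒞) (Z : HopfBimod 𝒞 𝒟) :
    X.obj ◁ prj Y Z ≫ assocInvPre X Y Z =
      (α_ _ _ _).inv ≫ prj X Y ▷ Z.obj ≫ prj (tensor X Y) Z := prj_tdescL _ _ _ _ _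

/-- The inverse of the associativity isomorphism. -/
noncomputable def assocInv (X : HopfBimod 𝒜 ℬ) (Y : HopfBimod ℬ 𝒞) (Z : HopfBimod 𝒞 𝒟) :
    (tensor X (tensor Y Z)).obj ⟶ (tensor (tensor X Y) Z).obj :=
  tdesc X (tensor Y Z) (assocInvPre X Y Z) (by
    rw [← cancel_epi ((X.obj ⊗ (unit ℬ).obj) ◁ prj Y Z)]
    have h1 := congrArg (fun t => X.obj ◁ t) (prj_actL Y Z)
    have h2 := congrArg (fun t => t ▷ Z.obj) (prj_cond X Y)
    simp only [comp_whiskerRight, MonoidalCategory.whiskerLeft_comp] at h1 h2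
    rw [whisker_exchange_assoc, prj_assocInvPre, associator_naturality_right_assoc,
      reassoc_of% h1, prj_assocInvPre, associator_inv_naturality_left_assoc, reassoc_of% h2]
    simp)

lemma prj_assocInv (X : HopfBimod 𝒜 ℬ) (Y : HopfBimod ℬ 𝒞) (Z : HopfBimod 𝒞 𝒟) :
    X.obj ◁ prj Y Z ≫ prj X (tensor Y Z) ≫ assocInv X Y Z =
      (α_ _ _ _).inv ≫ prj X Y ▷ Z.obj ≫ prj (tensor X Y) Z := by
  rw [assocInv, prj_tdesc, prj_assocInvPre]

/-- The associativity isomorphism `(X ⊗_ℬ Y) ⊗_𝒞 Z ≅ X ⊗_ℬ (Y ⊗_𝒞 Z)`. -/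
noncomputable def assocIso (X : HopfBimod 𝒜 ℬ) (Y : HopfBimod ℬ 𝒞) (Z : HopfBimod 𝒞 𝒟) :
    tensor (tensor X Y) Z ≅ tensor X (tensor Y Z) :=
  isoMk (assocHom X Y Z) (assocInv X Y Z)
    (by
      rw [← cancel_epi (prj X Y ▷ Z.obj ≫ prj (tensor X Y) Z)]
      rw [Category.assoc, reassoc_of% (prj_assocHom X Y Z), prj_assocInv]
      simp)
    (by
      rw [← cancel_epi (X.obj ◁ prj Y Z ≫ prj X (tensor Y Z))]
      rw [Category.assoc, reassoc_of% (prj_assocInv X Y Z), prj_assocHom]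
      simp)

end HopfBimod

end bimoduleBicategory

section bimoduleUnitors

open HopfRep

variable {k : Type u} [Field k] {T : Type v} [Category.{w} T] [Preadditive T]
  [Linear k T] [MonoidalCategory T] [HasCoequalizers T] [RigidCategory T]
  [MonoidalPreadditive T] [MonoidalLinear k T] {𝒜 ℬ 𝒞 𝒟 : Realization k T}

namespace HopfBimod

lemma lact_actL (X : HopfBimod 𝒜 ℬ) (V : 𝒜.Mod) (f : Module.Dual k V.carrier) :
    (unit 𝒜).str.lact V f ▷ X.obj ≫ X.actL =
      (α_ _ _ _).hom ≫ 𝒜.F.obj V ◁ X.actL ≫ X.str.lact V f := by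
  have h := X.str.lact_tensor V (coreg k 𝒜.A) f (evOne k 𝒜.A)
  have h2 := X.mc_actL (V ⊗ coreg k 𝒜.A) (dtens f (evOne k 𝒜.A))
  have h3 : (unit 𝒜).str.lact V f = μ 𝒜.F V (coreg k 𝒜.A) ≫
      unitMc 𝒜 (V := V ⊗ coreg k 𝒜.A) (dtens f (evOne k 𝒜.A)) := rfl
  have h4 : (unit 𝒜).str.lact V f ▷ X.obj = μ 𝒜.F V (coreg k 𝒜.A) ▷ X.obj ≫
      unitMc 𝒜 (V := V ⊗ coreg k 𝒜.A) (dtens f (evOne k 𝒜.A)) ▷ X.obj := by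
    rw [h3]; exact MonoidalCategory.comp_whiskerRight _ _ _
  refine ((congrArg (· ≫ X.actL) h4).trans (Category.assoc _ _ _)).trans ?_
  exact (congrArg (_ ≫ ·) h2).trans h

lemma actR_ract (X : HopfBimod 𝒜 ℬ) (W : ℬ.Mod) (f : Module.Dual k W.carrier) :
    X.obj ◁ (unit ℬ).str.ract W f ≫ X.actR =
      (α_ _ _ _).inv ≫ X.actR ▷ ℬ.F.obj W ≫ X.str.ract W f := by
  have h := X.str.ract_tensor (coreg k ℬ.A) W (evOne k ℬ.A) f
  have h2 := X.mc_actR (coreg k ℬ.A ⊗ W) (dtens (evOne k ℬ.A) f)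
  have h3 : (unit ℬ).str.ract W f = μ ℬ.F (coreg k ℬ.A) W ≫
      unitMc ℬ (V := coreg k ℬ.A ⊗ W) (dtens (evOne k ℬ.A) f) := rfl
  have h4 : X.obj ◁ (unit ℬ).str.ract W f = X.obj ◁ μ ℬ.F (coreg k ℬ.A) W ≫
      X.obj ◁ unitMc ℬ (V := coreg k ℬ.A ⊗ W) (dtens (evOne k ℬ.A) f) := by
    rw [h3]; exact MonoidalCategory.whiskerLeft_comp _ _ _
  refine ((congrArg (· ≫ X.actR) h4).trans (Category.assoc _ _ _)).trans ?_
  exact (congrArg (_ ≫ ·) h2).trans h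

lemma unit_actL_eq_actR (𝒜 : Realization k T) : (unit 𝒜).actL = (unit 𝒜).actR := rfl

/-- The inclusion of the unit object in `𝔄`, as the multiple of the trivial module. -/
noncomputable def unitIncl (𝒜 : Realization k T) : 𝟙_ T ⟶ (unit 𝒜).obj :=
  ε 𝒜.F ≫ unitMc 𝒜 (V := 𝟙_ (HopfRep k 𝒜.A)) (LinearMap.id : k →ₗ[k] k)

lemma unitIncl_actL (X : HopfBimod 𝒜 ℬ) : unitIncl 𝒜 ▷ X.obj ≫ X.actL = (λ_ X.obj).hom := by
  rw [unitIncl, MonoidalCategory.comp_whiskerRight, Category.assoc, mc_actL]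
  exact X.str.lact_unit

lemma unitIncl_actR (X : HopfBimod 𝒜 ℬ) : X.obj ◁ unitIncl ℬ ≫ X.actR = (ρ_ X.obj).hom := by
  rw [unitIncl, MonoidalCategory.whiskerLeft_comp, Category.assoc, mc_actR]
  exact X.str.ract_unit

/-- The canonical morphism `𝔄 ⊗_𝒜 X → X`, rescaled by `c`. -/
noncomputable def leftHom (c : kˣ) (X : HopfBimod 𝒜 ℬ) : tensor (unit 𝒜) X ⟶ X :=
  descHom (unit 𝒜) X X ((c : k) • X.actL)
    (by
      have h : (unit 𝒜).actL ▷ X.obj ≫ X.actL = (α_ _ _ _).hom ≫ (unit 𝒜).obj ◁ X.actL ≫ X.actL :=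
        X.lact_actL (coreg k 𝒜.A) (evOne k 𝒜.A)
      rw [← unit_actL_eq_actR]
      simp only [Linear.comp_smul, h])
    (fun V f => by simp [lact_actL])
    (fun W f => by simp [actL_ract])

lemma prj_leftHom (c : kˣ) (X : HopfBimod 𝒜 ℬ) :
    prj (unit 𝒜) X ≫ (leftHom c X).hom = (c : k) • X.actL := prj_descHom _ _ _ _ _ _ _

/-- The canonical morphism `X ⊗_ℬ 𝔅 → X`, rescaled by `c`. -/
noncomputable def rightHom (c : kˣ) (X : HopfBimod 𝒜 ℬ) : tensor X (unit ℬ) ⟶ X :=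
  descHom X (unit ℬ) X ((c : k) • X.actR)
    (by
      have h : X.obj ◁ (unit ℬ).actR ≫ X.actR = (α_ _ _ _).inv ≫ X.actR ▷ (unit ℬ).obj ≫ X.actR :=
        X.actR_ract (coreg k ℬ.A) (evOne k ℬ.A)
      rw [unit_actL_eq_actR]
      simp only [Linear.comp_smul, h, Iso.hom_inv_id_assoc])
    (fun V f => by simp [lact_actR])
    (fun W f => by simp [actR_ract])

lemma prj_rightHom (c : kˣ) (X : HopfBimod 𝒜 ℬ) :
    prj X (unit ℬ) ≫ (rightHom c X).hom = (c : k) • X.actR := prj_descHom _ _ _ _ _ _ _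

/-- The left unit constraint. -/
noncomputable def leftIso (c : kˣ) (X : HopfBimod 𝒜 ℬ) : tensor (unit 𝒜) X ≅ X :=
  isoMk (leftHom c X) ((↑c⁻¹ : k) • ((λ_ X.obj).inv ≫ unitIncl 𝒜 ▷ X.obj ≫ prj (unit 𝒜) X))
    (by
      rw [← cancel_epi (prj (unit 𝒜) X), reassoc_of% (prj_leftHom c X)]
      have h1 := prj_cond (unit 𝒜) X
      have h2 := unitIncl_actL (unit 𝒜)
      have h3 : (unit 𝒜).obj ◁ X.actL ≫ prj (unit 𝒜) X = (α_ _ _ _).inv ≫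
        (unit 𝒜).actR ▷ X.obj ≫ prj (unit 𝒜) X := by
          rw [h1, Iso.inv_hom_id_assoc]
      simp only [Linear.comp_smul, Linear.smul_comp, smul_smul, Units.inv_mul, one_smul]
      rw [leftUnitor_inv_naturality_assoc, whisker_exchange_assoc, h3, ← unit_actL_eq_actR]
      have h4 := congrArg (fun t => t ▷ X.obj) h2
      simp only [comp_whiskerRight] at h4
      rw [associator_inv_naturality_left_assoc]
      rw [reassoc_of% h4]
      simp)
    (by
      rw [Linear.smul_comp, Category.assoc, Category.assoc, prj_leftHom]
      simp [unitIncl_actL, smul_smul])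

/-- The right unit constraint. -/
noncomputable def rightIso (c : kˣ) (X : HopfBimod 𝒜 ℬ) : tensor X (unit ℬ) ≅ X :=
  isoMk (rightHom c X) ((↑c⁻¹ : k) • ((ρ_ X.obj).inv ≫ X.obj ◁ unitIncl ℬ ≫ prj X (unit ℬ)))
    (by
      rw [← cancel_epi (prj X (unit ℬ)), reassoc_of% (prj_rightHom c X)]
      have h1 := prj_cond X (unit ℬ)
      have h2 := unitIncl_actR (unit ℬ)
      simp only [Linear.comp_smul, Linear.smul_comp, smul_smul, Units.inv_mul, one_smul]
      rw [rightUnitor_inv_naturality_assoc, ← whisker_exchange_assoc, h1, unit_actL_eq_actR]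
      have h4 := congrArg (fun t => X.obj ◁ t) h2
      simp only [MonoidalCategory.whiskerLeft_comp] at h4
      rw [associator_naturality_right_assoc, reassoc_of% h4]
      simp)
    (by
      rw [Linear.smul_comp, Category.assoc, Category.assoc, prj_rightHom]
      simp [unitIncl_actR, smul_smul])

end HopfBimod

end bimoduleUnitors

section bimoduleCoherence

variable {k : Type u} [Field k] {T : Type v} [Category.{w} T] [Preadditive T]
  [Linear k T] [MonoidalCategory T] [HasCoequalizers T] [RigidCategory T]
  [MonoidalPreadditive T] [MonoidalLinear k T] {𝒜 ℬ 𝒞 𝒟 ℰ : Realization k T}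

namespace HopfBimod

lemma prj_ext₃ {X : HopfBimod 𝒜 ℬ} {Y : HopfBimod ℬ 𝒞} {Z : HopfBimod 𝒞 𝒟} {U : HopfBimod 𝒜 𝒟}
    {p q : tensor (tensor X Y) Z ⟶ U}
    (h : prj X Y ▷ Z.obj ≫ prj (tensor X Y) Z ≫ p.hom =
      prj X Y ▷ Z.obj ≫ prj (tensor X Y) Z ≫ q.hom) : p = q :=
  prj_ext ((cancel_epi (prj X Y ▷ Z.obj)).1 h)

lemma tensorMap_id (X : HopfBimod 𝒜 ℬ) (Y : HopfBimod ℬ 𝒞) :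
    tensorMap (𝟙 X) (𝟙 Y) = 𝟙 (tensor X Y) :=
  prj_ext (by simp)

lemma tensorMap_comp {X X' X'' : HopfBimod 𝒜 ℬ} {Y Y' Y'' : HopfBimod ℬ 𝒞} (p : X ⟶ X')
    (p' : X' ⟶ X'') (q : Y ⟶ Y') (q' : Y' ⟶ Y'') :
    tensorMap (p ≫ p') (q ≫ q') = tensorMap p q ≫ tensorMap p' q' :=
  prj_ext (by
    have h := prj_tensorMap p q
    simp [reassoc_of% h])

lemma assoc_naturality {X X' : HopfBimod 𝒜 ℬ} {Y Y' : HopfBimod ℬ 𝒞} {Z Z' : HopfBimod 𝒞 𝒟}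
    (p : X ⟶ X') (q : Y ⟶ Y') (r : Z ⟶ Z') :
    tensorMap (tensorMap p q) r ≫ (assocIso X' Y' Z').hom =
      (assocIso X Y Z).hom ≫ tensorMap p (tensorMap q r) :=
  prj_ext₃ (by
    have h1 := prj_tensorMap (tensorMap p q) r
    have h2 := prj_tensorMap p q
    have h2' := congrArg (fun t => t ▷ Z.obj) h2
    have h3 := prj_tensorMap p (tensorMap q r)
    have h4 := prj_tensorMap q r
    have h4' := congrArg (fun t => X.obj ◁ t) h4
    have h5 := prj_assocHom X Y Z
    have h6 := prj_assocHom X' Y' Z'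
    simp only [comp_whiskerRight, MonoidalCategory.whiskerLeft_comp] at h2' h4'
    simp only [comp_hom, assocIso, isoMk]
    rw [reassoc_of% h1, reassoc_of% h5, h3, MonoidalCategory.tensorHom_def,
      MonoidalCategory.tensorHom_def']
    simp only [Category.assoc]
    rw [reassoc_of% h2', reassoc_of% h4', whisker_exchange_assoc, whisker_exchange_assoc,
      ← whisker_exchange_assoc (prj X' Y') r.hom, h6]
    simp [MonoidalCategory.tensorHom_def])

lemma left_naturality (c : kˣ) {X Y : HopfBimod 𝒜 ℬ} (p : X ⟶ Y) :
    tensorMap (𝟙 (unit 𝒜)) p ≫ (leftIso c Y).hom = (leftIso c X).hom ≫ p :=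
  prj_ext (by
    have h1 := prj_tensorMap (𝟙 (unit 𝒜)) p
    have h2 := prj_leftHom c X
    have h3 := prj_leftHom c Y
    simp only [comp_hom, leftIso, isoMk]
    rw [reassoc_of% h1, h3, reassoc_of% h2]
    simp [hom_actL])

lemma right_naturality (c : kˣ) {X Y : HopfBimod 𝒜 ℬ} (p : X ⟶ Y) :
    tensorMap p (𝟙 (unit ℬ)) ≫ (rightIso c Y).hom = (rightIso c X).hom ≫ p :=
  prj_ext (by
    have h1 := prj_tensorMap p (𝟙 (unit ℬ))
    have h2 := prj_rightHom c X
    have h3 := prj_rightHom c Y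
    simp only [comp_hom, rightIso, isoMk]
    rw [reassoc_of% h1, h3, reassoc_of% h2]
    simp [hom_actR])

lemma tensor_triangle (c : kˣ) (X : HopfBimod 𝒜 ℬ) (Y : HopfBimod ℬ 𝒞) :
    (assocIso X (unit ℬ) Y).hom ≫ tensorMap (𝟙 X) (leftIso c Y).hom =
      tensorMap (rightIso c X).hom (𝟙 Y) :=
  prj_ext₃ (by
    have h1 := prj_assocHom X (unit ℬ) Y
    have h2 := prj_tensorMap (𝟙 X) (leftIso c Y).hom
    have h3 := prj_tensorMap (rightIso c X).hom (𝟙 Y)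
    have h4 := prj_leftHom c Y
    have h4' := congrArg (fun t => X.obj ◁ t) h4
    have h5 := prj_rightHom c X
    have h5' := congrArg (fun t => t ▷ Y.obj) h5
    have h6 := prj_cond X Y
    simp only [comp_whiskerRight, MonoidalCategory.whiskerLeft_comp] at h4' h5'
    simp only [comp_hom, leftIso, rightIso, assocIso, isoMk] at *
    rw [reassoc_of% h1, h2, h3]
    simp [reassoc_of% h4', reassoc_of% h5', h6])

lemma tensor_pentagon (X : HopfBimod 𝒜 ℬ) (Y : HopfBimod ℬ 𝒞) (Z : HopfBimod 𝒞 𝒟)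
    (U : HopfBimod 𝒟 ℰ) :
    tensorMap (assocIso X Y Z).hom (𝟙 U) ≫ (assocIso X (tensor Y Z) U).hom ≫
        tensorMap (𝟙 X) (assocIso Y Z U).hom =
      (assocIso (tensor X Y) Z U).hom ≫ (assocIso X Y (tensor Z U)).hom :=
  prj_ext₃ (by
    have h1 := prj_tensorMap (assocIso X Y Z).hom (𝟙 U)
    have h2 := congrArg (fun t => t ▷ U.obj) (prj_assocHom X Y Z)
    have h3 := prj_assocHom X (tensor Y Z) U
    have h4 := prj_tensorMap (𝟙 X) (assocIso Y Z U).hom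
    have h5 := congrArg (fun t => X.obj ◁ t) (prj_assocHom Y Z U)
    have h6 := prj_assocHom (tensor X Y) Z U
    have h7 := prj_assocHom X Y (tensor Z U)
    simp only [comp_whiskerRight, MonoidalCategory.whiskerLeft_comp] at h2 h5
    simp only [comp_hom, assocIso, isoMk] at *
    rw [← cancel_epi (prj X Y ▷ Z.obj ▷ U.obj)]
    rw [reassoc_of% h1, reassoc_of% h6]
    simp only [id_hom, tensorHom_id]
    rw [reassoc_of% h2, reassoc_of% h3, h4]
    simp only [id_hom, id_tensorHom, MonoidalCategory.whisker_assoc, Category.assoc,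
      Iso.inv_hom_id_assoc]
    rw [reassoc_of% h5, associator_naturality_left_assoc, ← whisker_exchange_assoc, h7]
    simp)

end HopfBimod

/-- The bicategory of modules in `T`, for unit constraints that are specified by `ω`: the 0-cells are
the finite-dimensional Hopf algebras realized inside `T`. -/
@[ext]
structure MT (ω : Realization k T → kˣ) where
  alg : Realization k T

open HopfBimod in
/-- The 1-cells are the modules, the composite of an `𝒜`-`ℬ` module `X` and a `ℬ`-`𝒞` module `Y`
is `X ⊗_ℬ Y`, the identity 1-cells are the modules `𝔄`; the unit
constraints `𝔄 ⊗_𝒜 X → X` and `X ⊗_ℬ 𝔅 → X` are the canonical morphisms multiplied by the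
scalars `ω 𝒜` and `ω ℬ`. -/
noncomputable instance (ω : Realization k T → kˣ) : Bicategory (MT ω) where
  Hom 𝒜 ℬ := HopfBimod 𝒜.alg ℬ.alg
  id 𝒜 := unit 𝒜.alg
  comp X Y := tensor X Y
  homCategory 𝒜 ℬ := inferInstanceAs (Category (HopfBimod 𝒜.alg ℬ.alg))
  whiskerLeft X _ _ q := tensorMap (𝟙 X) q
  whiskerRight p Y := tensorMap p (𝟙 Y)
  associator X Y Z := assocIso X Y Z
  leftUnitor {𝒜 _} X := leftIso (ω 𝒜.alg) X
  rightUnitor {_ ℬ} X := rightIso (ω ℬ.alg) X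
  whiskerLeft_id X Y := tensorMap_id X Y
  whiskerLeft_comp X _ _ _ q q' := by
    rw [← tensorMap_comp, Category.comp_id]
  id_whiskerLeft p := by
    rw [← Category.assoc, Iso.eq_comp_inv]
    exact left_naturality _ p
  comp_whiskerLeft X Y Z Z' q := by
    rw [← Category.assoc, Iso.eq_comp_inv, ← assoc_naturality, tensorMap_id]
  id_whiskerRight X Y := tensorMap_id X Y
  comp_whiskerRight p p' Y := by
    rw [← tensorMap_comp, Category.comp_id]
  whiskerRight_id p := by
    rw [← Category.assoc, Iso.eq_comp_inv]
    exact right_naturality _ p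
  whiskerRight_comp p Y Z := by
    rw [Iso.eq_inv_comp, assoc_naturality, tensorMap_id]
  whisker_assoc X _ _ q Z := by
    rw [← Category.assoc, Iso.eq_comp_inv, assoc_naturality]
  whisker_exchange p q := by
    rw [← tensorMap_comp, ← tensorMap_comp]
    simp only [Category.comp_id, Category.id_comp]
  pentagon X Y Z U := tensor_pentagon X Y Z U
  triangle X Y := tensor_triangle _ X Y

end bimoduleCoherence

namespace HopfRep

variable {k : Type u} [Field k] {A : Type u} [Ring A] [HopfAlgebra k A]

/-- `V` is irreducible: it is nonzero, and `0` and `V` are its only submodules. -/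
def IsIrreducible (V : HopfRep k A) : Prop :=
  Nontrivial V.carrier ∧ ∀ N : Submodule k V.carrier,
    (∀ a : A, ∀ x ∈ N, V.ρ a x ∈ N) → N = ⊥ ∨ N = ⊤

end HopfRep

/-- A finite set of representatives of the isomorphism classes of irreducible `A`-modules. -/
structure IrrSystem (k : Type u) [Field k] (A : Type u) [Ring A] [HopfAlgebra k A] where
  ι : Type
  [fintype : Fintype ι]
  mod : ι → HopfRep k A
  irreducible (j : ι) : (mod j).IsIrreducible
  eq_of_iso {i j : ι} (e : mod i ≅ mod j) : i = j
  exists_iso (V : HopfRep k A) (hV : V.IsIrreducible) : ∃ j, Nonempty (V ≅ mod j)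

attribute [instance] IrrSystem.fintype

attribute [instance] Abelian.hasFiniteBiproducts

/-- `T` is semisimple: spaces of morphisms are finite-dimensional and each object is a
finite direct sum of simple objects. -/
structure IsSemisimpleCategory (k : Type u) [Field k] (T : Type v) [Category.{w} T] [Abelian T]
    [Linear k T] : Prop where
  finite_hom (X Y : T) : Module.Finite k (X ⟶ Y)
  exists_iso_biproduct (X : T) : ∃ (n : ℕ) (f : Fin n → T), (∀ i, Simple (f i)) ∧
    Nonempty (X ≅ ⨁ f)

section rigidity

open HopfRep

variable {k : Type u} [Field k] {T : Type v} [Category.{w} T] [Preadditive T]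
  [Linear k T] [MonoidalCategory T] {𝒜 ℬ 𝒞 : Realization k T}

namespace Realization

/-- The pairing `F(V*) ⊗ F(V) → I`. -/
noncomputable def pairing (𝒜 : Realization k T) (V : 𝒜.Mod) :
    𝒜.F.obj V.dual ⊗ 𝒜.F.obj V ⟶ 𝟙_ T :=
  μ 𝒜.F V.dual V ≫ 𝒜.F.map V.ev ≫ η 𝒜.F

/-- The copairing `I → F(V)* ⊗ F(V)`. -/
noncomputable def copairing (𝒜 : Realization k T) (V : 𝒜.Mod) :
    𝟙_ T ⟶ 𝒜.F.obj V.predual ⊗ 𝒜.F.obj V :=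
  ε 𝒜.F ≫ 𝒜.F.map V.coev' ≫ δ 𝒜.F V.predual V

end Realization

namespace HopfBimod

section dual

variable (X : HopfBimod 𝒜 ℬ) (Xd : T) [ExactPairing Xd X.obj]

/-- The transpose `G(W) ⊗ X* → X* ⊗ W` of the trivializing
isomorphism `W* ⊗ X → X ⊗ G(W*)`, that is, the composite
`G(W) X* → X* X G(W) X* → X* X G(W*) G(W) X* → X* X X* → X*` for `g` in `W*`. -/
noncomputable def transposeLeft (W : ℬ.Mod) (g : Module.Dual k W.carrier) :
    ℬ.F.obj W ⊗ Xd ⟶ Xd :=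
  (λ_ _).inv ≫ η_ Xd X.obj ▷ (ℬ.F.obj W ⊗ Xd) ≫ (α_ _ _ _).hom ≫
    Xd ◁ (X.str.rcoact W.dual g ▷ (ℬ.F.obj W ⊗ Xd) ≫ (α_ _ _ _).hom ≫
      X.obj ◁ ((α_ _ _ _).inv ≫ ℬ.pairing W ▷ Xd ≫ (λ_ _).hom) ≫ ε_ Xd X.obj) ≫ (ρ_ _).hom

/-- The transpose `X* ⊗ F(V) → V ⊗ X*` of the trivializing
isomorphism `X ⊗ V* → F(V*) ⊗ X`, that is, the composite
`X* F(V) → X* X X* F(V) → X* F(V*) X X* F(V) → X* F(V*) F(V) → X*` for `f` in `V*`. -/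
noncomputable def transposeRight (V : 𝒜.Mod) (f : Module.Dual k V.carrier) :
    Xd ⊗ 𝒜.F.obj V ⟶ Xd :=
  (λ_ _).inv ≫ η_ Xd X.obj ▷ (Xd ⊗ 𝒜.F.obj V) ≫ (α_ _ _ _).hom ≫
    Xd ◁ (X.str.lcoact V.dual f ▷ (Xd ⊗ 𝒜.F.obj V) ≫ (α_ _ _ _).hom ≫
      𝒜.F.obj V.dual ◁ ((α_ _ _ _).inv ≫ ε_ Xd X.obj ▷ 𝒜.F.obj V ≫ (λ_ _).hom) ≫
        𝒜.pairing V) ≫ (ρ_ _).hom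

/-- The structure of a `ℬ`-`𝒜` module on the dual object `X*` is given by the transposed
trivializing isomorphisms of `X`. -/
structure IsDualStr (S : BimodStr ℬ 𝒜 Xd) : Prop where
  lact_eq (W : ℬ.Mod) (g : Module.Dual k W.carrier) : S.lact W g = transposeLeft X Xd W g
  ract_eq (V : 𝒜.Mod) (f : Module.Dual k V.carrier) : S.ract V f = transposeRight X Xd V f

end dual

variable [MonoidalPreadditive T] [MonoidalLinear k T]

/-- The morphism `ε : X ⊗ X* → 𝔄 = ⨁ F(V) ⊗ V*`, the sum over the irreducible modules `V` of
`X ⊗ X* → X ⊗ V ⊗ V* ⊗ X* → F(V) ⊗ X ⊗ X* ⊗ V* → F(V) ⊗ V*` with the weight `dim V`. -/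
noncomputable def rigidityCounit (X : HopfBimod 𝒜 ℬ) (Xd : T) [ExactPairing Xd X.obj]
    (I : IrrSystem k 𝒜.A) : X.obj ⊗ Xd ⟶ (unit 𝒜).obj :=
  ∑ j, (Module.finrank k (I.mod j).carrier : k) • ∑ i,
    X.str.lcoact (I.mod j) (Module.finBasis k (I.mod j).carrier i) ▷ Xd ≫ (α_ _ _ _).hom ≫
      𝒜.F.obj (I.mod j) ◁ ε_ Xd X.obj ≫ (ρ_ _).hom ≫
        unitMc 𝒜 ((Module.finBasis k (I.mod j).carrier).coord i)

/-- The morphism `δ : 𝔅 = ⨁ G(W) ⊗ W* → X* ⊗ X`, the sum without weights of the morphisms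
`G(W) ⊗ W* → G(W) ⊗ W* ⊗ X* ⊗ X → X* ⊗ W ⊗ W* ⊗ X → X* ⊗ X`; see `unitMc_rigidityUnit`. -/
noncomputable def rigidityUnit (X : HopfBimod 𝒜 ℬ) (Xd : HopfBimod ℬ 𝒜)
    [ExactPairing Xd.obj X.obj] : (unit ℬ).obj ⟶ Xd.obj ⊗ X.obj :=
  (ρ_ _).inv ≫ (unit ℬ).obj ◁ η_ Xd.obj X.obj ≫ (α_ _ _ _).inv ≫ Xd.actL ▷ X.obj

/-- The component of `δ` on the copy of `G(W)` that belongs to the functional `g` in `W*`. -/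
lemma unitMc_rigidityUnit (X : HopfBimod 𝒜 ℬ) (Xd : HopfBimod ℬ 𝒜) [ExactPairing Xd.obj X.obj]
    (W : ℬ.Mod) (g : Module.Dual k W.carrier) :
    unitMc ℬ g ≫ rigidityUnit X Xd = (ρ_ _).inv ≫ ℬ.F.obj W ◁ η_ Xd.obj X.obj ≫
      (α_ _ _ _).inv ≫ Xd.str.lact W g ▷ X.obj := by
  rw [← mc_actL, rigidityUnit, rightUnitor_inv_naturality_assoc, ← whisker_exchange_assoc,
    associator_inv_naturality_left_assoc, MonoidalCategory.comp_whiskerRight]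

/-- The morphism `e` of `X ⊗ Y`, the sum with the weights `dim W / dim B` over the
irreducible modules `W` of the morphisms
`X ⊗ Y → X ⊗ G(W)* ⊗ G(W) ⊗ Y → W* ⊗ X ⊗ Y ⊗ W → X ⊗ Y`, where the last one is the
contraction of `W*` and `W`. -/
noncomputable def balancer (I : IrrSystem k ℬ.A) (X : HopfBimod 𝒜 ℬ) (Y : HopfBimod ℬ 𝒞) :
    X.obj ⊗ Y.obj ⟶ X.obj ⊗ Y.obj :=
  (Module.finrank k ℬ.A : k)⁻¹ • ∑ j, (Module.finrank k (I.mod j).carrier : k) • ∑ i,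
    X.obj ◁ ((λ_ _).inv ≫ ℬ.copairing (I.mod j) ▷ Y.obj ≫ (α_ _ _ _).hom) ≫ (α_ _ _ _).inv ≫
      (X.str.ract (I.mod j).predual (Module.Dual.eval k (I.mod j).carrier
          (Module.finBasis k (I.mod j).carrier i)) ⊗ₘ
        Y.str.lact (I.mod j) ((Module.finBasis k (I.mod j).carrier).coord i))

end HopfBimod

end rigidity

/-! For an element c of A*, the trivializing isomorphisms of an A-B module X give a morphism X → 𝔄 ⊗
X, the coaction `lcoact` of the coregular module at c; followed by the action of 𝔄 it is
multiplication by c(1). The weights dim(V) are explained by the identity Σ dim(V) χ_V = x, where x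
is the regular character (`IrrSystem.regularTrace_eq`). Hence ε is the coaction for x followed by
ε_X (`rigidityCounit_eq`), and e_B is dim(B)⁻¹ times the coaction on X for the regular character of
B, followed by the action on Y (`balancer_eq`).

Two properties of x are needed. One is x(1) = dim(A) ≠ 0. The other is that x is a two-sided
integral: x(a₁)a₂ = x(a)1 = a₁x(a₂). So the product of x with a matrix coefficient φ, in either
order, is φ(1)x, which makes ε a morphism of A-A modules (`counitOf_lact`, `counitOf_ract`) and
makes e_B balanced over B (`balance_balanced`). A balanced morphism absorbs the coaction for c up to
the factor c(1), so e_B is an idempotent whose image is the coequalizer (`balancer_image`). That ε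
is balanced over B, that δ is B-B linear and that e_A fixes δ follow from transposition and the
module axioms, without integrals.

In a zigzag the snake identity of (ε_X, δ_X) leaves the coaction for x followed by the action, that
is, dim(A) times the action (`unit_counit_left`, `unit_counit_right`). The unit constraints
contribute ω_A on one side and ω_B on the other, so both zigzags hold exactly when c · ω_A · dim(A)
= ω_B. A right action on X transposes to a left action on X*, and a left coaction to a right
coaction; the missing right action on X* is the inverse of that coaction. The construction is
reversible, so it yields left adjoints from left duals and right adjoints from right duals.

The integral property of x rests on the theorem of Larson and Radford that S² = 1. Semisimplicity of
T enters only through von Neumann regularity: it passes along F to A-modules, and makes A semisimple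
with a normalized two-sided integral Λ. The functional t(a) = Tr(y ↦ a S²(y)) is an integral on one
side by cyclicity of the trace (`trace_leftHit_mul`), and t(Λ) = 1. Its failure to be an integral on
the other side is measured by a group-like element w, and b w = w S⁴(b). As w has finite order, so
has S². On each matrix block it preserves, S² is conjugation by a matrix which may be scaled to have
roots of unity μᵢ as eigenvalues, and its trace there is |Σ μᵢ|²; the block of the counit
contributes 1. So t(1) = Tr(S²) ≠ 0, which forces w = 1 and S⁴ = 1. Finally Tr(S²) is an integer
multiple of dim(A), nonzero and of absolute value at most dim(A), whence S² = 1
(`antipodeSq_eq_self`) and t = x. -/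

section sweedler

/-! ### Sweedler calculus; the antipode reverses the coproduct. -/

open HopfAlgebra Coalgebra

variable {k : Type u} [Field k] {A : Type u} [Ring A] [HopfAlgebra k A]

/-- Coassociativity, for a function that is linear in each of three variables. -/
lemma sweedler_coassoc {M : Type*} [AddCommGroup M] [Module k M] (f : A → A → A → M)
    (h1 : ∀ y z, IsLinearMap k fun x => f x y z) (h2 : ∀ x z, IsLinearMap k fun y => f x y z)
    (h3 : ∀ x y, IsLinearMap k fun z => f x y z) (a : A) {ι : Type*} (r : Repr k a ι)
    {κ κ' : ι → Type*} (s : ∀ i, Repr k (r.left i) (κ i)) (t : ∀ i, Repr k (r.right i) (κ' i)) :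
    ∑ i ∈ r.index, ∑ j ∈ (s i).index, f ((s i).left j) ((s i).right j) (r.right i) =
      ∑ i ∈ r.index, ∑ j ∈ (t i).index, f (r.left i) ((t i).left j) ((t i).right j) := by
  let g (x : A) : A →ₗ[k] A →ₗ[k] M := LinearMap.mk₂ k (f x)
    (fun y y' z => (h2 x z).map_add y y') (fun c y z => (h2 x z).map_smul c y)
    (fun y z z' => (h3 x y).map_add z z') (fun c y z => (h3 x y).map_smul c z)
  let φ : A ⊗[k] (A ⊗[k] A) →ₗ[k] M := TensorProduct.lift
    { toFun := fun x => TensorProduct.lift (g x)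
      map_add' := fun x x' => TensorProduct.ext' fun y z => (h1 y z).map_add x x'
      map_smul' := fun c x => TensorProduct.ext' fun y z => (h1 y z).map_smul c x }
  have e := congrArg φ (sum_tmul_tmul_eq r s t)
  simp only [map_sum] at e
  exact e

/-- The counit laws, for linear functions. -/
lemma sweedler_counit_left {M : Type*} [AddCommGroup M] [Module k M] (f : A → M)
    (h : IsLinearMap k f) {a : A} {ι : Type*} (r : Repr k a ι) :
    ∑ i ∈ r.index, counit (R := k) (r.left i) • f (r.right i) = f a := by
  have e := congrArg (fun t => h.mk' f (TensorProduct.lid k A t)) (sum_counit_tmul_eq r)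
  simp only [map_sum, TensorProduct.lid_tmul, map_smul, one_smul] at e
  exact e

lemma sweedler_counit_right {M : Type*} [AddCommGroup M] [Module k M] (f : A → M)
    (h : IsLinearMap k f) {a : A} {ι : Type*} (r : Repr k a ι) :
    ∑ i ∈ r.index, counit (R := k) (r.right i) • f (r.left i) = f a := by
  have e := congrArg (fun t => h.mk' f (TensorProduct.rid k A t)) (sum_tmul_counit_eq r)
  simp only [map_sum, TensorProduct.rid_tmul, map_smul, one_smul] at e
  exact e

/-- The map `x ⊗ y ↦ S y ⊗ S x`. -/
noncomputable def antipodeSwap (k : Type u) [Field k] (A : Type u) [Ring A] [HopfAlgebra k A] :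
    A ⊗[k] A →ₗ[k] A ⊗[k] A :=
  TensorProduct.map (antipode k) (antipode k) ∘ₗ (TensorProduct.comm k A A).toLinearMap

@[simp] lemma antipodeSwap_tmul (x y : A) :
    antipodeSwap k A (x ⊗ₜ y) = antipode k y ⊗ₜ antipode k x := rfl

/-- In Sweedler notation the left side is x S(y₃) ⊗ y₁ S(y₂), and the second factor collapses to the
counit. -/
lemma tmul_mul_antipodeSwap (x y : A) :
    ∑ i ∈ (Repr.arbitrary k y).index, (x ⊗ₜ[k] (Repr.arbitrary k y).left i) *
      antipodeSwap k A (comul ((Repr.arbitrary k y).right i)) = (x * antipode k y) ⊗ₜ 1 := by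
  have h := sweedler_coassoc (k := k) (A := A)
    (fun u v w => (x * antipode k w) ⊗ₜ[k] (u * antipode k v))
    (fun _ _ => ⟨by intros; simp [add_mul, tmul_add], by intros; simp⟩)
    (fun _ _ => ⟨by intros; simp [mul_add, tmul_add], by intros; simp⟩)
    (fun _ _ => ⟨by intros; simp [mul_add, add_tmul], by intros; simp [smul_tmul']⟩) y
    (Repr.arbitrary k y) (fun i => Repr.arbitrary k _) (fun i => Repr.arbitrary k _)
  have e : ∀ i, (x ⊗ₜ[k] (Repr.arbitrary k y).left i) *
      antipodeSwap k A (comul ((Repr.arbitrary k y).right i)) =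
      ∑ j ∈ (Repr.arbitrary k ((Repr.arbitrary k y).right i)).index,
        (x * antipode k ((Repr.arbitrary k ((Repr.arbitrary k y).right i)).right j)) ⊗ₜ[k]
        ((Repr.arbitrary k y).left i *
          antipode k ((Repr.arbitrary k ((Repr.arbitrary k y).right i)).left j)) := by
    intro i
    rw [← (Repr.arbitrary k ((Repr.arbitrary k y).right i)).eq, map_sum, Finset.mul_sum]
    simp
  rw [Finset.sum_congr rfl fun i _ => e i, ← h]
  simp only [← tmul_sum, sum_mul_antipode_eq_smul, tmul_smul]
  exact sweedler_counit_left (k := k) (fun z => (x * antipode k z) ⊗ₜ[k] (1 : A))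
    ⟨by intros; simp [mul_add, add_tmul], by intros; simp [smul_tmul']⟩ _

/-- The element is y₁ S(y₄) ⊗ y₂ S(y₃); the inner pair collapses first, then the outer one. Thus the
swapped antipodes of the coproduct form a right convolution inverse of Δ : A → A ⊗ A. -/
lemma comul_mul_antipodeSwap (y : A) :
    ∑ i ∈ (Repr.arbitrary k y).index, comul ((Repr.arbitrary k y).left i) *
      antipodeSwap k A (comul ((Repr.arbitrary k y).right i)) =
        counit (R := k) y • (1 : A ⊗[k] A) := by
  have h := sweedler_coassoc (k := k) (A := A)
    (fun u v w => (u ⊗ₜ[k] v) * antipodeSwap k A (comul w))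
    (fun _ _ => ⟨by intros; simp [add_mul, add_tmul], by intros; simp [← smul_tmul']⟩)
    (fun _ _ => ⟨by intros; simp [add_mul, tmul_add], by intros; simp⟩)
    (fun _ _ => ⟨by intros; simp [mul_add], by intros; simp⟩) y
    (Repr.arbitrary k y) (fun i => Repr.arbitrary k _) (fun i => Repr.arbitrary k _)
  simp only [← Finset.sum_mul, (Repr.arbitrary k _).eq] at h
  rw [h]
  simp only [tmul_mul_antipodeSwap]
  rw [← sum_tmul, sum_mul_antipode_eq_smul, ← smul_tmul', Algebra.TensorProduct.one_def]

/-- The antipode reverses the comultiplication. -/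
lemma comul_antipode (a : A) :
    comul (antipode k a) = antipodeSwap k A (comul a) := by
  -- The composite Δ ∘ S is a left convolution inverse of Δ because Δ is multiplicative. The two
  -- bracketings of the triple convolution product identify it with the right inverse.
  have h := sweedler_coassoc (k := k) (A := A)
    (fun u v w => comul (R := k) (antipode k u) * (comul v * antipodeSwap k A (comul w)))
    (fun _ _ => ⟨by intros; simp [add_mul], by intros; simp⟩)
    (fun _ _ => ⟨by intros; simp [mul_add, add_mul], by intros; simp⟩)
    (fun _ _ => ⟨by intros; simp [mul_add], by intros; simp⟩) a
    (Repr.arbitrary k a) (fun i => Repr.arbitrary k _) (fun i => Repr.arbitrary k _)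
  simp only [← Finset.mul_sum, comul_mul_antipodeSwap] at h
  simp only [← mul_assoc, ← Finset.sum_mul, ← Bialgebra.comul_mul, ← map_sum,
    sum_antipode_mul_eq_smul] at h
  simp only [map_smul, Bialgebra.comul_one, smul_mul_assoc, one_mul, mul_smul_comm, mul_one] at h
  rw [sweedler_counit_right (k := k) (fun z => comul (R := k) (antipode k z))
      ⟨by intros; simp, by intros; simp⟩,
    sweedler_counit_left (k := k) (fun z => antipodeSwap k A (comul z))
      ⟨by intros; simp, by intros; simp⟩] at h
  exact h.symm

end sweedler

/-! ### Translation operators a ↦ p(a₁)a₂ and a ↦ a₁p(a₂), and a trace formula. -/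

section hits

open HopfAlgebra Coalgebra

variable {k : Type u} [Field k] {A : Type u} [Ring A] [HopfAlgebra k A]

/-- The operator `a ↦ p(a₁) a₂`. -/
noncomputable def leftHit (p : Module.Dual k A) : A →ₗ[k] A :=
  (TensorProduct.lid k A).toLinearMap ∘ₗ TensorProduct.map p LinearMap.id ∘ₗ comul

/-- The operator `a ↦ a₁ p(a₂)`. -/
noncomputable def rightHit (p : Module.Dual k A) : A →ₗ[k] A :=
  (TensorProduct.rid k A).toLinearMap ∘ₗ TensorProduct.map LinearMap.id p ∘ₗ comul

lemma leftHit_repr (p : Module.Dual k A) {a : A} {ι : Type*} (r : Repr k a ι) :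
    leftHit p a = ∑ i ∈ r.index, p (r.left i) • r.right i := by
  simp [leftHit, ← r.eq]

lemma rightHit_repr (p : Module.Dual k A) {a : A} {ι : Type*} (r : Repr k a ι) :
    rightHit p a = ∑ i ∈ r.index, p (r.right i) • r.left i := by
  simp [rightHit, ← r.eq]

/-- Both sides are p(a₁)q(a₂). This adjointness exchanges statements about left and right integrals.
-/
lemma apply_leftHit (p q : Module.Dual k A) (a : A) : q (leftHit p a) = p (rightHit q a) := by
  rw [leftHit_repr p (Repr.arbitrary k a), rightHit_repr q (Repr.arbitrary k a)]
  simp [mul_comm]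

lemma leftHit_counit : leftHit (counit : A →ₗ[k] k) = LinearMap.id := by
  ext a
  rw [leftHit_repr _ (Repr.arbitrary k a)]
  exact sweedler_counit_left (fun a => a) ⟨by simp, by simp⟩ _

lemma rightHit_counit : rightHit (counit : A →ₗ[k] k) = LinearMap.id := by
  ext a
  rw [rightHit_repr _ (Repr.arbitrary k a)]
  exact sweedler_counit_right (fun a => a) ⟨by simp, by simp⟩ _

/-- Both sides are p(a₁)q(a₂)a₃; `q ∘ₗ leftHit p` is the convolution product of p and q. -/
lemma leftHit_leftHit (p q : Module.Dual k A) (a : A) :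
    leftHit q (leftHit p a) = leftHit (q ∘ₗ leftHit p) a := by
  have h := sweedler_coassoc (k := k) (A := A) (fun u v w => (p u * q v) • w)
    (fun _ _ => ⟨by intros; simp [add_mul, add_smul], by intros; simp [smul_smul, mul_assoc]⟩)
    (fun _ _ => ⟨by intros; simp [mul_add, add_smul],
      by intros; simp [smul_smul, mul_left_comm]⟩)
    (fun _ _ => ⟨by intros; simp, by intros; simp [smul_smul, mul_comm]⟩) a
    (Repr.arbitrary k a) (fun i => Repr.arbitrary k _) (fun i => Repr.arbitrary k _)
  rw [leftHit_repr p (Repr.arbitrary k a), leftHit_repr _ (Repr.arbitrary k a), map_sum]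
  simp only [map_smul, LinearMap.comp_apply]
  rw [Finset.sum_congr rfl fun i _ => by
    rw [leftHit_repr q (Repr.arbitrary k ((Repr.arbitrary k a).right i)), Finset.smul_sum]]
  simp only [smul_smul]
  rw [← h]
  refine Finset.sum_congr rfl fun i _ => ?_
  rw [leftHit_repr p (Repr.arbitrary k ((Repr.arbitrary k a).left i))]
  simp [Finset.sum_smul]

/-- Cyclicity of the trace gives the invariance of `a ↦ Tr (y ↦ a φ(y))`. -/
lemma trace_leftHit_mul [Module.Finite k A] (φ θ : A →ₗ[k] A) (p : Module.Dual k A)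
    (hφ : ∀ y, comul (R := k) (φ y) = TensorProduct.map φ φ (comul y))
    (hθ : ∀ y, ∑ i ∈ (Repr.arbitrary k y).index,
      φ ((Repr.arbitrary k y).right i) * θ ((Repr.arbitrary k y).left i) =
        counit (R := k) y • (1 : A))
    (hp : ∀ y, ∑ i ∈ (Repr.arbitrary k y).index,
      p ((Repr.arbitrary k y).left i * θ ((Repr.arbitrary k y).right i)) =
        counit (R := k) y * p 1) (a : A) :
    LinearMap.trace k A (LinearMap.mulLeft k (leftHit p a) ∘ₗ φ) =
      p 1 * LinearMap.trace k A (LinearMap.mulLeft k a ∘ₗ φ) := by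
  set e := Module.finBasis k A
  set Q := fun i => leftHit (p ∘ₗ LinearMap.mulLeft k (e i) ∘ₗ θ) with hQ
  set D := fun i => leftHit (e.coord i) with hD
  have hsum : ∀ x z : A, ∑ i, e.coord i x * p (e i * z) = p (x * z) := by
    intro x z
    conv_rhs => rw [← e.sum_repr x, Finset.sum_mul, map_sum]
    simp
  -- Here `D i` is z ↦ eⁱ(z₁)z₂ and `Q i` is y ↦ p(eᵢ θ(y₁))y₂. Summing over the dual bases turns
  -- the right side into p(a₁ φ(y₂) θ(y₁)) a₂ φ(y₃), and `hθ` cancels φ(y₂) θ(y₁).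
  have h1 : LinearMap.mulLeft k (leftHit p a) ∘ₗ φ =
      ∑ i, D i ∘ₗ (LinearMap.mulLeft k a ∘ₗ φ) ∘ₗ Q i := by
    ext y
    simp only [LinearMap.comp_apply, LinearMap.sum_apply, LinearMap.mulLeft_apply]
    have hDm : ∀ i z, D i (a * φ z) = ∑ j ∈ (Repr.arbitrary k a).index,
        ∑ l ∈ (Repr.arbitrary k z).index,
          e.coord i ((Repr.arbitrary k a).left j * φ ((Repr.arbitrary k z).left l)) •
            ((Repr.arbitrary k a).right j * φ ((Repr.arbitrary k z).right l)) := by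
      intro i z
      have : comul (R := k) (a * φ z) = ∑ j ∈ (Repr.arbitrary k a).index,
        ∑ l ∈ (Repr.arbitrary k z).index,
          ((Repr.arbitrary k a).left j * φ ((Repr.arbitrary k z).left l)) ⊗ₜ
            ((Repr.arbitrary k a).right j * φ ((Repr.arbitrary k z).right l)) := by
        rw [Bialgebra.comul_mul, hφ, ← (Repr.arbitrary k a).eq, ← (Repr.arbitrary k z).eq]
        simp only [map_sum, TensorProduct.map_tmul, Finset.sum_mul, Finset.mul_sum,
          Algebra.TensorProduct.tmul_mul_tmul]
        rw [Finset.sum_comm]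
      simp [hD, leftHit, this]
    have hQ' : ∀ i, Q i y = ∑ j ∈ (Repr.arbitrary k y).index,
        p (e i * θ ((Repr.arbitrary k y).left j)) • (Repr.arbitrary k y).right j := by
      intro i
      rw [hQ]
      simp only [leftHit_repr _ (Repr.arbitrary k y)]
      rfl
    have h := sweedler_coassoc (k := k) (A := A)
      (fun u v w => ∑ j ∈ (Repr.arbitrary k a).index,
        p ((Repr.arbitrary k a).left j * (φ v * θ u)) • ((Repr.arbitrary k a).right j * φ w))
      (fun _ _ => ⟨by intros; simp [mul_add, add_smul, Finset.sum_add_distrib],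
        by intros; simp [Finset.smul_sum, smul_smul]⟩)
      (fun _ _ => ⟨by intros; simp [mul_add, add_mul, add_smul, Finset.sum_add_distrib],
        by intros; simp [Finset.smul_sum, smul_smul]⟩)
      (fun _ _ => ⟨by intros; simp [mul_add, Finset.sum_add_distrib],
        by intros; simp [Finset.smul_sum, smul_smul, mul_comm]⟩) y
      (Repr.arbitrary k y) (fun i => Repr.arbitrary k _) (fun i => Repr.arbitrary k _)
    calc leftHit p a * φ y = _ := ?_
      _ = _ := h
      _ = _ := ?_
    · rw [← sweedler_counit_left (k := k) (fun z => leftHit p a * φ z)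
        ⟨by intros; simp [mul_add], by intros; simp⟩ (Repr.arbitrary k y)]
      refine Finset.sum_congr rfl fun i _ => ?_
      rw [Finset.sum_comm]
      simp only [← Finset.sum_smul, ← map_sum, ← Finset.mul_sum, hθ]
      rw [leftHit_repr p (Repr.arbitrary k a)]
      simp [Finset.sum_mul, Finset.smul_sum, smul_smul]
    · simp only [hQ', map_sum, map_smul, Finset.mul_sum, mul_smul_comm]
      rw [Finset.sum_comm]
      refine Finset.sum_congr rfl fun i _ => ?_
      simp only [hDm, Finset.smul_sum, smul_smul]
      rw [Finset.sum_comm]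
      conv_rhs => rw [Finset.sum_comm]
      refine Finset.sum_congr rfl fun j _ => ?_
      conv_rhs => rw [Finset.sum_comm]
      refine Finset.sum_congr rfl fun l _ => ?_
      rw [← Finset.sum_smul, ← mul_assoc, ← hsum]
      simp only [mul_comm]
  -- In the opposite order the sum is p(y₁ θ(y₂)) y₃, which `hp` collapses. This is the order that
  -- cyclicity of the trace produces.
  have h2 : ∑ i, Q i ∘ₗ D i = p 1 • LinearMap.id := by
    ext y
    simp only [LinearMap.comp_apply, LinearMap.sum_apply, hQ, hD, leftHit_leftHit]
    have h := sweedler_coassoc (k := k) (A := A)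
      (fun u v w => p (u * θ v) • w)
      (fun _ _ => ⟨by intros; simp [add_mul, add_smul], by intros; simp [smul_smul]⟩)
      (fun _ _ => ⟨by intros; simp [mul_add, add_smul], by intros; simp [smul_smul]⟩)
      (fun _ _ => ⟨by intros; simp, by intros; simp [smul_smul, mul_comm]⟩) y
      (Repr.arbitrary k y) (fun i => Repr.arbitrary k _) (fun i => Repr.arbitrary k _)
    simp only [← Finset.sum_smul, hp] at h
    simp only [leftHit_repr _ (Repr.arbitrary k y)]
    rw [Finset.sum_comm]
    have h3 : p 1 • y = ∑ i ∈ (Repr.arbitrary k y).index,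
        (counit (R := k) ((Repr.arbitrary k y).left i) * p 1) • (Repr.arbitrary k y).right i := by
      have := sweedler_counit_left (k := k) (fun z => p 1 • z) ⟨by simp, by
        intros; simp [smul_smul, mul_comm]⟩ (Repr.arbitrary k y)
      rw [← this]
      simp only [smul_smul]
    simp only [LinearMap.smul_apply, LinearMap.id_apply]
    rw [h3]
    refine Finset.sum_congr rfl fun i _ => ?_
    rw [← Finset.sum_smul]
    congr 1
    rw [← hp]
    simp only [LinearMap.comp_apply,
      leftHit_repr _ (Repr.arbitrary k ((Repr.arbitrary k y).left i)),
      map_sum, map_smul, LinearMap.mulLeft_apply, smul_eq_mul]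
    rw [Finset.sum_comm]
    simp only [hsum]
  rw [h1, map_sum]
  have h4 : ∀ i, LinearMap.trace k A (D i ∘ₗ (LinearMap.mulLeft k a ∘ₗ φ) ∘ₗ Q i) =
      LinearMap.trace k A ((LinearMap.mulLeft k a ∘ₗ φ) ∘ₗ (Q i ∘ₗ D i)) := by
    intro i
    rw [LinearMap.trace_comp_comm', LinearMap.comp_assoc]
  have h5 : ∑ i, (LinearMap.mulLeft k a ∘ₗ φ) ∘ₗ (Q i ∘ₗ D i) =
      (LinearMap.mulLeft k a ∘ₗ φ) ∘ₗ ∑ i, Q i ∘ₗ D i := by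
    ext y
    simp only [LinearMap.sum_apply, LinearMap.comp_apply, map_sum]
  rw [Finset.sum_congr rfl fun i _ => h4 i, ← map_sum, h5, h2, LinearMap.comp_smul,
    LinearMap.comp_id, map_smul,
    smul_eq_mul]

end hits

/-! ### Integrals, the distinguished group-like element and Radford's formula. -/

section integrals

open HopfAlgebra Coalgebra

variable {k : Type u} [Field k] {A : Type u} [Ring A] [HopfAlgebra k A]

/-- A normalized two-sided integral. -/
structure IsNormalizedIntegral (k : Type u) [Field k] {A : Type u} [Ring A] [HopfAlgebra k A]
    (Λ : A) : Prop where
  mul_left (a : A) : a * Λ = counit (R := k) a • Λ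
  mul_right (a : A) : Λ * a = counit (R := k) a • Λ
  counit_eq : counit (R := k) Λ = 1

lemma comul_antipodeSq (y : A) : comul (R := k) (antipodeSq k y) =
    TensorProduct.map (antipodeSq k).toLinearMap (antipodeSq k).toLinearMap (comul (R := k) y) := by
  rw [antipodeSq_apply, comul_antipode, comul_antipode]
  generalize (comul y : A ⊗[k] A) = t
  induction t with
  | zero => simp
  | add p q hp hq => simp only [map_add, hp, hq]
  | tmul p q => rfl

lemma counit_antipodeSq (y : A) : counit (R := k) (antipodeSq k y) = counit (R := k) y := by
  rw [antipodeSq_apply, counit_antipode, counit_antipode]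

/-- The functional `a ↦ Tr (y ↦ a S²(y))`. -/
noncomputable def twistedTrace (k : Type u) [Field k] (A : Type u) [Ring A] [HopfAlgebra k A] :
    Module.Dual k A :=
  LinearMap.trace k A ∘ₗ LinearMap.lcomp k A (antipodeSq k : A →ₐ[k] A).toLinearMap ∘ₗ
    LinearMap.mul k A

lemma twistedTrace_apply (a : A) : twistedTrace k A a =
    LinearMap.trace k A (LinearMap.mulLeft k a ∘ₗ (antipodeSq k).toLinearMap) := rfl

/-- Moving left multiplication by a around the trace brings it to the other side of S², where it
acts as S²(a). -/
lemma twistedTrace_mul (a b : A) :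
    twistedTrace k A (a * b) = twistedTrace k A (b * antipodeSq k a) := by
  have h : LinearMap.mulLeft k (a * b) ∘ₗ (antipodeSq k : A →ₐ[k] A).toLinearMap =
      LinearMap.mulLeft k a * (LinearMap.mulLeft k b ∘ₗ (antipodeSq k).toLinearMap) := by
    ext y; simp
  have h' : LinearMap.mulLeft k (b * antipodeSq k a) ∘ₗ (antipodeSq k : A →ₐ[k] A).toLinearMap =
      (LinearMap.mulLeft k b ∘ₗ (antipodeSq k).toLinearMap) * LinearMap.mulLeft k a := by
    ext y; simp
  rw [twistedTrace_apply, twistedTrace_apply, h, h', LinearMap.trace_mul_comm]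

variable [Module.Finite k A]

lemma comul_eq_sum (a : A) : comul (R := k) a =
    ∑ i, Module.finBasis k A i ⊗ₜ[k] leftHit ((Module.finBasis k A).coord i) a := by
  simp only [leftHit_repr _ (Repr.arbitrary k a), tmul_sum]
  rw [Finset.sum_comm, ← (Repr.arbitrary k a).eq]
  refine Finset.sum_congr rfl fun j _ => ?_
  simp only [← smul_tmul, ← sum_tmul]
  congr 1
  exact ((Module.finBasis k A).sum_repr _).symm

/-- Paired with a functional p, this is `trace_leftHit_mul` for φ = S² and θ = S: indeed S²(y₂)S(y₁)
= S(y₁S(y₂)). No semisimplicity is needed; a normalized integral only ensures that the functional is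
nonzero. -/
lemma rightHit_twistedTrace (a : A) :
    rightHit (twistedTrace k A) a = twistedTrace k A a • (1 : A) := by
  rw [← sub_eq_zero, ← Module.forall_dual_apply_eq_zero_iff k]
  intro p
  rw [map_sub, sub_eq_zero, ← apply_leftHit, map_smul, smul_eq_mul, mul_comm]
  refine trace_leftHit_mul (antipodeSq k).toLinearMap (antipode k) p comul_antipodeSq
    (fun y => ?_) (fun y => ?_) a
  · simp only [AlgHom.toLinearMap_apply, antipodeSq_apply, ← antipode_mul_antidistrib, ← map_sum,
      sum_mul_antipode_eq_smul, map_smul, antipode_one]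
  · rw [← map_sum, sum_mul_antipode_eq_smul, map_smul, smul_eq_mul]

variable {Λ : A}

/-- The operator y ↦ Λ S²(y) = ε(y)Λ has rank one and trace ε(Λ). -/
lemma IsNormalizedIntegral.twistedTrace_eq (hΛ : IsNormalizedIntegral k Λ) :
    twistedTrace k A Λ = 1 := by
  have h : LinearMap.mulLeft k Λ ∘ₗ (antipodeSq k : A →ₐ[k] A).toLinearMap =
      LinearMap.smulRight (counit : A →ₗ[k] k) Λ := by
    ext y; simp [hΛ.mul_right, counit_antipodeSq]
  rw [twistedTrace_apply, h, LinearMap.trace_smulRight, hΛ.counit_eq]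

/-- The product Λ S(Λ) equals Λ because Λ absorbs right factors, and equals S(Λ) because it is S(Λ
S⁻¹(Λ)). -/
lemma IsNormalizedIntegral.antipode_eq (hΛ : IsNormalizedIntegral k Λ) : antipode k Λ = Λ := by
  have h := hΛ.mul_right (antipode k Λ)
  rw [counit_antipode, hΛ.counit_eq, one_smul] at h
  have h2 : antipode k (antipodeInv k Λ) * antipode k Λ = antipode k Λ := by
    rw [← antipode_mul_antidistrib, hΛ.mul_right, ← counit_antipode, antipode_antipodeInv,
      hΛ.counit_eq, one_smul]
  rw [antipode_antipodeInv, h] at h2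
  exact h2.symm

/-- Evaluate (S(b₁)b₂ ⊗ b₃)Δ(Λ) in two ways: S(b₁)b₂ cancels, or (b₂ ⊗ b₃)Δ(Λ) becomes Δ(b₂Λ) =
ε(b₂)Δ(Λ). -/
lemma IsNormalizedIntegral.tmul_mul_comul (hΛ : IsNormalizedIntegral k Λ) (b : A) :
    ((1 : A) ⊗ₜ[k] b) * comul Λ =
    (antipode k b ⊗ₜ[k] (1 : A)) * comul Λ := by
  have h := sweedler_coassoc (k := k) (A := A)
    (fun u v w => ((antipode k u * v) ⊗ₜ[k] w) * comul Λ)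
    (fun _ _ => ⟨by intros; simp [add_mul, add_tmul], by intros; simp [← smul_tmul']⟩)
    (fun _ _ => ⟨by intros; simp [mul_add, add_mul, add_tmul], by intros; simp [← smul_tmul']⟩)
    (fun _ _ => ⟨by intros; simp [add_mul, tmul_add], by intros; simp⟩) b
    (Repr.arbitrary k b) (fun i => Repr.arbitrary k _) (fun i => Repr.arbitrary k _)
  simp only [← Finset.sum_mul, ← sum_tmul, sum_antipode_mul_eq_smul] at h
  simp only [Finset.sum_mul] at h
  have e1 := sweedler_counit_left (k := k) (fun z => ((1 : A) ⊗ₜ[k] z) * comul Λ)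
    ⟨by intros; simp [tmul_add, add_mul], by intros; simp⟩ (Repr.arbitrary k b)
  have e2 := sweedler_counit_right (k := k)
    (fun z => (antipode k z ⊗ₜ[k] (1 : A)) * comul Λ)
    ⟨by intros; simp [add_tmul, add_mul], by intros; simp [← smul_tmul']⟩ (Repr.arbitrary k b)
  rw [← e1, ← e2]
  simp only [← smul_tmul', smul_mul_assoc] at h
  rw [h]
  refine Finset.sum_congr rfl fun i _ => ?_
  have e3 : ∀ u v w : A, (u * v) ⊗ₜ[k] w = (u ⊗ₜ[k] (1 : A)) * (v ⊗ₜ[k] w) := by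
    intros; simp
  simp only [e3, mul_assoc, ← Finset.mul_sum, ← Finset.sum_mul, (Repr.arbitrary k _).eq]
  rw [← Bialgebra.comul_mul, hΛ.mul_left, map_smul, mul_smul_comm]

/-- Apply id ⊗ t to `tmul_mul_comul` and use Λ₁t(Λ₂) = 1. This is the Frobenius property: the form
t(ba) is nondegenerate, and every element of A is a translate of Λ. -/
lemma IsNormalizedIntegral.rightHit_mul (hΛ : IsNormalizedIntegral k Λ) (b : A) :
    rightHit (twistedTrace k A ∘ₗ LinearMap.mulLeft k b) Λ = antipode k b := by
  have h := congrArg (fun t => TensorProduct.rid k A (TensorProduct.map LinearMap.id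
    (twistedTrace k A) t)) (hΛ.tmul_mul_comul b)
  have e1 : ∀ t : A ⊗[k] A, TensorProduct.map LinearMap.id (twistedTrace k A)
      ((1 : A) ⊗ₜ[k] b * t) = TensorProduct.map LinearMap.id
        (twistedTrace k A ∘ₗ LinearMap.mulLeft k b) t := by
    intro t
    induction t with
    | zero => simp
    | add p q hp hq => simp only [map_add, mul_add, hp, hq]
    | tmul p q => simp
  have e2 : ∀ (c : A) (t : A ⊗[k] A), TensorProduct.rid k A (TensorProduct.map LinearMap.id
      (twistedTrace k A) (c ⊗ₜ[k] (1 : A) * t)) = c * TensorProduct.rid k A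
        (TensorProduct.map LinearMap.id (twistedTrace k A) t) := by
    intro c t
    induction t with
    | zero => simp
    | add p q hp hq => simp only [map_add, mul_add, hp, hq]
    | tmul p q => simp
  simp only [e1, e2] at h
  have h2 := rightHit_twistedTrace (k := k) Λ
  rw [hΛ.twistedTrace_eq, one_smul] at h2
  refine h.trans ?_
  change _ * rightHit (twistedTrace k A) Λ = _
  rw [h2, mul_one]

lemma IsNormalizedIntegral.eq_zero_of_mul (hΛ : IsNormalizedIntegral k Λ) (b : A)
    (h : ∀ a, twistedTrace k A (b * a) = 0) : b = 0 := by
  apply antipode_injective (k := k)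
  rw [map_zero, ← hΛ.rightHit_mul, show twistedTrace k A ∘ₗ LinearMap.mulLeft k b = 0 from
    LinearMap.ext h]
  simp [rightHit]

lemma IsNormalizedIntegral.exists_rightHit (hΛ : IsNormalizedIntegral k Λ) (a : A) :
    ∃ q : Module.Dual k A, rightHit q Λ = a :=
  ⟨_, (hΛ.rightHit_mul (antipodeInv k a)).trans (antipode_antipodeInv a)⟩

/-- The antipode fixes Λ and reverses its coproduct, so it carries right translates of Λ to left
ones. -/
lemma IsNormalizedIntegral.exists_leftHit (hΛ : IsNormalizedIntegral k Λ) (a : A) :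
    ∃ p : Module.Dual k A, leftHit p Λ = a := by
  obtain ⟨q, hq⟩ := hΛ.exists_rightHit (antipodeInv k a)
  refine ⟨q ∘ₗ antipodeInv k, ?_⟩
  rw [← antipode_antipodeInv (k := k) a, ← hq]
  nth_rewrite 1 [← hΛ.antipode_eq]
  rw [leftHit, LinearMap.comp_apply, LinearMap.comp_apply, comul_antipode, rightHit,
    LinearMap.comp_apply, LinearMap.comp_apply]
  generalize (comul Λ : A ⊗[k] A) = t
  induction t with
  | zero => simp
  | add p q hp hq => simp only [map_add, hp, hq]
  | tmul p q => simp

/-- Uniqueness of integrals in the dual. -/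
lemma IsNormalizedIntegral.unique (hΛ : IsNormalizedIntegral k Λ) (ρ ρ' : Module.Dual k A)
    (h : ∀ a, leftHit ρ a = ρ a • (1 : A)) (h' : ∀ a, leftHit ρ' a = ρ' a • (1 : A))
    (h1 : ρ Λ = ρ' Λ) : ρ = ρ' := by
  ext a
  obtain ⟨q, rfl⟩ := hΛ.exists_rightHit a
  rw [← apply_leftHit, ← apply_leftHit, h, h', h1]

/-- The distinguished grouplike element. -/
lemma IsNormalizedIntegral.leftHit_twistedTrace (hΛ : IsNormalizedIntegral k Λ) (a : A) :
    leftHit (twistedTrace k A) a =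
      twistedTrace k A a • leftHit (twistedTrace k A) Λ := by
  obtain ⟨p, rfl⟩ := hΛ.exists_leftHit a
  -- Invariance on the known side says that t is unchanged, up to p(1), by a left translation; so
  -- both sides for the translate of Λ are p(1) times their values at Λ.
  have h : twistedTrace k A ∘ₗ leftHit p = p 1 • twistedTrace k A := by
    ext a
    rw [LinearMap.comp_apply, apply_leftHit, rightHit_twistedTrace]
    simp [mul_comm]
  rw [leftHit_leftHit, h, apply_leftHit, rightHit_twistedTrace, hΛ.twistedTrace_eq, one_smul]
  simp [leftHit, TensorProduct.map_smul_left]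

/-- The convolution product of t with any q is q(w)t, so translating w by q multiplies it by q(w).
This is Δ(w) = w ⊗ w, read off in a basis. -/
lemma IsNormalizedIntegral.isGroupLikeElem (hΛ : IsNormalizedIntegral k Λ) :
    IsGroupLikeElem k (leftHit (twistedTrace k A) Λ) where
  counit_eq_one := by
    rw [apply_leftHit, rightHit_counit, LinearMap.id_apply, hΛ.twistedTrace_eq]
  comul_eq_tmul_self := by
    set w := leftHit (twistedTrace k A) Λ with hw
    have h : ∀ q : Module.Dual k A, leftHit q w = q w • w := by
      intro q
      have e : q ∘ₗ leftHit (twistedTrace k A) = q w • twistedTrace k A := by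
        ext a
        rw [LinearMap.comp_apply, hΛ.leftHit_twistedTrace]
        simp [mul_comm, hw]
      nth_rewrite 1 [hw]
      rw [leftHit_leftHit, e, hw]
      simp [leftHit, TensorProduct.map_smul_left]
    rw [comul_eq_sum]
    simp only [h, ← smul_tmul, ← sum_tmul]
    congr 1
    exact (Module.finBasis k A).sum_repr w

/-- Both functionals are integrals on the side where t itself is only one up to w: S interchanges
the sides, and right multiplication by the group-like w absorbs the defect. They agree at Λ, so
uniqueness applies. -/
lemma IsNormalizedIntegral.twistedTrace_antipode (hΛ : IsNormalizedIntegral k Λ) (a : A) :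
    twistedTrace k A (antipode k a) =
      twistedTrace k A (a * leftHit (twistedTrace k A) Λ) := by
  have hg := hΛ.isGroupLikeElem
  have hw := hΛ.leftHit_twistedTrace
  set w := leftHit (twistedTrace k A) Λ
  have h := hΛ.unique (twistedTrace k A ∘ₗ antipode k)
    (twistedTrace k A ∘ₗ LinearMap.mulRight k w) ?_ ?_ ?_
  · exact LinearMap.congr_fun h a
  · intro a
    apply antipode_injective (k := k)
    rw [map_smul, antipode_one]
    refine Eq.trans ?_ (rightHit_twistedTrace (antipode k a))
    rw [leftHit_repr _ (Repr.arbitrary k a), rightHit, LinearMap.comp_apply,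
      LinearMap.comp_apply, comul_antipode, ← (Repr.arbitrary k a).eq]
    simp
  · intro a
    have h1 := hw (a * w)
    have h2 : leftHit (twistedTrace k A) (a * w) =
        leftHit (twistedTrace k A ∘ₗ LinearMap.mulRight k w) a * w := by
      rw [leftHit_repr _ (Repr.arbitrary k a), leftHit, LinearMap.comp_apply,
        LinearMap.comp_apply, Bialgebra.comul_mul, hg.comul_eq_tmul_self,
        ← (Repr.arbitrary k a).eq]
      simp [Finset.sum_mul]
    rw [h2] at h1
    have h3 := congrArg (· * antipode k w) h1
    simpa [mul_assoc, hg.mul_antipode_cancel] using h3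
  · simp [hΛ.antipode_eq, hΛ.mul_right, hg.counit_eq_one]

/-- Radford's formula for the fourth power of the antipode. -/
lemma IsNormalizedIntegral.mul_distinguished (hΛ : IsNormalizedIntegral k Λ) (b : A) :
    b * leftHit (twistedTrace k A) Λ =
      leftHit (twistedTrace k A) Λ * antipodeSq k (antipodeSq k b) := by
  set w := leftHit (twistedTrace k A) Λ with hw
  -- The chain is t(abw) = t(S(b)S(a)) = t(S(a)S(S²b)) = t(S(S²(b)a)) = t(S²(b)aw) = t(awS⁴(b)).
  have h : ∀ a, twistedTrace k A (a * (b * w)) =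
      twistedTrace k A (a * (w * antipodeSq k (antipodeSq k b))) := by
    intro a
    have e : antipodeSq k (antipode k b) = antipode k (antipodeSq k b) := rfl
    rw [← mul_assoc, ← hΛ.twistedTrace_antipode, antipode_mul_antidistrib, twistedTrace_mul, e,
      ← antipode_mul_antidistrib, hΛ.twistedTrace_antipode, ← hw, mul_assoc, twistedTrace_mul,
      mul_assoc]
  rw [← sub_eq_zero]
  refine hΛ.eq_zero_of_mul _ fun a => ?_
  -- Moving a to the right of the trace applies S² to it, so the argument is S⁻²(a).
  have h2 := h (antipodeInv k (antipodeInv k a))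
  rw [← sub_eq_zero, ← map_sub, ← mul_sub, twistedTrace_mul,
    antipodeSq_apply (antipodeInv k (antipodeInv k a)), antipode_antipodeInv,
    antipode_antipodeInv] at h2
  exact h2

/-- At a = 1 the relation t(a₁)a₂ = t(a)w reads t(1)1 = t(1)w. So w = 1, and Radford's formula
becomes S⁴ = 1. -/
lemma IsNormalizedIntegral.antipodeSq_antipodeSq (hΛ : IsNormalizedIntegral k Λ)
    (h : twistedTrace k A 1 ≠ 0) (b : A) :
    antipodeSq k (antipodeSq k b) = b ∧ leftHit (twistedTrace k A) Λ = 1 := by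
  have h1 := hΛ.leftHit_twistedTrace 1
  have h2 : leftHit (twistedTrace k A) (1 : A) = twistedTrace k A 1 • (1 : A) := by
    simp [leftHit, Algebra.TensorProduct.one_def]
  rw [h2] at h1
  have h3 := smul_right_injective A h h1
  have h4 := hΛ.mul_distinguished b
  rw [← h3] at h4 ⊢
  simpa using h4.symm

/-- Group-like elements are linearly independent, hence finite in number, so w has finite order; and
S⁴ is conjugation by w. -/
lemma IsNormalizedIntegral.exists_pow_antipodeSq (hΛ : IsNormalizedIntegral k Λ) :
    ∃ N : ℕ, 0 < N ∧ (antipodeSq k : A →ₐ[k] A) ^ N = 1 := by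
  have hg := hΛ.isGroupLikeElem
  have hw := hΛ.mul_distinguished
  set w := leftHit (twistedTrace k A) Λ
  have hfin : Finite (GroupLike k A) := (linearIndep_groupLikeVal (R := k) (A := A)).finite
  obtain ⟨m, n, hmn, he⟩ := Finite.exists_ne_map_eq_of_infinite
    (fun n : ℕ => (⟨w ^ n, hg.pow⟩ : GroupLike k A))
  have he' : w ^ m = w ^ n := congrArg GroupLike.val he
  have hpow : ∀ n b, b * w ^ n = w ^ n * ((antipodeSq k : A →ₐ[k] A) ^ (2 * n)) b := by
    intro n
    induction n with
    | zero => simp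
    | succ n ih =>
      intro b
      rw [pow_succ, ← mul_assoc, ih, mul_assoc, hw, ← mul_assoc]
      congr 1
      rw [show 2 * (n + 1) = 2 + 2 * n by ring, pow_add]
      rfl
  have key : ∀ m n : ℕ, m < n → w ^ m = w ^ n →
      ∃ N : ℕ, 0 < N ∧ (antipodeSq k : A →ₐ[k] A) ^ N = 1 := by
    intro m n hlt hmn
    obtain ⟨d, rfl⟩ := Nat.exists_eq_add_of_lt hlt
    have hu : antipode k w ^ m * w ^ m = 1 := by
      have hc : Commute (antipode k w) w := by
        rw [commute_iff_eq, hg.antipode_mul_cancel, hg.mul_antipode_cancel]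
      rw [← hc.mul_pow, hg.antipode_mul_cancel, one_pow]
    have h1 : w ^ (d + 1) = 1 := by
      have := congrArg (antipode k w ^ m * ·) hmn
      simp only [add_assoc, pow_add w m, ← mul_assoc, hu, one_mul] at this
      exact this.symm
    refine ⟨2 * (d + 1), by omega, ?_⟩
    ext b
    have := hpow (d + 1) b
    rw [h1] at this
    simpa using this.symm
  rcases lt_or_gt_of_ne hmn with h | h
  · exact key m n h he'
  · exact key n m h he'.symm

end integrals

/-! ### Traces of finite-order automorphisms of a matrix algebra. -/

section traces

variable {k : Type u} [Field k]

lemma trace_eq_sum_of_eigenbasis {V ι : Type*} [AddCommGroup V] [Module k V] [Fintype ι]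
    (b : Module.Basis ι k V) (f : V →ₗ[k] V) (c : ι → k) (h : ∀ i, f (b i) = c i • b i) :
    LinearMap.trace k V f = ∑ i, c i := by
  classical
  rw [LinearMap.trace_eq_matrix_trace k b, Matrix.trace]
  refine Finset.sum_congr rfl fun i _ => ?_
  simp [LinearMap.toMatrix_apply, h]

lemma trace_pi {ι : Type*} [Fintype ι] [DecidableEq ι] {M : ι → Type*} [∀ i, AddCommGroup (M i)]
    [∀ i, Module k (M i)] [∀ i, Module.Finite k (M i)] (f : (∀ i, M i) →ₗ[k] (∀ i, M i)) :
    LinearMap.trace k _ f =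
      ∑ i, LinearMap.trace k _ (LinearMap.proj i ∘ₗ f ∘ₗ LinearMap.single k M i) := by
  have h : f = ∑ i, (f ∘ₗ LinearMap.single k M i) ∘ₗ LinearMap.proj i := by
    ext i x : 2
    simp only [LinearMap.coe_comp, Function.comp_apply, LinearMap.sum_apply]
    rw [Finset.sum_eq_single i]
    · simp
    · intro j _ hj; simp [hj]
    · simp
  conv_lhs => rw [h]
  rw [map_sum]
  exact Finset.sum_congr rfl fun i _ => LinearMap.trace_comp_comm' _ _

/-- The power T^N is central, hence a scalar c ≠ 0. Since X^N − c is separable, T is diagonalizable,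
and conjugation multiplies the matrix unit (i, j) of an eigenbasis by the ratio of the i-th and j-th
eigenvalues. -/
lemma exists_trace_conj [IsAlgClosed k] [CharZero k] {V : Type*} [AddCommGroup V] [Module k V]
    [Module.Finite k V] {d : ℕ} (hd : Module.finrank k V = d) (T : V ≃ₗ[k] V) {N : ℕ} (hN : 0 < N)
    (h : ∀ x : Module.End k V, ((T.conjAlgEquiv k : Module.End k V ≃ₐ[k] _)^[N]) x = x) :
    ∃ μ : Fin d → k, (∀ i, μ i ^ N = 1) ∧
      LinearMap.trace k _ (T.conjAlgEquiv k : Module.End k V ≃ₐ[k] _).toLinearMap =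
        ∑ i, ∑ j, μ i * (μ j)⁻¹ := by
  classical
  subst hd
  set g : Module.End k V := T.toLinearMap with hg
  have hc (x : Module.End k V) : (T.conjAlgEquiv k : Module.End k V ≃ₐ[k] _) x * g = g * x := by
    ext y; simp [hg]
  have hcN (x : Module.End k V) (n : ℕ) :
      ((T.conjAlgEquiv k : Module.End k V ≃ₐ[k] _)^[n]) x * g ^ n = g ^ n * x := by
    induction n with
    | zero => simp
    | succ n ih => rw [Function.iterate_succ_apply', pow_succ', ← mul_assoc, hc, mul_assoc, ih,
        mul_assoc]
  have hcen (x : Module.End k V) : x * g ^ N = g ^ N * x := by rw [← hcN, h]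
  rcases subsingleton_or_nontrivial V with hV | hV
  · refine ⟨fun _ => 1, by simp, ?_⟩
    have : Module.finrank k V = 0 := Module.finrank_zero_of_subsingleton
    rw [this]
    have : (T.conjAlgEquiv k : Module.End k V ≃ₐ[k] _).toLinearMap = 0 := by
      ext; simp [eq_iff_true_of_subsingleton]
    rw [this]; simp
  have hmem : g ^ N ∈ Subalgebra.center k (Module.End k V) := by
    rw [Subalgebra.mem_center_iff]; exact hcen
  rw [Algebra.IsCentral.center_eq_bot, Algebra.mem_bot] at hmem
  obtain ⟨c, hc'⟩ := hmem
  have hinv : (g ^ N) * (T.symm.toLinearMap ^ N : Module.End k V) = 1 := by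
    rw [← Commute.mul_pow]
    · convert one_pow N; ext; simp [hg]
    · ext; simp [hg]
  have hc0 : c ≠ 0 := by
    rintro rfl
    rw [map_zero] at hc'
    rw [← hc', zero_mul] at hinv
    exact zero_ne_one hinv
  have hss : g.IsSemisimple := Module.End.isSemisimple_of_squarefree_aeval_eq_zero
    (p := Polynomial.X ^ N - Polynomial.C c)
    (Polynomial.separable_X_pow_sub_C c (by exact_mod_cast hN.ne') hc0).squarefree (by simp [hc'])
  have htop := hss.iSup_eigenspace_eq_top
  have hspan : (⊤ : Submodule k V) ≤ Submodule.span k {y : V | ∃ μ : k, g y = μ • y} := by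
    rw [← htop]
    refine iSup_le fun μ y hy => Submodule.subset_span ⟨μ, Module.End.mem_eigenspace_iff.1 hy⟩
  set b0 := Module.Basis.ofSpan hspan
  have hb0 (i) : ∃ μ : k, g (b0 i) = μ • b0 i := Module.Basis.ofSpan_subset hspan ⟨i, rfl⟩
  have : Fintype _ := FiniteDimensional.fintypeBasisIndex b0
  set b := b0.reindex (Fintype.equivFinOfCardEq (Module.finrank_eq_card_basis b0).symm)
  have hb (i) : ∃ μ : k, g (b i) = μ • b i := by simpa [b] using hb0 _
  choose μ hμ using hb
  have hpow (i) : μ i ^ N = c := by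
    have h1 : ∀ n : ℕ, (g ^ n) (b i) = μ i ^ n • b i := fun n => by
      induction n with
      | zero => simp
      | succ n ih => rw [pow_succ', Module.End.mul_apply, ih, map_smul, hμ, smul_smul, pow_succ]
    have h2 := h1 N
    rw [← hc', Module.algebraMap_end_apply] at h2
    exact (smul_left_injective k (b.ne_zero i) h2).symm
  have hne (i) : μ i ≠ 0 := by
    intro h0; have := hpow i; rw [h0, zero_pow hN.ne'] at this; exact hc0 this.symm
  -- Dividing all eigenvalues by an N-th root of c makes them roots of unity and leaves their ratios
  -- unchanged.
  obtain ⟨ν, hν⟩ := IsAlgClosed.exists_pow_nat_eq c hN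
  have hν0 : ν ≠ 0 := by rintro rfl; rw [zero_pow hN.ne'] at hν; exact hc0 hν.symm
  refine ⟨fun i => μ i / ν, fun i => by rw [div_pow, hpow, hν, div_self hc0], ?_⟩
  rw [trace_eq_sum_of_eigenbasis b.end _ (fun p => μ p.1 * (μ p.2)⁻¹), Fintype.sum_prod_type]
  · refine Finset.sum_congr rfl fun i _ => Finset.sum_congr rfl fun j _ => ?_
    field_simp [hne j]
  · rintro ⟨i, j⟩
    refine b.ext fun l => ?_
    have hs : T.symm (b l) = (μ l)⁻¹ • b l := by
      rw [LinearEquiv.symm_apply_eq, map_smul, ← LinearEquiv.coe_coe T, ← hg, hμ, smul_smul,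
        inv_mul_cancel₀ (hne l), one_smul]
    rcases eq_or_ne j l with rfl | hl
    · have hT : T (b i) = μ i • b i := hμ i
      simp [hs, hT, Module.Basis.end_apply_apply, smul_smul, mul_comm]
    · simp [hs, Module.Basis.end_apply_apply, hl]

/-- By the Skolem–Noether theorem, φ is a conjugation. -/
lemma exists_trace_matrix_algEquiv [IsAlgClosed k] [CharZero k] {d : ℕ}
    (φ : Matrix (Fin d) (Fin d) k ≃ₐ[k] Matrix (Fin d) (Fin d) k) {N : ℕ} (hN : 0 < N)
    (h : ∀ x, (φ^[N]) x = x) :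
    ∃ μ : Fin d → k, (∀ i, μ i ^ N = 1) ∧
      LinearMap.trace k _ φ.toLinearMap = ∑ i, ∑ j, μ i * (μ j)⁻¹ := by
  set c : Matrix (Fin d) (Fin d) k ≃ₐ[k] Module.End k (Fin d → k) := Matrix.toLinAlgEquiv'
  obtain ⟨T, hT⟩ := AlgEquiv.eq_linearEquivConjAlgEquiv (c.symm.trans (φ.trans c))
  have hc (n : ℕ) (x) : ((T.conjAlgEquiv k : Module.End k (Fin d → k) ≃ₐ[k] _)^[n]) x =
      c ((φ^[n]) (c.symm x)) := by
    induction n with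
    | zero => simp
    | succ n ih => rw [Function.iterate_succ_apply', ih, ← hT, Function.iterate_succ_apply']; simp
  obtain ⟨μ, h1, h2⟩ := exists_trace_conj (Module.finrank_fin_fun k) T hN
    (fun x => by rw [hc, h]; simp)
  refine ⟨μ, h1, ?_⟩
  rw [← h2, ← hT, ← LinearMap.trace_conj' φ.toLinearMap c.toLinearEquiv]
  rfl

end traces

/-! ### A substitute in k for the nonnegative real numbers. -/

section positivity

variable (k : Type u) [Field k] [CharZero k]

/-- The field k need not embed in ℂ, but its algebraic numbers do. There P is the set of elements
with nonnegative image, and the double sum becomes |Σ μᵢ|² because the inverse of a root of unity is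
its conjugate. -/
lemma exists_nonneg_submonoid : ∃ P : AddSubmonoid k, (∀ z ∈ P, 1 + z ≠ 0) ∧
    ∀ {n N : ℕ} (μ : Fin n → k), 0 < N → (∀ i, μ i ^ N = 1) →
      ∑ i, ∑ j, μ i * (μ j)⁻¹ ∈ P := by
  open ComplexOrder in
  have : Algebra.IsAlgebraic ℚ (algebraicClosure ℚ k) := by
    convert algebraicClosure.isAlgebraic ℚ k
    · rfl
    · exact Subsingleton.elim _ _
  let τ : algebraicClosure ℚ k →ₐ[ℚ] ℂ := IsAlgClosed.lift
  refine ⟨((AddSubmonoid.nonneg ℂ).comap τ.toLinearMap.toAddMonoidHom).map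
    (algebraMap (algebraicClosure ℚ k) k).toAddMonoidHom, ?_, ?_⟩
  · rintro _ ⟨y, hy, rfl⟩ h
    have h0 : (0 : ℂ) ≤ τ y := hy
    have h' : 1 + y = 0 := by
      apply (algebraMap (algebraicClosure ℚ k) k).injective
      simpa using h
    have h1 : 1 + τ y = 0 := by rw [← map_one τ, ← map_add, h', map_zero]
    have : (0 : ℂ) < 1 + τ y := by positivity
    exact this.ne' h1
  · intro n N μ hN hμ
    have hint (i) : IsAlgebraic ℚ (μ i) := by
      refine ⟨Polynomial.X ^ N - 1, ?_, by simp [hμ]⟩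
      exact Polynomial.X_pow_sub_C_ne_zero hN 1
    let ν : Fin n → algebraicClosure ℚ k := fun i => ⟨μ i, mem_algebraicClosure_iff.2 (hint i)⟩
    have hν (i) : ν i ^ N = 1 := Subtype.ext (by simp [ν, hμ])
    refine ⟨∑ i, ∑ j, ν i * (ν j)⁻¹, ?_, ?_⟩
    · change (0 : ℂ) ≤ τ _
      have hinv (i) : (τ (ν i))⁻¹ = star (τ (ν i)) := by
        refine RCLike.inv_eq_conj (Complex.norm_eq_one_of_pow_eq_one (n := N) ?_ hN.ne')
        rw [← map_pow, hν, map_one]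
      simp only [map_sum, map_mul, map_inv₀, hinv]
      rw [← Finset.sum_mul_sum, ← star_sum]
      exact mul_star_self_nonneg _
    · simp [ν]

end positivity

/-! ### Traces of finite-order automorphisms of a product of matrix algebras. -/

section products

variable {k : Type u} [Field k] [IsAlgClosed k] [CharZero k]

lemma eq_zero_or_one_of_isIdempotentElem_of_central {d : ℕ} {e : Matrix (Fin d) (Fin d) k}
    (he : e * e = e) (hc : ∀ x, x * e = e * x) : e = 0 ∨ e = 1 := by
  have hmem : e ∈ Subalgebra.center k (Matrix (Fin d) (Fin d) k) := Subalgebra.mem_center_iff.2 hc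
  rcases isEmpty_or_nonempty (Fin d) with hd | hd
  · left; ext i; exact hd.elim i
  rw [Algebra.IsCentral.center_eq_bot, Algebra.mem_bot] at hmem
  obtain ⟨c, rfl⟩ := hmem
  rw [← map_mul] at he
  have : c * c = c := (algebraMap k (Matrix (Fin d) (Fin d) k)).injective he
  rcases IsIdempotentElem.iff_eq_zero_or_one.1 this with rfl | rfl <;> simp

/-- The trace is the sum of the diagonal contributions of the blocks. A block that is moved
contributes 0, a preserved one an element of P. The character lives on a single one-dimensional
block, which is preserved and contributes 1, and 1 + z ≠ 0 for z in P. -/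
lemma trace_ne_zero_of_pow_eq_one {n : ℕ} {d : Fin n → ℕ}
    (σ : (∀ i, Matrix (Fin (d i)) (Fin (d i)) k) →ₐ[k] (∀ i, Matrix (Fin (d i)) (Fin (d i)) k))
    {N : ℕ} (hN : 0 < N) (hσ : σ ^ N = 1)
    (ε : (∀ i, Matrix (Fin (d i)) (Fin (d i)) k) →ₐ[k] k) (hε : ∀ x, ε (σ x) = ε x) :
    LinearMap.trace k _ σ.toLinearMap ≠ 0 := by
  obtain ⟨P, hP1, hP⟩ := exists_nonneg_submonoid k
  let M (i : Fin n) := Matrix (Fin (d i)) (Fin (d i)) k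
  let τ : (∀ i, M i) →ₐ[k] (∀ i, M i) := σ ^ (N - 1)
  have hτσ (x) : τ (σ x) = x := by
    have : σ ^ (N - 1) * σ = 1 := by rw [← pow_succ, Nat.sub_add_cancel hN, hσ]
    exact DFunLike.congr_fun this x
  have hστ (x) : σ (τ x) = x := by
    have : σ * σ ^ (N - 1) = 1 := by rw [← pow_succ', Nat.sub_add_cancel hN, hσ]
    exact DFunLike.congr_fun this x
  let e (i : Fin n) : ∀ i, M i := Pi.single i 1
  have hee (i) : e i * e i = e i := by rw [← Pi.single_mul, mul_one]
  have hec (i) (x) : x * e i = e i * x := by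
    ext j : 1
    rcases eq_or_ne j i with rfl | hj <;> simp [e, *]
  have hx (i) (x) : x * e i = Pi.single i (x i) := by
    ext j : 1
    rcases eq_or_ne j i with rfl | hj <;> simp [e, *]
  -- A surjective endomorphism sends the block idempotent to a central idempotent, whose component
  -- in a matrix algebra is 0 or 1.
  have hcent (ρ ρ' : (∀ i, M i) →ₐ[k] (∀ i, M i)) (h : ∀ x, ρ (ρ' x) = x) (i) :
      ρ (e i) i = 0 ∨ ρ (e i) i = 1 := by
    refine eq_zero_or_one_of_isIdempotentElem_of_central ?_ fun x => ?_
    · rw [← Pi.mul_apply, ← map_mul, hee]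
    · have := congrFun (congrArg ρ (hec i (ρ' (Pi.single i x)))) i
      simpa [h] using this
  -- From e_i ≤ σ(e_i) the inverse τ gives τ(e_i) ≤ e_i, so τ(e_i) is 0 or e_i.
  have hfix (i) (hi : σ (e i) i = 1) : σ (e i) = e i := by
    have h1 : σ (e i) * e i = e i := by rw [hx, hi]
    have h2 : e i * τ (e i) = τ (e i) := by simpa [hτσ] using congrArg τ h1
    rw [← hec, hx] at h2
    rcases hcent τ σ hτσ i with h3 | h3
    · rw [h3, Pi.single_zero] at h2
      have h4 := hστ (e i)
      rw [← h2, map_zero] at h4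
      rw [← h4, map_zero]
    · rw [h3] at h2
      conv_lhs => rw [show e i = τ (e i) from h2, hστ]
  let φ (i : Fin n) : M i →ₗ[k] M i :=
    LinearMap.proj i ∘ₗ σ.toLinearMap ∘ₗ LinearMap.single k M i
  have hφ (i) (x) : φ i x = σ (Pi.single i x) i := rfl
  have htr : LinearMap.trace k _ σ.toLinearMap = ∑ i, LinearMap.trace k _ (φ i) := trace_pi _
  have hzero (i) (hi : σ (e i) i = 0) : φ i = 0 := by
    ext1 x
    rw [hφ, show (Pi.single i x : ∀ i, M i) = Pi.single i x * e i by simp [hx], map_mul,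
      Pi.mul_apply, hi, mul_zero, LinearMap.zero_apply]
  have hone (i) (hi : σ (e i) i = 1) : ∃ μ : Fin (d i) → k, (∀ j, μ j ^ N = 1) ∧
      LinearMap.trace k _ (φ i) = ∑ a, ∑ b, μ a * (μ b)⁻¹ := by
    have hin (x) : σ (Pi.single i x) = Pi.single i (φ i x) := by
      conv_lhs => rw [show (Pi.single i x : ∀ i, M i) = Pi.single i x * e i by simp [hx], map_mul,
        hfix i hi, hx]
      rfl
    have hit (m : ℕ) (x) : ((φ i)^[m]) x = (σ ^ m) (Pi.single i x) i := by
      induction m generalizing x with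
      | zero => simp
      | succ m ih => rw [Function.iterate_succ_apply, ih, ← hin, pow_succ, AlgHom.mul_apply]
    have hN' (x) : ((φ i)^[N]) x = x := by rw [hit, hσ]; simp
    let f : M i →ₐ[k] M i := AlgHom.ofLinearMap (φ i) hi fun x y => by
      rw [hφ, Pi.single_mul, map_mul]; rfl
    have hb : Function.Bijective f := by
      have : Function.Bijective ((φ i)^[N]) := by
        rw [show (φ i)^[N] = id from funext hN']; exact Function.bijective_id
      obtain ⟨N, rfl⟩ : ∃ m, N = m + 1 := ⟨N - 1, by omega⟩
      refine ⟨fun x y hxy => this.1 ?_, fun y => ?_⟩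
      · rw [Function.iterate_succ_apply, Function.iterate_succ_apply]
        exact congrArg _ hxy
      · obtain ⟨x, hx⟩ := this.2 y
        rw [Function.iterate_succ_apply'] at hx
        exact ⟨_, hx⟩
    exact exists_trace_matrix_algEquiv (AlgEquiv.ofBijective f hb) hN hN'
  have hmem (i) : LinearMap.trace k _ (φ i) ∈ P := by
    rcases hcent σ τ hστ i with hi | hi
    · rw [hzero i hi, map_zero]; exact P.zero_mem
    · obtain ⟨μ, h1, h2⟩ := hone i hi
      rw [h2]; exact hP μ hN h1
  obtain ⟨i, hi⟩ : ∃ i, ε (e i) ≠ 0 := by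
    by_contra! h
    have h1 : (1 : ∀ i, M i) = ∑ i, e i := (Finset.univ_sum_single _).symm
    have := map_one ε
    rw [h1, map_sum, Finset.sum_eq_zero fun i _ => h i] at this
    exact zero_ne_one this
  have hεi : ε (e i) = 1 := by
    have : ε (e i) * ε (e i) = ε (e i) := by rw [← map_mul, hee]
    exact mul_right_cancel₀ hi (by rw [this, one_mul])
  have hσi : σ (e i) i = 1 := by
    refine (hcent σ τ hστ i).resolve_left fun h0 => ?_
    have h1 : ε (σ (e i) * e i) = 1 := by rw [map_mul, hε, hεi, one_mul]
    rw [hx, h0, Pi.single_zero, map_zero] at h1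
    exact zero_ne_one h1
  -- The character is injective on this simple block, so d² ≤ 1.
  have hdi : d i = 1 := by
    let f : M i →ₐ[k] k := AlgHom.ofLinearMap (ε.toLinearMap ∘ₗ LinearMap.single k M i) hεi
      fun x y => by
        change ε (Pi.single i (x * y)) = _
        rw [Pi.single_mul, map_mul]; rfl
    have h0 : d i ≠ 0 := fun h0 => by
      have : IsEmpty (Fin (d i)) := by rw [h0]; infer_instance
      have : e i = 0 := by
        change Pi.single i (1 : M i) = 0
        rw [Subsingleton.elim (1 : M i) 0, Pi.single_zero]
      rw [this, map_zero] at hεi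
      exact zero_ne_one hεi
    have : NeZero (d i) := ⟨h0⟩
    have hinj : Function.Injective f := f.toRingHom.injective
    have h1 := LinearMap.finrank_le_finrank_of_injective (f := f.toLinearMap) hinj
    rw [Module.finrank_matrix] at h1
    simp at h1
    nlinarith [Nat.pos_of_ne_zero h0]
  obtain ⟨μ, h1, h2⟩ := hone i hσi
  have h3 : LinearMap.trace k _ (φ i) = 1 := by
    rw [h2]
    have : ∀ a b : Fin (d i), a = b := by rw [hdi]; exact fun a b => Subsingleton.elim a b
    have h4 (a b) : μ a * (μ b)⁻¹ = 1 := by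
      rw [this a b]
      refine mul_inv_cancel₀ fun h0 => ?_
      have := h1 b
      rw [h0, zero_pow hN.ne'] at this
      exact zero_ne_one this
    simp [h4, hdi]
  rw [htr, ← Finset.add_sum_erase _ _ (Finset.mem_univ i), h3]
  exact hP1 _ (P.sum_mem fun j _ => hmem j)

end products

/-! ### The regular character and the theorem S² = 1. -/

section involutive

open HopfAlgebra Coalgebra

variable {k : Type u} [Field k] {A : Type u} [Ring A] [HopfAlgebra k A]

/-- Both sides are p(a₁b₁) a₂ b₂ S(b₃), where b₂S(b₃) may be cancelled. -/
lemma leftHit_comp_mulRight (p : Module.Dual k A) (a b : A) :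
    leftHit (p ∘ₗ LinearMap.mulRight k b) a = ∑ i ∈ (Repr.arbitrary k b).index,
      leftHit p (a * (Repr.arbitrary k b).left i) * antipode k ((Repr.arbitrary k b).right i) := by
  have h := sweedler_coassoc (k := k) (A := A)
    (fun u v w => ∑ j ∈ (Repr.arbitrary k a).index,
      p ((Repr.arbitrary k a).left j * u) • ((Repr.arbitrary k a).right j * (v * antipode k w)))
    (fun _ _ => ⟨by intros; simp [mul_add, add_smul, Finset.sum_add_distrib],
      by intros; simp [Finset.smul_sum, smul_smul]⟩)
    (fun _ _ => ⟨by intros; simp [mul_add, add_mul, smul_add, Finset.sum_add_distrib],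
      by intros; simp [Finset.smul_sum, smul_smul, mul_comm]⟩)
    (fun _ _ => ⟨by intros; simp [mul_add, smul_add, Finset.sum_add_distrib],
      by intros; simp [Finset.smul_sum, smul_smul, mul_comm]⟩) b
    (Repr.arbitrary k b) (fun i => Repr.arbitrary k _) (fun i => Repr.arbitrary k _)
  have hL (c : A) : leftHit p (a * c) = ∑ l ∈ (Repr.arbitrary k c).index,
      ∑ j ∈ (Repr.arbitrary k a).index,
      p ((Repr.arbitrary k a).left j * (Repr.arbitrary k c).left l) •
        ((Repr.arbitrary k a).right j * (Repr.arbitrary k c).right l) := by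
    rw [leftHit, LinearMap.comp_apply, LinearMap.comp_apply, Bialgebra.comul_mul,
      ← (Repr.arbitrary k a).eq, ← (Repr.arbitrary k c).eq]
    simp only [map_sum, Finset.sum_mul, Finset.mul_sum, Algebra.TensorProduct.tmul_mul_tmul]
    rfl
  calc _ = _ := ?_
    _ = _ := h.symm
    _ = _ := Finset.sum_congr rfl fun i _ => ?_
  · have h2 (i) : ∑ l ∈ (Repr.arbitrary k ((Repr.arbitrary k b).right i)).index,
        ∑ j ∈ (Repr.arbitrary k a).index,
        p ((Repr.arbitrary k a).left j * (Repr.arbitrary k b).left i) •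
          ((Repr.arbitrary k a).right j *
            ((Repr.arbitrary k ((Repr.arbitrary k b).right i)).left l *
              antipode k ((Repr.arbitrary k ((Repr.arbitrary k b).right i)).right l))) =
        ∑ j ∈ (Repr.arbitrary k a).index,
        p ((Repr.arbitrary k a).left j * (counit (R := k) ((Repr.arbitrary k b).right i) •
          (Repr.arbitrary k b).left i)) • (Repr.arbitrary k a).right j := by
      rw [Finset.sum_comm]
      refine Finset.sum_congr rfl fun j _ => ?_
      rw [← Finset.smul_sum, ← Finset.mul_sum, HopfAlgebra.sum_mul_antipode_eq_smul]
      simp [smul_smul, mul_comm]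
    simp only [h2]
    rw [Finset.sum_comm, leftHit_repr _ (Repr.arbitrary k a)]
    refine Finset.sum_congr rfl fun j _ => ?_
    rw [← Finset.sum_smul, ← map_sum, ← Finset.mul_sum,
      sweedler_counit_right (fun x => x) ⟨by simp, by simp⟩]
    rfl
  · rw [hL, Finset.sum_mul]
    refine Finset.sum_congr rfl fun l _ => ?_
    rw [Finset.sum_mul]
    simp [mul_assoc]

/-- The character of the regular representation. -/
noncomputable def regularTrace (k : Type u) [Field k] (A : Type u) [Ring A] [HopfAlgebra k A] :
    Module.Dual k A :=
  LinearMap.trace k A ∘ₗ LinearMap.mul k A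

lemma regularTrace_apply (a : A) :
    regularTrace k A a = LinearMap.trace k A (LinearMap.mulLeft k a) := rfl

lemma regularTrace_mul_comm (a b : A) : regularTrace k A (a * b) = regularTrace k A (b * a) := by
  rw [regularTrace_apply, regularTrace_apply, LinearMap.mulLeft_mul, LinearMap.mulLeft_mul]
  exact LinearMap.trace_mul_comm k (LinearMap.mulLeft k a) (LinearMap.mulLeft k b)

variable [Module.Finite k A]

lemma regularTrace_one : regularTrace k A 1 = Module.finrank k A := by
  rw [regularTrace_apply, LinearMap.mulLeft_one, LinearMap.trace_id]

lemma trace_mulLeft_integral {Λ : A} (hΛ : IsNormalizedIntegral k Λ) :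
    regularTrace k A Λ = 1 := by
  have h : LinearMap.mulLeft k Λ = LinearMap.smulRight (counit (R := k) (A := A)) Λ := by
    ext y; simp [hΛ.mul_right]
  rw [regularTrace_apply, h, LinearMap.trace_smulRight, hΛ.counit_eq]

/-- This is `trace_leftHit_mul` for φ = id and θ = S⁻¹; its condition on p holds because x is
symmetric, x(y₁S⁻¹(y₂)) = x(S⁻¹(y₂)y₁). So x/dim(A) is a convolution idempotent before x is known to
be an integral. -/
lemma regularTrace_comp_leftHit (a : A) :
    regularTrace k A (leftHit (regularTrace k A) a) =
      regularTrace k A 1 * regularTrace k A a := by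
  have h := trace_leftHit_mul LinearMap.id (antipodeInv k) (regularTrace k A)
    (fun y => by simp) (fun y => by simpa using sum_mul_antipodeInv (Repr.arbitrary k y))
    (fun y => by
      have h2 := congrArg (regularTrace k A) (sum_antipodeInv_mul (Repr.arbitrary k y))
      rw [map_sum, map_smul, smul_eq_mul] at h2
      rw [← h2]
      exact Finset.sum_congr rfl fun i _ => regularTrace_mul_comm _ _) a
  exact h

lemma regularTrace_algEquiv (e : A ≃ₐ[k] A) (a : A) :
    regularTrace k A (e a) = regularTrace k A a := by
  rw [regularTrace_apply, regularTrace_apply,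
    ← LinearMap.trace_conj' (LinearMap.mulLeft k a) e.toLinearEquiv]
  congr 1
  ext y
  simp [LinearEquiv.conj_apply]

lemma trace_eq_finrank_of_idempotent {V : Type*} [AddCommGroup V] [Module k V]
    [Module.Finite k V] {f : V →ₗ[k] V} (h : f ∘ₗ f = f) :
    LinearMap.trace k V f = (Module.finrank k (LinearMap.range f) : k) :=
  (LinearMap.IsIdempotentElem.isProj_range f h).trace

/-! ### Semisimple Hopf algebras in characteristic zero. -/

section semisimple

variable [IsAlgClosed k] [CharZero k] [IsSemisimpleRing A] {Λ : A}

/-- The value at 1 is Tr(S²). By Radford's formula S² has finite order, it preserves the counit, and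
A is a product of matrix algebras. -/
lemma twistedTrace_one_ne_zero (hΛ : IsNormalizedIntegral k Λ) : twistedTrace k A 1 ≠ 0 := by
  obtain ⟨N, hN, hσ⟩ := hΛ.exists_pow_antipodeSq
  obtain ⟨n, d, hd, ⟨e⟩⟩ := IsSemisimpleRing.exists_algEquiv_pi_matrix_of_isAlgClosed k A
  have hpow (m : ℕ) : ((e.toAlgHom.comp (antipodeSq k)).comp e.symm.toAlgHom) ^ m =
      (e.toAlgHom.comp (antipodeSq k ^ m)).comp e.symm.toAlgHom := by
    induction m with
    | zero => ext x : 1; simp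
    | succ m ih => rw [pow_succ, ih, pow_succ]; ext x : 1; simp
  have h := trace_ne_zero_of_pow_eq_one ((e.toAlgHom.comp (antipodeSq k)).comp e.symm.toAlgHom) hN
    (by rw [hpow, hσ]; ext x : 1; simp) ((Bialgebra.counitAlgHom k A).comp e.symm.toAlgHom)
    (fun x => by simp [counit_antipodeSq])
  rw [twistedTrace_apply, ← LinearMap.trace_conj' _ e.toLinearEquiv]
  convert h using 2
  ext x : 1
  simp [LinearEquiv.conj_apply]

lemma antipodeSq_antipodeSq (hΛ : IsNormalizedIntegral k Λ) (a : A) :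
    antipodeSq k (antipodeSq k a) = a :=
  (hΛ.antipodeSq_antipodeSq (twistedTrace_one_ne_zero hΛ) a).1

/-- By `leftHit_comp_mulRight` the operator is a ↦ S²(leftHit p (a b₁)) S³(b₂), and S³ = S⁻¹ since
S⁴ = 1. Cyclicity of the trace brings the right multiplications together as S⁻¹(b₂)b₁ = ε(b). -/
lemma trace_antipodeSq_leftHit (hΛ : IsNormalizedIntegral k Λ) (p : Module.Dual k A) (b : A) :
    LinearMap.trace k A ((antipodeSq k).toLinearMap ∘ₗ leftHit (p ∘ₗ LinearMap.mulRight k b)) =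
      counit (R := k) b * LinearMap.trace k A ((antipodeSq k).toLinearMap ∘ₗ leftHit p) := by
  have h : (antipodeSq k : A →ₐ[k] A).toLinearMap ∘ₗ leftHit (p ∘ₗ LinearMap.mulRight k b) =
      ∑ i ∈ (Repr.arbitrary k b).index,
        LinearMap.mulRight k (antipodeInv k ((Repr.arbitrary k b).right i)) ∘ₗ
          (((antipodeSq k).toLinearMap ∘ₗ leftHit p) ∘ₗ
            LinearMap.mulRight k ((Repr.arbitrary k b).left i)) := by
    ext a
    simp only [LinearMap.comp_apply, LinearMap.sum_apply, leftHit_comp_mulRight, map_sum,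
      AlgHom.toLinearMap_apply, map_mul, LinearMap.mulRight_apply]
    refine Finset.sum_congr rfl fun i _ => ?_
    congr 1
    apply antipode_injective (k := k)
    rw [antipode_antipodeInv, antipodeSq_apply, ← antipodeSq_apply (antipode k (antipode k _)),
      ← antipodeSq_apply]
    exact antipodeSq_antipodeSq hΛ _
  have h2 (i) : LinearMap.trace k A
      (LinearMap.mulRight k (antipodeInv k ((Repr.arbitrary k b).right i)) ∘ₗ
          (((antipodeSq k).toLinearMap ∘ₗ leftHit p) ∘ₗ
            LinearMap.mulRight k ((Repr.arbitrary k b).left i))) = LinearMap.trace k A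
      (((antipodeSq k).toLinearMap ∘ₗ leftHit p) ∘ₗ LinearMap.mulRight k
        (antipodeInv k ((Repr.arbitrary k b).right i) * (Repr.arbitrary k b).left i)) := by
    rw [LinearMap.trace_comp_comm', LinearMap.mulRight_mul, LinearMap.comp_assoc]
  rw [h, map_sum]
  simp only [h2]
  have h3 : ∑ i ∈ (Repr.arbitrary k b).index, LinearMap.mulRight k
      (antipodeInv k ((Repr.arbitrary k b).right i) * (Repr.arbitrary k b).left i) =
      counit (R := k) b • LinearMap.id := by
    ext a
    simp only [LinearMap.sum_apply, LinearMap.mulRight_apply]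
    rw [← Finset.mul_sum, sum_antipodeInv_mul]
    simp
  have h4 := congrArg (fun f => LinearMap.trace k A
    ((antipodeSq k : A →ₐ[k] A).toLinearMap ∘ₗ leftHit p ∘ₗ f)) h3
  simp only [LinearMap.comp_smul, LinearMap.comp_id, map_smul, smul_eq_mul] at h4
  rw [← h4, ← map_sum]
  congr 1
  ext y
  simp

/-- Put σ = S² and n = dim(A). The involution σ commutes with the idempotent E of translation by
x/n, so Tr(σ) and Tr(σE) are integers, and Tr(σ) = n Tr(σE). As Tr(σ) is nonzero and lies between −n
and n, it is n or −n, so σ = 1 or σ = −1; the latter is impossible since σ(1) = 1. -/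
lemma antipodeSq_eq_self (hΛ : IsNormalizedIntegral k Λ) (a : A) : antipodeSq k a = a := by
  set σ : A →ₗ[k] A := (antipodeSq k).toLinearMap with hσ
  set x := regularTrace k A with hx
  set n := Module.finrank k A with hn
  have hnt : Nontrivial A := ⟨Λ, 0, fun h => by
    have := hΛ.counit_eq; rw [h, map_zero] at this; exact zero_ne_one this⟩
  have hn0 : 0 < n := Module.finrank_pos
  have hnk : (n : k) ≠ 0 := by exact_mod_cast hn0.ne'
  have hσσ : σ ∘ₗ σ = LinearMap.id := LinearMap.ext fun a => antipodeSq_antipodeSq hΛ a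
  have hxσ (a : A) : x (σ a) = x a := regularTrace_algEquiv
    (AlgEquiv.ofAlgHom (antipodeSq k) (antipodeSq k)
      (AlgHom.ext fun a => antipodeSq_antipodeSq hΛ a)
      (AlgHom.ext fun a => antipodeSq_antipodeSq hΛ a)) a
  set E : A →ₗ[k] A := (n : k)⁻¹ • leftHit x with hE
  have hEE : E ∘ₗ E = E := by
    ext a
    have : x ∘ₗ leftHit x = (n : k) • x := by
      ext a
      rw [LinearMap.comp_apply, hx, regularTrace_comp_leftHit, regularTrace_one]; rfl
    simp only [hE, LinearMap.comp_apply, LinearMap.smul_apply, map_smul, leftHit_leftHit, this]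
    have h2 : leftHit ((n : k) • x) a = (n : k) • leftHit x a := by
      simp [leftHit_repr _ (Repr.arbitrary k a), Finset.smul_sum, smul_smul]
    rw [h2, smul_smul (n : k)⁻¹ (n : k), inv_mul_cancel₀ hnk, one_smul]
  have hEσ : E ∘ₗ σ = σ ∘ₗ E := by
    ext a
    have : leftHit x (σ a) = σ (leftHit x a) := by
      rw [leftHit_repr _ (Repr.arbitrary k a), leftHit, LinearMap.comp_apply,
        LinearMap.comp_apply, hσ, AlgHom.toLinearMap_apply,
        comul_antipodeSq, ← (Repr.arbitrary k a).eq]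
      simp only [map_sum, TensorProduct.map_tmul, map_smul]
      refine Finset.sum_congr rfl fun i _ => ?_
      rw [← hσ, hxσ]
      rfl
    simp [hE, this]
  set u : A →ₗ[k] A := (2 : k)⁻¹ • (LinearMap.id + σ) with hu
  have huu : u ∘ₗ u = u := by
    have h4 : (2 : k)⁻¹ * 2⁻¹ * 2 = 2⁻¹ := by field_simp
    have h1 (y : A) : σ (σ y) = y := LinearMap.congr_fun hσσ y
    ext a
    simp only [hu, LinearMap.comp_apply, LinearMap.smul_apply, LinearMap.add_apply,
      LinearMap.id_apply, map_smul, map_add, h1]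
    match_scalars <;> linear_combination h4
  have huE : (u ∘ₗ E) ∘ₗ (u ∘ₗ E) = u ∘ₗ E := by
    have h1 : E ∘ₗ u = u ∘ₗ E := by
      simp only [hu, LinearMap.comp_smul, LinearMap.smul_comp, LinearMap.comp_add,
        LinearMap.add_comp, hEσ, LinearMap.comp_id, LinearMap.id_comp]
    calc _ = u ∘ₗ (E ∘ₗ u) ∘ₗ E := rfl
      _ = (u ∘ₗ u) ∘ₗ (E ∘ₗ E) := by rw [h1]; rfl
      _ = _ := by rw [huu, hEE]
  have hσu : σ = (2 : k) • u - LinearMap.id := by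
    rw [hu, smul_smul, mul_inv_cancel₀ two_ne_zero, one_smul]; abel
  -- Take p = x and b = Λ in `trace_antipodeSq_leftHit`: since x(aΛ) = ε(a), translation by x(·Λ) is
  -- the identity.
  have htσ : LinearMap.trace k A σ = n * LinearMap.trace k A (σ ∘ₗ E) := by
    have h1 := trace_antipodeSq_leftHit hΛ x Λ
    have h2 : x ∘ₗ LinearMap.mulRight k Λ = counit := by
      ext a
      simp [hΛ.mul_left, hx, trace_mulLeft_integral hΛ]
    have h3 : leftHit (counit (R := k) (A := A)) = LinearMap.id :=
      LinearMap.ext fun a => by rw [leftHit_counit]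
    rw [h2, hΛ.counit_eq, one_mul, h3, LinearMap.comp_id] at h1
    rw [hE, LinearMap.comp_smul, map_smul, smul_eq_mul, mul_inv_cancel_left₀ hnk]
    exact h1
  have hσ0 : LinearMap.trace k A σ ≠ 0 := by
    have := twistedTrace_one_ne_zero hΛ
    rwa [twistedTrace_apply, LinearMap.mulLeft_one, LinearMap.id_comp] at this
  have hid : LinearMap.trace k A LinearMap.id = (n : k) := LinearMap.trace_id _ _
  obtain ⟨r, hr⟩ : ∃ r, r = Module.finrank k (LinearMap.range u) := ⟨_, rfl⟩
  have hrn : r ≤ n := hr ▸ Submodule.finrank_le _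
  have h1 : LinearMap.trace k A σ = ((2 * r - n : ℤ) : k) := by
    rw [hσu, map_sub, map_smul, trace_eq_finrank_of_idempotent huu, hid, hr]
    push_cast; rfl
  have h2 : LinearMap.trace k A (σ ∘ₗ E) =
      ((2 * Module.finrank k (LinearMap.range (u ∘ₗ E)) -
        Module.finrank k (LinearMap.range E) : ℤ) : k) := by
    rw [hσu, LinearMap.sub_comp, LinearMap.smul_comp, map_sub, map_smul,
      trace_eq_finrank_of_idempotent huE, LinearMap.id_comp, trace_eq_finrank_of_idempotent hEE]
    push_cast; rfl
  generalize (2 * Module.finrank k (LinearMap.range (u ∘ₗ E)) -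
        Module.finrank k (LinearMap.range E) : ℤ) = m at h2
  have h3 : (2 * r - n : ℤ) = n * m := by
    rw [h1, h2] at htσ
    exact_mod_cast htσ
  have h4 : (2 * r - n : ℤ) ≠ 0 := fun h0 => hσ0 (by rw [h1, h0, Int.cast_zero])
  -- Here 2r − n = nm with m ≠ 0 and 0 ≤ r ≤ n.
  have h5 : r = n ∨ r = 0 := by
    have hm0 : m ≠ 0 := by rintro rfl; simp [h3] at h4
    rcases lt_or_gt_of_ne hm0 with hm | hm
    · right; have : (n : ℤ) * m ≤ n * (-1) := by gcongr; omega
      omega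
    · left; have : (n : ℤ) * 1 ≤ n * m := by gcongr; omega
      omega
  rcases h5 with h5 | h5
  · have h6 : LinearMap.range u = ⊤ := Submodule.eq_top_of_finrank_eq (hr.symm.trans h5)
    obtain ⟨b, hb⟩ := LinearMap.range_eq_top.1 h6 a
    have h7 : u a = a := by rw [← hb, ← LinearMap.comp_apply, huu]
    have h8 := LinearMap.congr_fun hσu a
    change antipodeSq k a = _ at h8
    rw [h8, LinearMap.sub_apply, LinearMap.smul_apply, h7, two_smul]
    simp
  · have h6 : LinearMap.range u = ⊥ := Submodule.finrank_eq_zero.1 (hr.symm.trans h5)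
    have h7 : u = 0 := LinearMap.range_eq_bot.1 h6
    have h8 := LinearMap.congr_fun hσu 1
    change antipodeSq k 1 = _ at h8
    rw [h7, map_one] at h8
    simp only [smul_zero, zero_sub, LinearMap.neg_apply, LinearMap.id_apply] at h8
    have : (2 : k) • (1 : A) = 0 := by rw [two_smul]; nth_rewrite 1 [h8]; simp
    simp at this

lemma twistedTrace_eq_regularTrace (hΛ : IsNormalizedIntegral k Λ) :
    twistedTrace k A = regularTrace k A := by
  ext a
  rw [twistedTrace_apply, regularTrace_apply]
  congr 1
  ext y
  simp [antipodeSq_eq_self hΛ]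

/-- The regular character is a two-sided integral on `A`. -/
lemma rightHit_regularTrace (hΛ : IsNormalizedIntegral k Λ) (a : A) :
    rightHit (regularTrace k A) a = regularTrace k A a • (1 : A) := by
  rw [← twistedTrace_eq_regularTrace hΛ]; exact rightHit_twistedTrace a

lemma leftHit_regularTrace (hΛ : IsNormalizedIntegral k Λ) (a : A) :
    leftHit (regularTrace k A) a = regularTrace k A a • (1 : A) := by
  rw [← twistedTrace_eq_regularTrace hΛ, hΛ.leftHit_twistedTrace,
    (hΛ.antipodeSq_antipodeSq (twistedTrace_one_ne_zero hΛ) 1).2]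

lemma regularTrace_antipode (hΛ : IsNormalizedIntegral k Λ) (a : A) :
    regularTrace k A (antipode k a) = regularTrace k A a := by
  rw [← twistedTrace_eq_regularTrace hΛ, hΛ.twistedTrace_antipode,
    (hΛ.antipodeSq_antipodeSq (twistedTrace_one_ne_zero hΛ) 1).2, mul_one]

end semisimple

end involutive

/-! ### Von Neumann regularity in a semisimple category. -/

section regular

variable {T : Type v} [Category.{w} T] [Abelian T]

/-- Since f(1 − hf) = f − fhf = (1 − fh)f, a quasi-inverse t of the remainder corrects h by (1 −
hf)t(1 − fh). -/
lemma exists_regular_of_sub {X Y : T} (f : X ⟶ Y) (h t : Y ⟶ X)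
    (ht : (f - f ≫ h ≫ f) ≫ t ≫ (f - f ≫ h ≫ f) = f - f ≫ h ≫ f) :
    ∃ g : Y ⟶ X, f ≫ g ≫ f = f := by
  refine ⟨h + (𝟙 Y - h ≫ f) ≫ t ≫ (𝟙 X - f ≫ h), ?_⟩
  have h1 : f ≫ (𝟙 Y - h ≫ f) = f - f ≫ h ≫ f := by simp
  have h2 : (𝟙 X - f ≫ h) ≫ f = f - f ≫ h ≫ f := by simp
  rw [Preadditive.add_comp, Preadditive.comp_add, Category.assoc, Category.assoc, h2,
    ← Category.assoc f (_ - _), h1, ht]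
  abel

/-- Gaussian elimination: by Schur's lemma a nonzero entry between simple summands is invertible and
serves as a pivot. Subtracting fhf kills f on the summand of the pivot and keeps it zero where it
was zero, so the number of active summands drops. The decompositions enter only through the two
resolutions of the identity. -/
lemma exists_regular_aux {X Y : T} {n m : ℕ} (S : Fin n → T) (S' : Fin m → T)
    [∀ i, Simple (S i)] [∀ i, Simple (S' i)] (i : ∀ a, S a ⟶ X) (p : ∀ a, X ⟶ S a)
    (i' : ∀ a, S' a ⟶ Y) (p' : ∀ a, Y ⟶ S' a) (hX : ∑ a, p a ≫ i a = 𝟙 X)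
    (hY : ∑ a, p' a ≫ i' a = 𝟙 Y) (N : ℕ) (f : X ⟶ Y) (s : Finset (Fin n)) (hs : s.card ≤ N)
    (hf : ∀ a, a ∉ s → i a ≫ f = 0) : ∃ g : Y ⟶ X, f ≫ g ≫ f = f := by
  induction N generalizing f s with
  | zero =>
    have hs0 : s = ∅ := Finset.card_eq_zero.1 (Nat.le_zero.1 hs)
    have : f = 0 := by
      rw [← Category.id_comp f, ← hX, Preadditive.sum_comp]
      exact Finset.sum_eq_zero fun a _ => by rw [Category.assoc, hf a (by simp [hs0]), comp_zero]
    exact ⟨0, by simp [this]⟩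
  | succ N ih =>
    by_cases h0 : ∃ a ∈ s, i a ≫ f ≠ 0
    · obtain ⟨a, has, ha⟩ := h0
      obtain ⟨b, hb⟩ : ∃ b, (i a ≫ f) ≫ p' b ≠ 0 := by
        by_contra! h
        apply ha
        rw [← Category.comp_id (i a ≫ f), ← hY, Preadditive.comp_sum]
        exact Finset.sum_eq_zero fun b _ => by rw [← Category.assoc, h, zero_comp]
      have := isIso_of_hom_simple hb
      let h := p' b ≫ inv ((i a ≫ f) ≫ p' b) ≫ i a
      obtain ⟨t, ht⟩ := ih (f - f ≫ h ≫ f) (s.erase a)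
        (by rw [Finset.card_erase_of_mem has]; omega) (fun c hc => by
          rw [Preadditive.comp_sub]
          rcases eq_or_ne c a with rfl | hca
          · have : (i c ≫ f) ≫ p' b ≫ inv ((i c ≫ f) ≫ p' b) = 𝟙 _ := by
              rw [← Category.assoc, IsIso.hom_inv_id]
            have h3 : i c ≫ f ≫ h ≫ f = ((i c ≫ f) ≫ p' b ≫ inv ((i c ≫ f) ≫ p' b)) ≫ i c ≫ f := by
              simp [h]
            rw [h3, this, Category.id_comp, sub_self]
          · have hcs : c ∉ s := fun h => hc (Finset.mem_erase.2 ⟨hca, h⟩)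
            rw [← Category.assoc, hf c hcs, zero_comp, sub_zero])
      exact exists_regular_of_sub f h t ht
    · push Not at h0
      refine ih f ∅ (by simp) fun a _ => ?_
      by_cases ha : a ∈ s
      · exact h0 a ha
      · exact hf a ha

variable {k : Type u} [Field k] [Linear k T]

/-- Every morphism of a semisimple category is von Neumann regular. -/
lemma IsSemisimpleCategory.exists_regular (hT : IsSemisimpleCategory k T) {X Y : T} (f : X ⟶ Y) :
    ∃ g : Y ⟶ X, f ≫ g ≫ f = f := by
  obtain ⟨n, S, hS, ⟨e⟩⟩ := hT.exists_iso_biproduct X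
  obtain ⟨m, S', hS', ⟨e'⟩⟩ := hT.exists_iso_biproduct Y
  refine exists_regular_aux S S' (fun a => biproduct.ι S a ≫ e.inv)
    (fun a => e.hom ≫ biproduct.π S a)
    (fun a => biproduct.ι S' a ≫ e'.inv) (fun a => e'.hom ≫ biproduct.π S' a) ?_ ?_ n f
    Finset.univ (by simp) (by simp)
  · have : ∑ a, (e.hom ≫ biproduct.π S a) ≫ biproduct.ι S a ≫ e.inv =
      e.hom ≫ (∑ a, biproduct.π S a ≫ biproduct.ι S a) ≫ e.inv := by
      simp only [Preadditive.comp_sum, Preadditive.sum_comp, Category.assoc]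
    rw [this, biproduct.total]; simp
  · have : ∑ a, (e'.hom ≫ biproduct.π S' a) ≫ biproduct.ι S' a ≫ e'.inv =
      e'.hom ≫ (∑ a, biproduct.π S' a ≫ biproduct.ι S' a) ≫ e'.inv := by
      simp only [Preadditive.comp_sum, Preadditive.sum_comp, Category.assoc]
    rw [this, biproduct.total]; simp

/-- Fullness of F lifts the quasi-inverse found in T, and faithfulness lifts the equation. -/
lemma Realization.exists_regular [MonoidalCategory T] (hT : IsSemisimpleCategory k T)
    (𝒜 : Realization k T) {V W : 𝒜.Mod} (f : V ⟶ W) : ∃ g : W ⟶ V, f ≫ g ≫ f = f := by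
  obtain ⟨g, hg⟩ := hT.exists_regular (𝒜.F.map f)
  obtain ⟨g, rfl⟩ := 𝒜.F.map_surjective g
  exact ⟨g, 𝒜.F.map_injective (by simpa using hg)⟩

end regular

/-! ### Irreducible modules, Schur's lemma and the integral of a semisimple Hopf algebra. -/

namespace HopfRep

section regular

variable {k : Type u} [Field k] {A : Type u} [Ring A] [HopfAlgebra k A]

/-- Every homomorphism of finite-dimensional `A`-modules is von Neumann regular. -/
def Regular (k : Type u) [Field k] (A : Type u) [Ring A] [HopfAlgebra k A] : Prop :=
  ∀ ⦃V W : HopfRep k A⦄ (f : V ⟶ W), ∃ g : W ⟶ V, f ≫ g ≫ f = f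

lemma Regular.exists_retraction (h : Regular k A) {V W : HopfRep k A} (f : V ⟶ W)
    (hf : Function.Injective f.lin) : ∃ g : W ⟶ V, ∀ x, g.lin (f.lin x) = x := by
  obtain ⟨g, hg⟩ := h f
  exact ⟨g, fun x => hf (LinearMap.congr_fun (congrArg Hom.lin hg) x)⟩

/-- An invariant subspace, as a module. -/
abbrev sub (V : HopfRep k A) (N : Submodule k V.carrier)
    (h : ∀ a : A, ∀ x ∈ N, V.ρ a x ∈ N) : HopfRep k A :=
  ⟨N, AlgHom.ofLinearMap
    { toFun a := (V.ρ a).restrict (h a)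
      map_add' a b := by ext x; simp
      map_smul' c a := by ext x; simp } (by ext x; simp) (fun a b => by ext x; simp)⟩

/-- The inclusion of an invariant subspace. -/
def subIncl (V : HopfRep k A) (N : Submodule k V.carrier)
    (h : ∀ a : A, ∀ x ∈ N, V.ρ a x ∈ N) : V.sub N h ⟶ V :=
  ⟨N.subtype, fun _ => rfl⟩

/-- A nonzero submodule of least dimension; strong induction on the dimension. -/
lemma exists_irreducible (V : HopfRep k A) [hV : Nontrivial V.carrier] :
    ∃ (W : HopfRep k A) (i : W ⟶ V), W.IsIrreducible ∧ Function.Injective i.lin := by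
  obtain ⟨n, hn⟩ : ∃ n, Module.finrank k V.carrier = n := ⟨_, rfl⟩
  induction n using Nat.strong_induction_on generalizing V with
  | _ n ih =>
    by_cases h : V.IsIrreducible
    · exact ⟨V, 𝟙 V, h, fun x y hxy => hxy⟩
    · obtain ⟨N, hN, hb, ht⟩ : ∃ N : Submodule k V.carrier,
          (∀ a : A, ∀ x ∈ N, V.ρ a x ∈ N) ∧ N ≠ ⊥ ∧ N ≠ ⊤ := by
        by_contra! h'
        exact h ⟨hV, fun N hN => or_iff_not_imp_left.2 (h' N hN)⟩
      have : Nontrivial (V.sub N hN).carrier := Submodule.nontrivial_iff_ne_bot.2 hb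
      obtain ⟨W, i, hW, hi⟩ := ih _ (hn ▸ Submodule.finrank_lt ht) (V.sub N hN) rfl
      exact ⟨W, i ≫ V.subIncl N hN, hW, fun x y hxy => hi (Subtype.ext hxy)⟩

lemma ker_invariant {V W : HopfRep k A} (f : V ⟶ W) (a : A) (x : V.carrier)
    (hx : x ∈ LinearMap.ker f.lin) : V.ρ a x ∈ LinearMap.ker f.lin := by
  rw [LinearMap.mem_ker] at hx ⊢
  rw [lin_ρ, hx, map_zero]

lemma range_invariant {V W : HopfRep k A} (f : V ⟶ W) (a : A) (y : W.carrier)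
    (hy : y ∈ LinearMap.range f.lin) : W.ρ a y ∈ LinearMap.range f.lin := by
  obtain ⟨x, rfl⟩ := hy
  exact ⟨V.ρ a x, lin_ρ f a x⟩

lemma IsIrreducible.eq_zero_or_nonempty_iso {V W : HopfRep k A} (hV : V.IsIrreducible)
    (hW : W.IsIrreducible) (f : V ⟶ W) : f.lin = 0 ∨ Nonempty (V ≅ W) := by
  rcases hV.2 _ (ker_invariant f) with h | h
  · rcases hW.2 _ (range_invariant f) with h' | h'
    · exact Or.inl (LinearMap.range_eq_bot.1 h')
    · exact Or.inr ⟨isoMk (LinearEquiv.ofBijective f.lin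
        ⟨LinearMap.ker_eq_bot.1 h, LinearMap.range_eq_top.1 h'⟩) f.comm⟩
  · exact Or.inl (LinearMap.ker_eq_top.1 h)

lemma IsIrreducible.exists_eq_smul [IsAlgClosed k] {V : HopfRep k A} (hV : V.IsIrreducible)
    (f : V ⟶ V) : ∃ c : k, f.lin = c • LinearMap.id := by
  have := hV.1
  obtain ⟨c, hc⟩ := Module.End.exists_eigenvalue f.lin
  refine ⟨c, ?_⟩
  rcases hV.2 (Module.End.eigenspace f.lin c) (fun a x hx => by
    rw [Module.End.mem_eigenspace_iff] at hx ⊢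
    rw [lin_ρ, hx, map_smul]) with h | h
  · exact absurd h hc
  · ext x
    exact Module.End.mem_eigenspace_iff.1
      (h ▸ Submodule.mem_top : x ∈ Module.End.eigenspace f.lin c)

open HopfAlgebra in
-- The counit spans a trivial submodule of the coregular module A*. A retraction onto it is
-- evaluation at some R in A; its linearity says that R is a right integral, and ε(R) = 1. Then S(R)
-- is a left integral, and the product R S(R) equals both R and S(R).
lemma Regular.exists_integral [Module.Finite k A] (h : Regular k A) :
    ∃ Λ : A, IsNormalizedIntegral k Λ := by
  obtain ⟨g, hg⟩ := h.exists_retraction (mc (V := 𝟙_ (HopfRep k A)) (LinearMap.id : k →ₗ[k] k))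
    (fun x y hxy => by
      have := LinearMap.congr_fun hxy (1 : A)
      change Coalgebra.counit (R := k) (1 : A) * x = Coalgebra.counit (R := k) (1 : A) * y at this
      rwa [Bialgebra.counit_one, one_mul, one_mul] at this)
  obtain ⟨R, hR⟩ : ∃ R : A, ∀ φ : Module.Dual k A, g.lin φ = φ R :=
    ⟨(Module.evalEquiv k A).symm g.lin, fun φ => by
      conv_lhs => rw [← (Module.evalEquiv k A).apply_symm_apply g.lin]
      rfl⟩
  have h1 : Coalgebra.counit (R := k) R = 1 := by
    have := (hR _).symm.trans (hg (1 : k))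
    rw [mc_apply] at this
    have h2 : Coalgebra.counit (R := k) R * 1 = 1 := this
    rwa [mul_one] at h2
  have h2 (a : A) : R * a = Coalgebra.counit (R := k) a • R := by
    refine (Module.evalEquiv k A).injective (LinearMap.ext fun φ => ?_)
    have := lin_ρ g a φ
    rw [hR, hR] at this
    change φ (R * a) = Coalgebra.counit (R := k) a * φ R at this
    simpa using this
  have h3 (a : A) : a * antipode k R = Coalgebra.counit (R := k) a • antipode k R := by
    obtain ⟨b, rfl⟩ : ∃ b, antipode k b = a := ⟨antipodeInv k a, antipode_antipodeInv a⟩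
    rw [← antipode_mul_antidistrib, h2, map_smul, counit_antipode]
  have h4 : R = antipode k R := by
    have h5 := h2 (antipode k R)
    rw [h3, counit_antipode, h1, one_smul, one_smul] at h5
    exact h5.symm
  exact ⟨R, fun a => by rw [h4]; exact h3 a, h2, h1⟩

/-- A retraction onto a left ideal has its kernel as a complement. -/
lemma Regular.isSemisimpleRing [Module.Finite k A] (h : Regular k A) : IsSemisimpleRing A := by
  refine (isSemisimpleModule_iff _ _).2 ⟨fun N => ?_⟩
  let V : HopfRep k A := ⟨A, Algebra.lmul k A⟩
  obtain ⟨g, hg⟩ := h.exists_retraction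
    (V.subIncl (N.restrictScalars k) fun a x hx => N.smul_mem a hx) Subtype.val_injective
  let f : A →ₗ[A] N :=
    { toFun := g.lin
      map_add' := map_add g.lin
      map_smul' := fun a x => lin_ρ g a x }
  exact ⟨LinearMap.ker f, LinearMap.isCompl_of_proj hg⟩

end regular

end HopfRep

/-! ### Finite direct sums of modules. -/

namespace HopfRep

section pi

variable {k : Type u} [Field k] {A : Type u} [Ring A] [HopfAlgebra k A]

/-- The direct sum of a finite family of modules. -/
abbrev pi {κ : Type} [Fintype κ] (M : κ → HopfRep k A) : HopfRep k A :=
  ⟨∀ i, (M i).carrier, AlgHom.ofLinearMap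
    { toFun a := LinearMap.pi fun i => (M i).ρ a ∘ₗ LinearMap.proj i
      map_add' a b := by ext; simp
      map_smul' c a := by ext; simp } (by ext; simp) (fun a b => by ext; simp)⟩

/-- The projections of a direct sum. -/
def piProj {κ : Type} [Fintype κ] (M : κ → HopfRep k A) (i : κ) : pi M ⟶ M i :=
  ⟨LinearMap.proj i, fun _ => rfl⟩

/-- The inclusions of a direct sum. -/
def piIncl {κ : Type} [Fintype κ] [DecidableEq κ] (M : κ → HopfRep k A) (i : κ) : M i ⟶ pi M :=
  ⟨LinearMap.single k (fun i => (M i).carrier) i, fun a => by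
    ext x j
    rcases eq_or_ne j i with rfl | hj <;> simp [*]⟩

lemma sum_lin {V W : HopfRep k A} {κ : Type*} (s : Finset κ) (f : κ → (V ⟶ W)) :
    (∑ i ∈ s, f i).lin = ∑ i ∈ s, (f i).lin := by
  classical
  induction s using Finset.induction_on with
  | empty => rfl
  | insert a s ha ih => rw [Finset.sum_insert ha, Finset.sum_insert ha, add_lin, ih]

variable [Module.Finite k A]

lemma mc_sum_smul {V : HopfRep k A} {κ : Type*} (s : Finset κ) (c : κ → k)
    (f : κ → Module.Dual k V.carrier) : mc (∑ i ∈ s, c i • f i) = ∑ i ∈ s, c i • mc (f i) := by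
  classical
  induction s using Finset.induction_on with
  | empty => rfl
  | insert a s ha ih => rw [Finset.sum_insert ha, Finset.sum_insert ha, mc_add, mc_smul, ih]

end pi

end HopfRep

/-! ### Decomposition of the coregular module and of the regular character. -/

namespace IrrSystem

open HopfRep

variable {k : Type u} [Field k] {A : Type u} [Ring A] [HopfAlgebra k A] [Module.Finite k A]

/-- The index set of the matrix coefficients of the irreducible modules. -/
abbrev Idx (I : IrrSystem k A) : Type :=
  Σ j, Fin (Module.finrank k (I.mod j).carrier)

/-- The matrix coefficients of the irreducible modules. -/
noncomputable def coeffs (I : IrrSystem k A) (p : I.Idx) : I.mod p.1 ⟶ coreg k A :=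
  mc ((Module.finBasis k (I.mod p.1).carrier).coord p.2)

/-- The sum of the matrix coefficients of the irreducible modules. -/
noncomputable def coeffSum (I : IrrSystem k A) : pi (fun p : I.Idx => I.mod p.1) ⟶ coreg k A :=
  ∑ p, piProj _ p ≫ I.coeffs p

lemma coeffSum_apply (I : IrrSystem k A) (x : ∀ p : I.Idx, (I.mod p.1).carrier) :
    I.coeffSum.lin x = ∑ p, (I.coeffs p).lin (x p) := by
  rw [coeffSum, sum_lin]
  simp [piProj]

lemma piIncl_coeffSum (I : IrrSystem k A) [DecidableEq I.Idx] (p : I.Idx) :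
    piIncl (fun p : I.Idx => I.mod p.1) p ≫ I.coeffSum = I.coeffs p := by
  ext x : 2
  change I.coeffSum.lin (Pi.single p x) = _
  rw [coeffSum_apply, Finset.sum_eq_single p]
  · simp
  · intro q _ hq; simp [hq]
  · simp

variable [IsAlgClosed k]

/-- Otherwise the kernel contains a copy of some irreducible module. By Schur's lemma it lies in one
isotypic part, with scalar components c_a, and the sum restricts to the matrix coefficient of the
functional Σ c_a e^a. A matrix coefficient determines its functional, so all c_a vanish. -/
lemma coeffSum_injective (I : IrrSystem k A) : Function.Injective I.coeffSum.lin := by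
  rw [← LinearMap.ker_eq_bot]
  by_contra hK
  have : Nontrivial (HopfRep.sub _ (LinearMap.ker I.coeffSum.lin)
    (ker_invariant I.coeffSum)).carrier := Submodule.nontrivial_iff_ne_bot.2 hK
  obtain ⟨W, i, hW, hi⟩ := exists_irreducible
    (HopfRep.sub _ (LinearMap.ker I.coeffSum.lin) (ker_invariant I.coeffSum))
  obtain ⟨j, ⟨e⟩⟩ := I.exists_iso W hW
  set f : I.mod j ⟶ pi (fun p : I.Idx => I.mod p.1) := e.inv ≫ i ≫ subIncl _ _ _ with hf
  have hf0 : f ≫ I.coeffSum = 0 := by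
    ext x : 2
    exact (i.lin (e.inv.lin x)).2
  have hinj (x) (hx : f.lin x = 0) : x = 0 := by
    have h1 : i.lin (e.inv.lin x) = 0 := Subtype.ext hx
    have h2 : e.inv.lin x = 0 := hi (h1.trans (map_zero _).symm)
    have h3 : e.hom.lin (e.inv.lin x) = x := LinearMap.congr_fun (congrArg Hom.lin e.inv_hom_id) x
    rw [← h3, h2, map_zero]
  have hne (p : I.Idx) (hp : p.1 ≠ j) : (f ≫ piProj _ p).lin = 0 :=
    ((I.irreducible j).eq_zero_or_nonempty_iso (I.irreducible p.1) _).resolve_right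
      fun ⟨e⟩ => hp (I.eq_of_iso e).symm
  choose c hc using fun a => (I.irreducible j).exists_eq_smul (f ≫ piProj _ (⟨j, a⟩ : I.Idx))
  set φ : Module.Dual k (I.mod j).carrier :=
    ∑ a, c a • (Module.finBasis k (I.mod j).carrier).coord a with hφ
  have h1 : f ≫ I.coeffSum = mc φ := by
    ext x : 2
    change I.coeffSum.lin (f.lin x) = _
    rw [coeffSum_apply, Fintype.sum_sigma, Finset.sum_eq_single j]
    · have h2 (a) : (I.coeffs ⟨j, a⟩).lin (f.lin x ⟨j, a⟩) = c a •
          (mc ((Module.finBasis k (I.mod j).carrier).coord a)).lin x := by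
        rw [show f.lin x ⟨j, a⟩ = c a • x from LinearMap.congr_fun (hc a) x, map_smul]
        rfl
      rw [Finset.sum_congr rfl fun a _ => h2 a, hφ, mc_sum_smul, sum_lin, LinearMap.sum_apply]
      rfl
    · intro j' _ hj'
      refine Finset.sum_eq_zero fun a _ => ?_
      have h2 : f.lin x ⟨j', a⟩ = 0 := LinearMap.congr_fun (hne ⟨j', a⟩ hj') x
      rw [h2, map_zero]
    · simp
  have h2 : φ = 0 := by
    rw [← evOne_mc φ, ← h1, hf0]
    ext; rfl
  have h3 (a) : c a = 0 := by
    have := LinearMap.congr_fun h2 (Module.finBasis k (I.mod j).carrier a)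
    simpa [hφ, Finsupp.single_apply] using this
  have := (I.irreducible j).1
  obtain ⟨x, hx⟩ := exists_ne (0 : (I.mod j).carrier)
  refine hx (hinj x (funext fun p => ?_))
  obtain ⟨j', a⟩ := p
  rcases eq_or_ne j' j with rfl | hj
  · have h4 : f.lin x ⟨j', a⟩ = c a • x := LinearMap.congr_fun (hc a) x
    rw [h4, h3, zero_smul]; rfl
  · exact LinearMap.congr_fun (hne ⟨j', a⟩ hj) x

/-- Regularity gives an idempotent `e` that vanishes on the image and projects onto a complement. A
nonzero complement would contain an irreducible module, but every morphism from an irreducible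
module to A* consists of matrix coefficients and factors through the image. -/
lemma coeffSum_surjective (hA : Regular k A) (I : IrrSystem k A) :
    Function.Surjective I.coeffSum.lin := by
  obtain ⟨g, hg⟩ := hA I.coeffSum
  set e : coreg k A ⟶ coreg k A := 𝟙 _ - g ≫ I.coeffSum with he
  have hfe : I.coeffSum ≫ e = 0 := by simp [he, hg]
  have hge : g ≫ I.coeffSum ≫ g ≫ I.coeffSum = g ≫ I.coeffSum := by rw [hg]
  have hee : e ≫ e = e := by simp [he, hge]
  by_cases h0 : e.lin = 0
  · intro y
    refine ⟨g.lin y, ?_⟩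
    have h1 : 𝟙 (coreg k A) = g ≫ I.coeffSum := by
      rw [← sub_eq_zero, ← he]; exact hom_ext h0
    exact (LinearMap.congr_fun (congrArg Hom.lin h1) y).symm
  · exfalso
    have : Nontrivial (HopfRep.sub _ (LinearMap.range e.lin) (range_invariant e)).carrier :=
      Submodule.nontrivial_iff_ne_bot.2 fun h => h0 (LinearMap.range_eq_bot.1 h)
    obtain ⟨W, i, hW, hi⟩ := exists_irreducible
      (HopfRep.sub _ (LinearMap.range e.lin) (range_invariant e))
    obtain ⟨j, ⟨e'⟩⟩ := I.exists_iso W hW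
    set f : I.mod j ⟶ coreg k A := e'.inv ≫ i ≫ subIncl _ _ _ with hf
    have hfe' : f ≫ e = f := by
      ext x : 2
      obtain ⟨y, hy⟩ := (i.lin (e'.inv.lin x)).2
      change e.lin (i.lin (e'.inv.lin x)).1 = (i.lin (e'.inv.lin x)).1
      rw [← hy]
      exact LinearMap.congr_fun (congrArg Hom.lin hee) y
    classical
    -- The functional of f, its value at 1, is expanded in the dual basis.
    have hfI : f = (∑ a, (evOne k A ∘ₗ f.lin) (Module.finBasis k (I.mod j).carrier a) •
        piIncl (fun p : I.Idx => I.mod p.1) ⟨j, a⟩) ≫ I.coeffSum := by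
      rw [Preadditive.sum_comp]
      have h3 (a) (c : k) : (c • piIncl (fun p : I.Idx => I.mod p.1) ⟨j, a⟩) ≫ I.coeffSum =
          c • mc ((Module.finBasis k (I.mod j).carrier).coord a) := by
        rw [Linear.smul_comp, piIncl_coeffSum]; rfl
      rw [Finset.sum_congr rfl fun a _ => h3 a _, ← mc_sum_smul, eq_mc f]
      congr 1
      refine (Module.finBasis k (I.mod j).carrier).ext fun b => ?_
      rw [← eq_mc f]
      simp [Finsupp.single_apply]
    have hf0 : f = 0 := by rw [← hfe', hfI, Category.assoc, hfe, comp_zero]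
    have := hW.1
    obtain ⟨x, hx⟩ := exists_ne (0 : W.carrier)
    apply hx
    have h1 : e'.inv.lin (e'.hom.lin x) = x :=
      LinearMap.congr_fun (congrArg Hom.lin e'.hom_inv_id) x
    refine hi (Subtype.ext ?_)
    rw [← h1]
    exact (LinearMap.congr_fun (congrArg Hom.lin hf0) (e'.hom.lin x)).trans (by rw [map_zero]; rfl)

/-- The coregular module is the direct sum of the irreducible modules, each with its dimension as
multiplicity. -/
noncomputable def coeffIso (hA : Regular k A) (I : IrrSystem k A) :
    pi (fun p : I.Idx => I.mod p.1) ≅ coreg k A :=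
  isoMk (LinearEquiv.ofBijective I.coeffSum.lin ⟨I.coeffSum_injective, I.coeffSum_surjective hA⟩)
    I.coeffSum.comm

open HopfAlgebra in
/-- The decomposition of the regular character. -/
lemma regularTrace_eq [CharZero k] (hA : Regular k A) (I : IrrSystem k A) :
    regularTrace k A = ∑ j, (Module.finrank k (I.mod j).carrier : k) •
      ∑ i, (mc ((Module.finBasis k (I.mod j).carrier).coord i)).lin
        (Module.finBasis k (I.mod j).carrier i) := by
  obtain ⟨Λ, hΛ⟩ := hA.exists_integral
  have := hA.isSemisimpleRing
  ext a
  -- The trace on A* is first computed from the decomposition, in which each irreducible module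
  -- occurs as often as its dimension.
  have h1 (b : A) : LinearMap.trace k _ (coregAct k A b) =
      ∑ j, (Module.finrank k (I.mod j).carrier : k) * LinearMap.trace k _ ((I.mod j).ρ b) := by
    classical
    let e := LinearEquiv.ofBijective I.coeffSum.lin
      ⟨I.coeffSum_injective, I.coeffSum_surjective hA⟩
    have h2 : coregAct k A b = e.conj ((pi (fun p : I.Idx => I.mod p.1)).ρ b) := by
      ext1 φ
      obtain ⟨x, rfl⟩ := e.surjective φ
      rw [LinearEquiv.conj_apply_apply, LinearEquiv.symm_apply_apply]
      exact (lin_ρ I.coeffSum b x).symm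
    rw [h2, LinearMap.trace_conj', trace_pi, Fintype.sum_sigma]
    refine Finset.sum_congr rfl fun j _ => ?_
    have h3 (i) : LinearMap.proj i ∘ₗ (pi (fun p : I.Idx => I.mod p.1)).ρ b ∘ₗ
        LinearMap.single k (fun p : I.Idx => (I.mod p.1).carrier) i = (I.mod i.1).ρ b := by
      ext x
      simp
    refine (Finset.sum_congr rfl fun i _ => congrArg (LinearMap.trace k _) (h3 ⟨j, i⟩)).trans ?_
    change ∑ _i : Fin (Module.finrank k (I.mod j).carrier), LinearMap.trace k _ ((I.mod j).ρ b) = _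
    rw [Finset.sum_const, Finset.card_univ, Fintype.card_fin, nsmul_eq_mul]
  -- The coregular action is transposed to right multiplication, which the antipode conjugates to
  -- left multiplication by S(b); and x ∘ S = x.
  have h2 (b : A) : LinearMap.trace k _ (coregAct k A b) = regularTrace k A b := by
    have h3 : coregAct k A b = Module.Dual.transpose (LinearMap.mulRight k b) := by
      ext; simp [Module.Dual.transpose]
    rw [h3, LinearMap.trace_transpose']
    let e : A ≃ₗ[k] A := LinearEquiv.ofBijective (antipode k)
      ⟨antipode_injective, fun b => ⟨antipodeInv k b, antipode_antipodeInv b⟩⟩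
    rw [← regularTrace_antipode hΛ, regularTrace_apply, ← LinearMap.trace_conj' _ e]
    congr 1
    ext y
    obtain ⟨z, rfl⟩ := e.surjective y
    rw [LinearEquiv.conj_apply_apply, LinearEquiv.symm_apply_apply]
    exact antipode_mul_antidistrib z b
  have h3 (j) : LinearMap.trace k _ ((I.mod j).ρ a) =
      ∑ i, (Module.finBasis k (I.mod j).carrier).coord i
        ((I.mod j).ρ a (Module.finBasis k (I.mod j).carrier i)) := by
    classical
    rw [LinearMap.trace_eq_matrix_trace k (Module.finBasis k (I.mod j).carrier), Matrix.trace]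
    simp [LinearMap.toMatrix_apply]
  rw [← h2, h1]
  simp only [LinearMap.sum_apply, LinearMap.smul_apply, smul_eq_mul, h3]
  rfl

/-- The unit module `𝔄` is the direct sum of the images of the
irreducible modules. -/
lemma isIso_desc {T : Type v} [Category.{w} T] [Abelian T] [Linear k T] [MonoidalCategory T]
    [MonoidalPreadditive T] [MonoidalLinear k T] (𝒜 : Realization k T)
    (hA : Regular k 𝒜.A) (I : IrrSystem k 𝒜.A) :
    IsIso (biproduct.desc
      (f := fun p : Σ j, Fin (Module.finrank k (I.mod j).carrier) => 𝒜.F.obj (I.mod p.1))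
      (fun p => HopfBimod.unitMc 𝒜 ((Module.finBasis k (I.mod p.1).carrier).coord p.2))) := by
  classical
  change IsIso (biproduct.desc (f := fun p : I.Idx => 𝒜.F.obj (I.mod p.1))
    (fun p => (𝒜.F.map (I.coeffs p) : _ ⟶ 𝒜.F.obj (coreg k 𝒜.A))))
  let e := I.coeffIso hA
  have hinc (p : I.Idx) : piIncl (fun p : I.Idx => I.mod p.1) p ≫ e.hom = I.coeffs p :=
    piIncl_coeffSum I p
  have hsum : ∑ p : I.Idx, piProj (fun p : I.Idx => I.mod p.1) p ≫ I.coeffs p = e.hom := rfl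
  have hpp (p q : I.Idx) : piIncl (fun p : I.Idx => I.mod p.1) p ≫ piProj _ q =
      if h : p = q then eqToHom (by rw [h]) else 0 := by
    split_ifs with h
    · subst h
      ext x
      exact Pi.single_eq_same (M := fun p : I.Idx => (I.mod p.1).carrier) p x
    · ext x
      exact Pi.single_eq_of_ne (M := fun p : I.Idx => (I.mod p.1).carrier) (Ne.symm h) x
  refine ⟨∑ p : I.Idx, 𝒜.F.map (e.inv ≫ piProj _ p) ≫ biproduct.ι
    (fun p : I.Idx => 𝒜.F.obj (I.mod p.1)) p, ?_, ?_⟩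
  · refine biproduct.hom_ext' _ _ fun p => ?_
    rw [biproduct.ι_desc_assoc, Category.comp_id, Preadditive.comp_sum, Finset.sum_eq_single p]
    · have h1 : I.coeffs p ≫ e.inv ≫ piProj _ p = 𝟙 _ := by
        rw [← hinc, Category.assoc, e.hom_inv_id_assoc, hpp]; simp
      rw [← Category.assoc, ← Functor.map_comp, h1, CategoryTheory.Functor.map_id, Category.id_comp]
    · intro q _ hq
      have h1 : I.coeffs p ≫ e.inv ≫ piProj _ q = 0 := by
        rw [← hinc, Category.assoc, e.hom_inv_id_assoc, hpp, dif_neg hq.symm]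
      rw [← Category.assoc, ← Functor.map_comp, h1, Functor.map_zero, zero_comp]
    · simp
  · rw [Preadditive.sum_comp]
    have h1 (p : I.Idx) : (𝒜.F.map (e.inv ≫ piProj _ p) ≫ biproduct.ι
        (fun p : I.Idx => 𝒜.F.obj (I.mod p.1)) p) ≫
          biproduct.desc (fun p => 𝒜.F.map (I.coeffs p)) =
        𝒜.F.map (e.inv ≫ piProj _ p ≫ I.coeffs p) := by
      rw [Category.assoc, biproduct.ι_desc, ← Functor.map_comp, Category.assoc]
    rw [Finset.sum_congr rfl fun p _ => h1 p, ← Functor.map_sum, ← Preadditive.comp_sum, hsum,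
      e.inv_hom_id, CategoryTheory.Functor.map_id]

end IrrSystem

/-! ### Functionals on a tensor product. -/

section dualTensor

open HopfRep

variable {k : Type u} [Field k] {V W : Type*} [AddCommGroup V] [Module k V] [Module.Finite k V]
  [AddCommGroup W] [Module k W] [Module.Finite k W]

/-- In finite dimension the products of coordinate functionals form a basis. Axioms of modules are
stated for such products only, and extend to all functionals by this. -/
lemma HopfRep.dtens_ext {M : Type*} [AddCommGroup M] [Module k M]
    {p q : Module.Dual k (V ⊗[k] W) →ₗ[k] M} (h : ∀ f g, p (dtens f g) = q (dtens f g)) :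
    p = q := by
  ext φ
  have h1 : φ = ∑ i, ∑ j, φ (Module.finBasis k V i ⊗ₜ Module.finBasis k W j) •
      dtens ((Module.finBasis k V).coord i) ((Module.finBasis k W).coord j) := by
    refine (Module.Basis.tensorProduct (Module.finBasis k V) (Module.finBasis k W)).ext ?_
    rintro ⟨i, j⟩
    rw [Module.Basis.tensorProduct_apply]
    simp only [LinearMap.sum_apply, LinearMap.smul_apply]
    rw [Finset.sum_eq_single i, Finset.sum_eq_single j]
    · have : dtens ((Module.finBasis k V).coord i) ((Module.finBasis k W).coord j)
        (Module.finBasis k V i ⊗ₜ Module.finBasis k W j) =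
          (Module.finBasis k V).coord i (Module.finBasis k V i) *
            (Module.finBasis k W).coord j (Module.finBasis k W j) := rfl
      rw [this]; simp
    · intro j' _ hj
      have : dtens ((Module.finBasis k V).coord i) ((Module.finBasis k W).coord j')
        (Module.finBasis k V i ⊗ₜ Module.finBasis k W j) =
          (Module.finBasis k V).coord i (Module.finBasis k V i) *
            (Module.finBasis k W).coord j' (Module.finBasis k W j) := rfl
      rw [this]; simp [hj.symm]
    · simp
    · intro i' _ hi
      refine Finset.sum_eq_zero fun j' _ => ?_
      have : dtens ((Module.finBasis k V).coord i') ((Module.finBasis k W).coord j')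
        (Module.finBasis k V i ⊗ₜ Module.finBasis k W j) =
          (Module.finBasis k V).coord i' (Module.finBasis k V i) *
            (Module.finBasis k W).coord j' (Module.finBasis k W j) := rfl
      rw [this]; simp [hi.symm]
    · simp
  rw [h1]
  simp only [map_sum, map_smul, h]

end dualTensor

/-! ### The coactions, that is, the inverses of the trivializing isomorphisms. -/

namespace BimodStr

variable {k : Type u} [Field k] {T : Type v} [Category.{w} T] [Preadditive T]
  [Linear k T] [MonoidalCategory T] [MonoidalPreadditive T] [MonoidalLinear k T]
  {𝒜 ℬ : Realization k T} {X : T}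

section ext

variable (S : BimodStr 𝒜 ℬ X)

/-- The actions for all f are the components of an isomorphism X ⊗ G(W) → W ⊗ X, so they are jointly
monic; likewise the coactions are jointly epic. All axioms of the coactions follow by this from
those of the actions. -/
lemma ract_ext {W : ℬ.Mod} {Z : T} {g h : Z ⟶ X ⊗ ℬ.F.obj W}
    (H : ∀ f, g ≫ S.ract W f = h ≫ S.ract W f) : g = h := by
  rw [← Category.comp_id g, ← Category.comp_id h, ← S.ract_rcoact W]
  simp only [Preadditive.comp_sum, reassoc_of% H]

lemma lact_ext {V : 𝒜.Mod} {Z : T} {g h : Z ⟶ 𝒜.F.obj V ⊗ X}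
    (H : ∀ f, g ≫ S.lact V f = h ≫ S.lact V f) : g = h := by
  rw [← Category.comp_id g, ← Category.comp_id h, ← S.lact_lcoact V]
  simp only [Preadditive.comp_sum, reassoc_of% H]

lemma rcoact_ext {W : ℬ.Mod} {Z : T} {g h : X ⊗ ℬ.F.obj W ⟶ Z}
    (H : ∀ w, S.rcoact W w ≫ g = S.rcoact W w ≫ h) : g = h := by
  rw [← Category.id_comp g, ← Category.id_comp h, ← S.ract_rcoact W]
  simp only [Preadditive.sum_comp, Category.assoc, H]

lemma rcoact_whiskerRight_ext {W : ℬ.Mod} {Y Z : T} {g h : (X ⊗ ℬ.F.obj W) ⊗ Y ⟶ Z}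
    (H : ∀ w, S.rcoact W w ▷ Y ≫ g = S.rcoact W w ▷ Y ≫ h) : g = h := by
  rw [← Category.id_comp g, ← Category.id_comp h, ← id_whiskerRight, ← S.ract_rcoact W]
  simp only [sum_whiskerRight, comp_whiskerRight, Preadditive.sum_comp, Category.assoc, H]

lemma rcoact_whiskerLeft_ext {W : ℬ.Mod} {Y Z : T} {g h : Y ⊗ X ⊗ ℬ.F.obj W ⟶ Z}
    (H : ∀ w, Y ◁ S.rcoact W w ≫ g = Y ◁ S.rcoact W w ≫ h) : g = h := by
  rw [← Category.id_comp g, ← Category.id_comp h, ← MonoidalCategory.whiskerLeft_id,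
    ← S.ract_rcoact W]
  simp only [whiskerLeft_sum, MonoidalCategory.whiskerLeft_comp, Preadditive.sum_comp,
    Category.assoc, H]

lemma lcoact_whiskerRight_ext {V : 𝒜.Mod} {Y Z : T} {g h : (𝒜.F.obj V ⊗ X) ⊗ Y ⟶ Z}
    (H : ∀ v, S.lcoact V v ▷ Y ≫ g = S.lcoact V v ▷ Y ≫ h) : g = h := by
  rw [← Category.id_comp g, ← Category.id_comp h, ← id_whiskerRight, ← S.lact_lcoact V]
  simp only [sum_whiskerRight, comp_whiskerRight, Preadditive.sum_comp, Category.assoc, H]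

lemma eq_rcoact {W : ℬ.Mod} {w : W.carrier} {h : X ⟶ X ⊗ ℬ.F.obj W}
    (H : ∀ f, h ≫ S.ract W f = f w • 𝟙 X) : h = S.rcoact W w :=
  S.ract_ext fun f => by rw [H, S.rcoact_ract]

lemma eq_lcoact {V : 𝒜.Mod} {v : V.carrier} {h : X ⟶ 𝒜.F.obj V ⊗ X}
    (H : ∀ f, h ≫ S.lact V f = f v • 𝟙 X) : h = S.lcoact V v :=
  S.lact_ext fun f => by rw [H, S.lcoact_lact]

lemma rcoact_nat {W W' : ℬ.Mod} (g : W ⟶ W') (w : W.carrier) :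
    S.rcoact W w ≫ X ◁ ℬ.F.map g = S.rcoact W' (g.lin w) :=
  S.eq_rcoact fun f => by rw [Category.assoc, S.ract_nat, S.rcoact_ract]; rfl

lemma lcoact_nat {V V' : 𝒜.Mod} (g : V ⟶ V') (v : V.carrier) :
    S.lcoact V v ≫ 𝒜.F.map g ▷ X = S.lcoact V' (g.lin v) :=
  S.eq_lcoact fun f => by rw [Category.assoc, S.lact_nat, S.lcoact_lact]; rfl

lemma rcoact_unit : S.rcoact (𝟙_ _) (1 : k) = (ρ_ X).inv ≫ X ◁ ε ℬ.F := by
  refine (S.eq_rcoact fun f => ?_).symm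
  have h : f = f (1 : k) • (LinearMap.id : k →ₗ[k] k) := LinearMap.ext_ring (by simp)
  rw [h, map_smul, Linear.comp_smul, Category.assoc, S.ract_unit, Iso.inv_hom_id]
  simp

lemma lcoact_unit : S.lcoact (𝟙_ _) (1 : k) = (λ_ X).inv ≫ ε 𝒜.F ▷ X := by
  refine (S.eq_lcoact fun f => ?_).symm
  have h : f = f (1 : k) • (LinearMap.id : k →ₗ[k] k) := LinearMap.ext_ring (by simp)
  rw [h, map_smul, Linear.comp_smul, Category.assoc, S.lact_unit, Iso.inv_hom_id]
  simp

/-- Inverting the multiplicativity of the action reverses the order: the coaction for W' comes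
first. -/
lemma rcoact_tensor (W W' : ℬ.Mod) (w : W.carrier) (w' : W'.carrier) :
    S.rcoact (W ⊗ W') (w ⊗ₜ[k] w') =
      S.rcoact W' w' ≫ S.rcoact W w ▷ ℬ.F.obj W' ≫ (α_ _ _ _).hom ≫ X ◁ μ ℬ.F W W' := by
  refine (S.eq_rcoact fun f => ?_).symm
  refine LinearMap.congr_fun (HopfRep.dtens_ext (p := Linear.leftComp k _ (S.rcoact W' w' ≫
    S.rcoact W w ▷ ℬ.F.obj W' ≫ (α_ _ _ _).hom ≫ X ◁ μ ℬ.F W W') ∘ₗ S.ract (W ⊗ W'))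
    (q := LinearMap.smulRight (Module.Dual.eval k _ (w ⊗ₜ[k] w')) (𝟙 X)) fun f f' => ?_) f
  simp only [LinearMap.comp_apply, Linear.leftComp_apply, Category.assoc, S.ract_tensor,
    Iso.hom_inv_id_assoc]
  rw [← comp_whiskerRight_assoc, S.rcoact_ract]
  simp only [MonoidalLinear.smul_whiskerRight, id_whiskerRight, Linear.smul_comp, Linear.comp_smul,
    Category.id_comp, S.rcoact_ract, smul_smul]
  rfl

lemma lcoact_tensor (V V' : 𝒜.Mod) (v : V.carrier) (v' : V'.carrier) :
    S.lcoact (V ⊗ V') (v ⊗ₜ[k] v') =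
      S.lcoact V v ≫ 𝒜.F.obj V ◁ S.lcoact V' v' ≫ (α_ _ _ _).inv ≫ μ 𝒜.F V V' ▷ X := by
  refine (S.eq_lcoact fun f => ?_).symm
  refine LinearMap.congr_fun (HopfRep.dtens_ext (p := Linear.leftComp k _ (S.lcoact V v ≫
    𝒜.F.obj V ◁ S.lcoact V' v' ≫ (α_ _ _ _).inv ≫ μ 𝒜.F V V' ▷ X) ∘ₗ S.lact (V ⊗ V'))
    (q := LinearMap.smulRight (Module.Dual.eval k _ (v ⊗ₜ[k] v')) (𝟙 X)) fun f f' => ?_) f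
  simp only [LinearMap.comp_apply, Linear.leftComp_apply, Category.assoc, S.lact_tensor,
    Iso.inv_hom_id_assoc]
  rw [← MonoidalCategory.whiskerLeft_comp_assoc, S.lcoact_lact]
  simp only [MonoidalLinear.whiskerLeft_smul, MonoidalCategory.whiskerLeft_id, Linear.smul_comp,
    Linear.comp_smul, Category.id_comp, S.lcoact_lact, smul_smul]
  exact congrArg (· • 𝟙 X) (mul_comm _ _)

lemma lact_rcoact (V : 𝒜.Mod) (W : ℬ.Mod) (f : Module.Dual k V.carrier) (w : W.carrier) :
    S.lact V f ≫ S.rcoact W w =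
      𝒜.F.obj V ◁ S.rcoact W w ≫ (α_ _ _ _).inv ≫ S.lact V f ▷ ℬ.F.obj W :=
  S.ract_ext fun f' => by
    simp only [Category.assoc, S.lact_ract, Iso.inv_hom_id_assoc, S.rcoact_ract]
    rw [← MonoidalCategory.whiskerLeft_comp_assoc, S.rcoact_ract]
    simp

lemma ract_lcoact (V : 𝒜.Mod) (W : ℬ.Mod) (v : V.carrier) (f : Module.Dual k W.carrier) :
    S.ract W f ≫ S.lcoact V v =
      S.lcoact V v ▷ ℬ.F.obj W ≫ (α_ _ _ _).hom ≫ 𝒜.F.obj V ◁ S.ract W f :=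
  S.lact_ext fun f' => by
    simp only [Category.assoc, ← S.lact_ract, S.lcoact_lact]
    rw [← comp_whiskerRight_assoc, S.lcoact_lact]
    simp

/-- The right actions in terms of the coactions. -/
lemma ract_eq (W : ℬ.Mod) (g : Module.Dual k W.carrier) :
    S.ract W g = S.rcoact W.dual g ▷ ℬ.F.obj W ≫ (α_ _ _ _).hom ≫ X ◁ ℬ.pairing W ≫
      (ρ_ X).hom := by
  refine S.rcoact_ext fun w => ?_
  have h1 := S.rcoact_tensor W.dual W g w
  have h2 := S.rcoact_nat W.ev (g ⊗ₜ[k] w)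
  have h3 : W.ev.lin (g ⊗ₜ[k] w) = g w • (1 : k) := (mul_one _).symm
  rw [h3, map_smul, S.rcoact_unit, h1] at h2
  have h4 := congrArg (fun t => t ≫ X ◁ η ℬ.F ≫ (ρ_ X).hom) h2
  simp only [Category.assoc, Linear.smul_comp] at h4
  rw [S.rcoact_ract, Realization.pairing]
  simp only [MonoidalCategory.whiskerLeft_comp, Category.assoc, h4]
  rw [← MonoidalCategory.whiskerLeft_comp_assoc, Functor.Monoidal.ε_η]
  simp

end ext

end BimodStr

/-! ### Module structures given by an action on one side and a coaction on the other. -/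

section mixed

variable {k : Type u} [Field k] {T : Type v} [Category.{w} T] [Preadditive T]
  [Linear k T] [MonoidalCategory T]

/-- A left action and a right coaction that commute: the data of a module of which the right action
is given by its inverse. -/
structure ActCoact (𝒜 ℬ : Realization k T) (X : T) where
  lact (V : 𝒜.Mod) : Module.Dual k V.carrier →ₗ[k] (𝒜.F.obj V ⊗ X ⟶ X)
  rcoact (W : ℬ.Mod) : W.carrier →ₗ[k] (X ⟶ X ⊗ ℬ.F.obj W)
  lact_nat {V V' : 𝒜.Mod} (g : V ⟶ V') (f : Module.Dual k V'.carrier) :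
    𝒜.F.map g ▷ X ≫ lact V' f = lact V (f ∘ₗ g.lin)
  rcoact_nat {W W' : ℬ.Mod} (g : W ⟶ W') (w : W.carrier) :
    rcoact W w ≫ X ◁ ℬ.F.map g = rcoact W' (g.lin w)
  lact_unit : ε 𝒜.F ▷ X ≫ lact (𝟙_ _) (LinearMap.id : k →ₗ[k] k) = (λ_ X).hom
  rcoact_unit : rcoact (𝟙_ _) (1 : k) = (ρ_ X).inv ≫ X ◁ ε ℬ.F
  lact_tensor (V V' : 𝒜.Mod) (f : Module.Dual k V.carrier) (f' : Module.Dual k V'.carrier) :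
    μ 𝒜.F V V' ▷ X ≫ lact (V ⊗ V') (HopfRep.dtens f f') =
      (α_ _ _ _).hom ≫ 𝒜.F.obj V ◁ lact V' f' ≫ lact V f
  rcoact_tensor (W W' : ℬ.Mod) (w : W.carrier) (w' : W'.carrier) :
    rcoact (W ⊗ W') (w ⊗ₜ[k] w') =
      rcoact W' w' ≫ rcoact W w ▷ ℬ.F.obj W' ≫ (α_ _ _ _).hom ≫ X ◁ μ ℬ.F W W'
  lact_rcoact (V : 𝒜.Mod) (W : ℬ.Mod) (f : Module.Dual k V.carrier) (w : W.carrier) :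
    lact V f ≫ rcoact W w =
      𝒜.F.obj V ◁ rcoact W w ≫ (α_ _ _ _).inv ≫ lact V f ▷ ℬ.F.obj W

/-- A left coaction and a right action that commute: the data of a module of which the left action
is given by its inverse. -/
structure CoactAct (𝒜 ℬ : Realization k T) (X : T) where
  lcoact (V : 𝒜.Mod) : V.carrier →ₗ[k] (X ⟶ 𝒜.F.obj V ⊗ X)
  ract (W : ℬ.Mod) : Module.Dual k W.carrier →ₗ[k] (X ⊗ ℬ.F.obj W ⟶ X)
  lcoact_nat {V V' : 𝒜.Mod} (g : V ⟶ V') (v : V.carrier) :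
    lcoact V v ≫ 𝒜.F.map g ▷ X = lcoact V' (g.lin v)
  ract_nat {W W' : ℬ.Mod} (g : W ⟶ W') (f : Module.Dual k W'.carrier) :
    X ◁ ℬ.F.map g ≫ ract W' f = ract W (f ∘ₗ g.lin)
  lcoact_unit : lcoact (𝟙_ _) (1 : k) = (λ_ X).inv ≫ ε 𝒜.F ▷ X
  ract_unit : X ◁ ε ℬ.F ≫ ract (𝟙_ _) (LinearMap.id : k →ₗ[k] k) = (ρ_ X).hom
  lcoact_tensor (V V' : 𝒜.Mod) (v : V.carrier) (v' : V'.carrier) :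
    lcoact (V ⊗ V') (v ⊗ₜ[k] v') =
      lcoact V v ≫ 𝒜.F.obj V ◁ lcoact V' v' ≫ (α_ _ _ _).inv ≫ μ 𝒜.F V V' ▷ X
  ract_tensor (W W' : ℬ.Mod) (f : Module.Dual k W.carrier) (f' : Module.Dual k W'.carrier) :
    X ◁ μ ℬ.F W W' ≫ ract (W ⊗ W') (HopfRep.dtens f f') =
      (α_ _ _ _).inv ≫ ract W f ▷ ℬ.F.obj W' ≫ ract W' f'
  ract_lcoact (V : 𝒜.Mod) (W : ℬ.Mod) (v : V.carrier) (f : Module.Dual k W.carrier) :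
    ract W f ≫ lcoact V v =
      lcoact V v ▷ ℬ.F.obj W ≫ (α_ _ _ _).hom ≫ 𝒜.F.obj V ◁ ract W f

end mixed

/-! ### Recovering the missing action as the inverse of a coaction. -/

section completion

open HopfRep

variable {k : Type u} [Field k] {T : Type v} [Category.{w} T] [Preadditive T]
  [Linear k T] [MonoidalCategory T] [MonoidalPreadditive T] [MonoidalLinear k T]
  {𝒜 ℬ : Realization k T} {X : T}

namespace ActCoact

variable (S : ActCoact 𝒜 ℬ X)

/-- The right action given by the inverse of the coaction. -/
noncomputable def ract (W : ℬ.Mod) : Module.Dual k W.carrier →ₗ[k] (X ⊗ ℬ.F.obj W ⟶ X) where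
  toFun g := S.rcoact W.dual g ▷ ℬ.F.obj W ≫ (α_ _ _ _).hom ≫ X ◁ ℬ.pairing W ≫ (ρ_ X).hom
  map_add' f g := by simp
  map_smul' c f := by simp

lemma ract_apply (W : ℬ.Mod) (g : Module.Dual k W.carrier) : S.ract W g =
    S.rcoact W.dual g ▷ ℬ.F.obj W ≫ (α_ _ _ _).hom ≫ X ◁ ℬ.pairing W ≫ (ρ_ X).hom := rfl

lemma rcoact_ract (W : ℬ.Mod) (w : W.carrier) (g : Module.Dual k W.carrier) :
    S.rcoact W w ≫ S.ract W g = g w • 𝟙 X := by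
  have h1 := S.rcoact_tensor W.dual W g w
  have h2 := S.rcoact_nat W.ev (g ⊗ₜ[k] w)
  have h3 : W.ev.lin (g ⊗ₜ[k] w) = g w • (1 : k) := (mul_one _).symm
  rw [h3, map_smul, S.rcoact_unit, h1] at h2
  have h4 := congrArg (fun t => t ≫ X ◁ η ℬ.F ≫ (ρ_ X).hom) h2
  simp only [Category.assoc, Linear.smul_comp] at h4
  rw [ract_apply, Realization.pairing]
  simp only [MonoidalCategory.whiskerLeft_comp, Category.assoc, h4]
  rw [← MonoidalCategory.whiskerLeft_comp_assoc, Functor.Monoidal.ε_η]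
  simp

/-- By multiplicativity the sum is the coaction for W ⊗ W* at the canonical element. That element is
the image of 1 under the invariant copairing, so naturality replaces the coaction by the copairing
of G(W), and the snake identity remains. -/
lemma ract_rcoact (W : ℬ.Mod) :
    ∑ i, S.ract W ((Module.finBasis k W.carrier).coord i) ≫
      S.rcoact W (Module.finBasis k W.carrier i) = 𝟙 _ := by
  let _ := mapPairing ℬ.F W W.dual
  have h (i) : S.ract W ((Module.finBasis k W.carrier).coord i) ≫
      S.rcoact W (Module.finBasis k W.carrier i) =
      S.rcoact (W ⊗ W.dual) (Module.finBasis k W.carrier i ⊗ₜ[k]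
        (Module.finBasis k W.carrier).coord i) ▷ ℬ.F.obj W ≫
        (X ◁ δ ℬ.F W W.dual) ▷ ℬ.F.obj W ≫ (α_ _ _ _).hom ≫ X ◁ ((α_ _ _ _).hom ≫
          ℬ.F.obj W ◁ ℬ.pairing W ≫ (ρ_ _).hom) := by
    rw [S.rcoact_tensor]
    simp only [comp_whiskerRight, Category.assoc]
    rw [← comp_whiskerRight_assoc (X ◁ μ ℬ.F W W.dual), ← MonoidalCategory.whiskerLeft_comp,
      Functor.Monoidal.μ_δ, ract_apply]
    simp only [Category.assoc, MonoidalCategory.whiskerLeft_id, id_whiskerRight, Category.id_comp]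
    rw [← rightUnitor_naturality, whisker_exchange_assoc]
    monoidal
  simp only [h, ← Preadditive.sum_comp, ← sum_whiskerRight, ← map_sum]
  have h2 := S.rcoact_nat W.coev (1 : k)
  rw [coev_apply, S.rcoact_unit] at h2
  refine (congrArg (fun t => t ▷ ℬ.F.obj W ≫ (X ◁ δ ℬ.F W W.dual) ▷ ℬ.F.obj W ≫
    (α_ _ _ _).hom ≫ X ◁ ((α_ _ _ _).hom ≫
      ℬ.F.obj W ◁ ℬ.pairing W ≫ (ρ_ _).hom)) h2.symm).trans ?_
  calc _ = 𝟙 _ ⊗≫ X ◁ (η_ (ℬ.F.obj W) (ℬ.F.obj W.dual) ▷ ℬ.F.obj W ≫ (α_ _ _ _).hom ≫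
        ℬ.F.obj W ◁ ε_ (ℬ.F.obj W) (ℬ.F.obj W.dual)) ⊗≫ 𝟙 _ := by
        change _ = 𝟙 _ ⊗≫ X ◁ ((ε ℬ.F ≫ ℬ.F.map W.coev ≫ δ ℬ.F W W.dual) ▷ ℬ.F.obj W ≫
          (α_ _ _ _).hom ≫ ℬ.F.obj W ◁ ℬ.pairing W) ⊗≫ 𝟙 _
        monoidal
    _ = _ := by rw [ExactPairing.evaluation_coevaluation]; monoidal

lemma rcoact_ext {W : ℬ.Mod} {Z : T} {g h : X ⊗ ℬ.F.obj W ⟶ Z}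
    (H : ∀ w, S.rcoact W w ≫ g = S.rcoact W w ≫ h) : g = h := by
  rw [← Category.id_comp g, ← Category.id_comp h, ← S.ract_rcoact W]
  simp only [Preadditive.sum_comp, Category.assoc, H]

lemma rcoact_whiskerRight_ext {W : ℬ.Mod} {Y Z : T} {g h : (X ⊗ ℬ.F.obj W) ⊗ Y ⟶ Z}
    (H : ∀ w, S.rcoact W w ▷ Y ≫ g = S.rcoact W w ▷ Y ≫ h) : g = h := by
  rw [← Category.id_comp g, ← Category.id_comp h, ← id_whiskerRight, ← S.ract_rcoact W]
  simp only [sum_whiskerRight, comp_whiskerRight, Preadditive.sum_comp, Category.assoc, H]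

lemma rcoact_whiskerLeft_ext {W : ℬ.Mod} {Y Z : T} {g h : Y ⊗ X ⊗ ℬ.F.obj W ⟶ Z}
    (H : ∀ w, Y ◁ S.rcoact W w ≫ g = Y ◁ S.rcoact W w ≫ h) : g = h := by
  rw [← Category.id_comp g, ← Category.id_comp h, ← MonoidalCategory.whiskerLeft_id,
    ← S.ract_rcoact W]
  simp only [whiskerLeft_sum, MonoidalCategory.whiskerLeft_comp, Preadditive.sum_comp,
    Category.assoc, H]

/-- The two actions. -/
noncomputable def toActStr : ActStr 𝒜 ℬ X where
  lact := S.lact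
  ract := S.ract
  lact_nat := S.lact_nat
  lact_unit := S.lact_unit
  lact_tensor := S.lact_tensor
  ract_nat {W W'} g f := S.rcoact_ext fun w => by
    rw [reassoc_of% (S.rcoact_nat g w), S.rcoact_ract, S.rcoact_ract]; rfl
  ract_unit := by
    have h := S.rcoact_ract (𝟙_ _) (1 : k) (LinearMap.id : k →ₗ[k] k)
    rw [S.rcoact_unit, Category.assoc, Iso.inv_comp_eq] at h
    refine h.trans ?_
    change (ρ_ X).hom ≫ ((1 : k) • 𝟙 X) = _
    simp
  ract_tensor W W' f f' := by
    rw [Iso.eq_inv_comp]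
    refine S.rcoact_whiskerRight_ext fun w => S.rcoact_ext fun w' => ?_
    have h := S.rcoact_ract (W ⊗ W') (w ⊗ₜ[k] w') (HopfRep.dtens f f')
    rw [S.rcoact_tensor] at h
    simp only [Category.assoc] at h
    rw [h, ← comp_whiskerRight_assoc, S.rcoact_ract]
    simp only [MonoidalLinear.smul_whiskerRight, id_whiskerRight, Linear.smul_comp,
      Linear.comp_smul, Category.id_comp, S.rcoact_ract, smul_smul]
    rfl
  lact_ract V W f g := by
    rw [← Iso.inv_comp_eq]
    refine S.rcoact_whiskerLeft_ext fun w => ?_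
    rw [← reassoc_of% (S.lact_rcoact V W f w), S.rcoact_ract,
      ← MonoidalCategory.whiskerLeft_comp_assoc, S.rcoact_ract]
    simp

/-- The module structure of which these are the left action and the right coaction. -/
noncomputable def toBimodStr : BimodStr 𝒜 ℬ X := S.toActStr.toBimodStr

lemma toBimodStr_rcoact : S.toBimodStr.rcoact = S.rcoact := by
  ext W w
  exact (S.toBimodStr.eq_rcoact fun f => S.rcoact_ract W w f).symm

end ActCoact

namespace CoactAct

variable (S : CoactAct 𝒜 ℬ X)

/-- The left action given by the inverse of the coaction. -/
noncomputable def lact (V : 𝒜.Mod) : Module.Dual k V.carrier →ₗ[k] (𝒜.F.obj V ⊗ X ⟶ X) where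
  toFun g := 𝒜.F.obj V ◁ S.lcoact V.predual g ≫ (α_ _ _ _).inv ≫
    (μ 𝒜.F V V.predual ≫ 𝒜.F.map V.ev' ≫ η 𝒜.F) ▷ X ≫ (λ_ X).hom
  map_add' f g := by simp
  map_smul' c f := by simp

lemma lact_apply (V : 𝒜.Mod) (g : Module.Dual k V.carrier) : S.lact V g =
    𝒜.F.obj V ◁ S.lcoact V.predual g ≫ (α_ _ _ _).inv ≫
      (μ 𝒜.F V V.predual ≫ 𝒜.F.map V.ev' ≫ η 𝒜.F) ▷ X ≫ (λ_ X).hom := rfl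

lemma lcoact_lact (V : 𝒜.Mod) (v : V.carrier) (g : Module.Dual k V.carrier) :
    S.lcoact V v ≫ S.lact V g = g v • 𝟙 X := by
  have h1 := S.lcoact_tensor V V.predual v g
  have h2 := S.lcoact_nat V.ev' (v ⊗ₜ[k] g)
  have h3 : V.ev'.lin (v ⊗ₜ[k] g) = g v • (1 : k) := (mul_one _).symm
  rw [h3, map_smul, S.lcoact_unit, h1] at h2
  have h4 := congrArg (fun t => t ≫ η 𝒜.F ▷ X ≫ (λ_ X).hom) h2
  simp only [Category.assoc, Linear.smul_comp] at h4
  rw [lact_apply]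
  simp only [comp_whiskerRight, Category.assoc, h4]
  rw [← comp_whiskerRight_assoc, Functor.Monoidal.ε_η]
  simp

/-- The mirror argument; on the left side the invariant pairings are those of V with `V.predual`. -/
lemma lact_lcoact (V : 𝒜.Mod) :
    ∑ i, S.lact V ((Module.finBasis k V.carrier).coord i) ≫
      S.lcoact V (Module.finBasis k V.carrier i) = 𝟙 _ := by
  let _ := mapPairing 𝒜.F V.predual V
  have h (i) : S.lact V ((Module.finBasis k V.carrier).coord i) ≫
      S.lcoact V (Module.finBasis k V.carrier i) =
      𝒜.F.obj V ◁ S.lcoact (V.predual ⊗ V) ((Module.finBasis k V.carrier).coord i ⊗ₜ[k]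
        Module.finBasis k V.carrier i) ≫
        𝒜.F.obj V ◁ (δ 𝒜.F V.predual V) ▷ X ≫ (α_ _ _ _).inv ≫ ((α_ _ _ _).inv ≫
          (μ 𝒜.F V V.predual ≫ 𝒜.F.map V.ev' ≫ η 𝒜.F) ▷ 𝒜.F.obj V ≫ (λ_ _).hom) ▷ X := by
    rw [S.lcoact_tensor]
    simp only [MonoidalCategory.whiskerLeft_comp, Category.assoc]
    rw [← MonoidalCategory.whiskerLeft_comp_assoc _ (μ 𝒜.F V.predual V ▷ X), ← comp_whiskerRight,
      Functor.Monoidal.μ_δ, lact_apply]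
    simp only [Category.assoc, MonoidalCategory.whiskerLeft_id, id_whiskerRight, Category.id_comp]
    rw [← leftUnitor_naturality, ← whisker_exchange_assoc]
    monoidal
  simp only [h, ← Preadditive.sum_comp, ← whiskerLeft_sum, ← map_sum]
  have h2 := S.lcoact_nat V.coev' (1 : k)
  have h3 : V.coev'.lin (1 : k) = ∑ i, (Module.finBasis k V.carrier).coord i ⊗ₜ[k]
      Module.finBasis k V.carrier i := by
    change (1 : k) • TensorProduct.comm k _ _ (canon V.carrier) = _
    rw [one_smul, canon, map_sum]
    rfl
  rw [h3, S.lcoact_unit] at h2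
  refine (congrArg (fun t => 𝒜.F.obj V ◁ t ≫ 𝒜.F.obj V ◁ (δ 𝒜.F V.predual V) ▷ X ≫
    (α_ _ _ _).inv ≫ ((α_ _ _ _).inv ≫ (μ 𝒜.F V V.predual ≫ 𝒜.F.map V.ev' ≫ η 𝒜.F) ▷
      𝒜.F.obj V ≫ (λ_ _).hom) ▷ X) h2.symm).trans ?_
  calc _ = 𝟙 _ ⊗≫ (𝒜.F.obj V ◁ η_ (𝒜.F.obj V.predual) (𝒜.F.obj V) ≫ (α_ _ _ _).inv ≫
        ε_ (𝒜.F.obj V.predual) (𝒜.F.obj V) ▷ 𝒜.F.obj V) ▷ X ⊗≫ 𝟙 _ := by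
        change _ = 𝟙 _ ⊗≫ (𝒜.F.obj V ◁ (ε 𝒜.F ≫ 𝒜.F.map V.coev' ≫ δ 𝒜.F V.predual V) ≫
          (α_ _ _ _).inv ≫ (μ 𝒜.F V V.predual ≫ 𝒜.F.map V.ev' ≫ η 𝒜.F) ▷ 𝒜.F.obj V) ▷ X ⊗≫ 𝟙 _
        monoidal
    _ = _ := by rw [ExactPairing.coevaluation_evaluation]; monoidal

lemma lcoact_ext {V : 𝒜.Mod} {Z : T} {g h : 𝒜.F.obj V ⊗ X ⟶ Z}
    (H : ∀ v, S.lcoact V v ≫ g = S.lcoact V v ≫ h) : g = h := by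
  rw [← Category.id_comp g, ← Category.id_comp h, ← S.lact_lcoact V]
  simp only [Preadditive.sum_comp, Category.assoc, H]

lemma lcoact_whiskerRight_ext {V : 𝒜.Mod} {Y Z : T} {g h : (𝒜.F.obj V ⊗ X) ⊗ Y ⟶ Z}
    (H : ∀ v, S.lcoact V v ▷ Y ≫ g = S.lcoact V v ▷ Y ≫ h) : g = h := by
  rw [← Category.id_comp g, ← Category.id_comp h, ← id_whiskerRight, ← S.lact_lcoact V]
  simp only [sum_whiskerRight, comp_whiskerRight, Preadditive.sum_comp, Category.assoc, H]

lemma lcoact_whiskerLeft_ext {V : 𝒜.Mod} {Y Z : T} {g h : Y ⊗ 𝒜.F.obj V ⊗ X ⟶ Z}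
    (H : ∀ v, Y ◁ S.lcoact V v ≫ g = Y ◁ S.lcoact V v ≫ h) : g = h := by
  rw [← Category.id_comp g, ← Category.id_comp h, ← MonoidalCategory.whiskerLeft_id,
    ← S.lact_lcoact V]
  simp only [whiskerLeft_sum, MonoidalCategory.whiskerLeft_comp, Preadditive.sum_comp,
    Category.assoc, H]

/-- The two actions. -/
noncomputable def toActStr : ActStr 𝒜 ℬ X where
  lact := S.lact
  ract := S.ract
  ract_nat := S.ract_nat
  ract_unit := S.ract_unit
  ract_tensor := S.ract_tensor
  lact_nat {V V'} g f := S.lcoact_ext fun v => by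
    rw [reassoc_of% (S.lcoact_nat g v), S.lcoact_lact, S.lcoact_lact]; rfl
  lact_unit := by
    have h := S.lcoact_lact (𝟙_ _) (1 : k) (LinearMap.id : k →ₗ[k] k)
    rw [S.lcoact_unit, Category.assoc, Iso.inv_comp_eq] at h
    refine h.trans ?_
    change (λ_ X).hom ≫ ((1 : k) • 𝟙 X) = _
    simp
  lact_tensor V V' f f' := by
    rw [← Iso.inv_comp_eq]
    refine S.lcoact_whiskerLeft_ext fun v' => S.lcoact_ext fun v => ?_
    have h := S.lcoact_lact (V ⊗ V') (v ⊗ₜ[k] v') (HopfRep.dtens f f')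
    rw [S.lcoact_tensor] at h
    simp only [Category.assoc] at h
    rw [h, ← MonoidalCategory.whiskerLeft_comp_assoc, S.lcoact_lact]
    simp only [MonoidalLinear.whiskerLeft_smul, MonoidalCategory.whiskerLeft_id, Linear.smul_comp,
      Linear.comp_smul, Category.id_comp, S.lcoact_lact, smul_smul]
    exact congrArg (· • 𝟙 X) (mul_comm _ _)
  lact_ract V W f g := by
    refine S.lcoact_whiskerRight_ext fun v => ?_
    rw [← reassoc_of% (S.ract_lcoact V W v g), S.lcoact_lact,
      ← comp_whiskerRight_assoc, S.lcoact_lact]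
    simp

/-- The module structure of which these are the left coaction and the right action. -/
noncomputable def toBimodStr : BimodStr 𝒜 ℬ X := S.toActStr.toBimodStr

lemma toBimodStr_lcoact : S.toBimodStr.lcoact = S.lcoact := by
  ext V v
  exact (S.toBimodStr.eq_lcoact fun f => S.lcoact_lact V v f).symm

end CoactAct

end completion

/-! ### Transposition of actions and coactions along a rigidity pair. -/

section mates

variable {T : Type v} [Category.{w} T] [MonoidalCategory T] {D X : T} [ExactPairing D X]

lemma dual_hom_ext {Z P : T} {l l' : Z ⟶ D ⊗ P}
    (H : X ◁ l ≫ (α_ _ _ _).inv ≫ ε_ D X ▷ P ≫ (λ_ P).hom =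
      X ◁ l' ≫ (α_ _ _ _).inv ≫ ε_ D X ▷ P ≫ (λ_ P).hom) : l = l' :=
  (tensorLeftHomEquiv Z D X P).symm.injective H

lemma dual_hom_ext' {Z : T} {l l' : Z ⟶ D} (H : X ◁ l ≫ ε_ D X = X ◁ l' ≫ ε_ D X) : l = l' := by
  rw [← cancel_mono (ρ_ D).inv]
  refine dual_hom_ext (X := X) ?_
  have h (t : Z ⟶ D) : X ◁ (t ≫ (ρ_ D).inv) ≫ (α_ _ _ _).inv ≫ ε_ D X ▷ 𝟙_ T ≫ (λ_ _).hom =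
      X ◁ t ≫ ε_ D X := by monoidal
  rw [h, h, H]

lemma hom_dual_ext {Z P : T} {h h' : Z ⟶ P ⊗ X}
    (H : h ▷ D ≫ (α_ _ _ _).hom ≫ P ◁ ε_ D X ≫ (ρ_ P).hom =
      h' ▷ D ≫ (α_ _ _ _).hom ≫ P ◁ ε_ D X ≫ (ρ_ P).hom) : h = h' :=
  (tensorRightHomEquiv Z D X P).symm.injective H

lemma hom_dual_ext' {Z : T} {h h' : Z ⟶ X} (H : h ▷ D ≫ ε_ D X = h' ▷ D ≫ ε_ D X) : h = h' := by
  rw [← cancel_mono (λ_ X).inv]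
  refine hom_dual_ext (D := D) ?_
  have h1 (t : Z ⟶ X) : (t ≫ (λ_ X).inv) ▷ D ≫ (α_ _ _ _).hom ≫ 𝟙_ T ◁ ε_ D X ≫ (ρ_ _).hom =
      t ▷ D ≫ ε_ D X := by monoidal
  rw [h1, h1, H]

variable (D X)

/-- The morphisms `h : X ⊗ Q ⟶ X` and `l : Q ⊗ D ⟶ D` are transposes of each other. -/
def IsMateL {Q : T} (h : X ⊗ Q ⟶ X) (l : Q ⊗ D ⟶ D) : Prop :=
  h ▷ D ≫ ε_ D X = (α_ _ _ _).hom ≫ X ◁ l ≫ ε_ D X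

/-- The morphisms `h : X ⟶ P ⊗ X` and `r : D ⟶ D ⊗ P` are transposes of each other. -/
def IsMateR {P : T} (h : X ⟶ P ⊗ X) (r : D ⟶ D ⊗ P) : Prop :=
  h ▷ D ≫ (α_ _ _ _).hom ≫ P ◁ ε_ D X ≫ (ρ_ P).hom =
    X ◁ r ≫ (α_ _ _ _).inv ≫ ε_ D X ▷ P ≫ (λ_ P).hom

variable {D X}

namespace IsMateL

variable {Q Q' : T} {h : X ⊗ Q ⟶ X} {l : Q ⊗ D ⟶ D} {h' : X ⊗ Q' ⟶ X} {l' : Q' ⊗ D ⟶ D}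

lemma right_unique {l₂ : Q ⊗ D ⟶ D} (H : IsMateL D X h l) (H' : IsMateL D X h l₂) : l = l₂ :=
  dual_hom_ext' (X := X) (by rw [← cancel_epi (α_ _ _ _).hom, ← H, ← H'])

lemma left_unique {h₂ : X ⊗ Q ⟶ X} (H : IsMateL D X h l) (H' : IsMateL D X h₂ l) : h = h₂ :=
  hom_dual_ext' (D := D) (H.trans H'.symm)

lemma nat (H : IsMateL D X h l) (q : Q' ⟶ Q) : IsMateL D X (X ◁ q ≫ h) (q ▷ D ≫ l) := by
  unfold IsMateL at *
  rw [comp_whiskerRight, Category.assoc, H]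
  simp

lemma unit : IsMateL D X (ρ_ X).hom (λ_ D).hom := by
  unfold IsMateL
  simp

lemma tensor (H : IsMateL D X h l) (H' : IsMateL D X h' l') :
    IsMateL D X ((α_ _ _ _).inv ≫ h ▷ Q' ≫ h') ((α_ _ _ _).hom ≫ Q ◁ l' ≫ l) := by
  unfold IsMateL at *
  simp only [comp_whiskerRight, MonoidalCategory.whiskerLeft_comp, Category.assoc, H']
  rw [associator_naturality_left_assoc, ← whisker_exchange_assoc, H]
  monoidal

end IsMateL

namespace IsMateR

variable {P P' : T} {h : X ⟶ P ⊗ X} {r : D ⟶ D ⊗ P} {h' : X ⟶ P' ⊗ X} {r' : D ⟶ D ⊗ P'}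

lemma right_unique {r₂ : D ⟶ D ⊗ P} (H : IsMateR D X h r) (H' : IsMateR D X h r₂) : r = r₂ :=
  dual_hom_ext (X := X) (H.symm.trans H')

lemma left_unique {h₂ : X ⟶ P ⊗ X} (H : IsMateR D X h r) (H' : IsMateR D X h₂ r) : h = h₂ :=
  hom_dual_ext (D := D) (H.trans H'.symm)

lemma nat (H : IsMateR D X h r) (p : P ⟶ P') : IsMateR D X (h ≫ p ▷ X) (r ≫ D ◁ p) := by
  unfold IsMateR at *
  have h1 : (h ≫ p ▷ X) ▷ D ≫ (α_ _ _ _).hom ≫ P' ◁ ε_ D X ≫ (ρ_ _).hom =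
    (h ▷ D ≫ (α_ _ _ _).hom ≫ P ◁ ε_ D X ≫ (ρ_ P).hom) ≫ p := by
      simp only [Category.assoc, ← rightUnitor_naturality, whisker_exchange_assoc]
      monoidal
  have h2 : X ◁ (r ≫ D ◁ p) ≫ (α_ _ _ _).inv ≫ ε_ D X ▷ P' ≫ (λ_ _).hom =
      (X ◁ r ≫ (α_ _ _ _).inv ≫ ε_ D X ▷ P ≫ (λ_ P).hom) ≫ p := by
    simp only [Category.assoc, ← leftUnitor_naturality, ← whisker_exchange_assoc]
    monoidal
  rw [h1, H, h2]

lemma unit : IsMateR D X (λ_ X).inv (ρ_ D).inv := by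
  unfold IsMateR
  monoidal

lemma tensor (H : IsMateR D X h r) (H' : IsMateR D X h' r') :
    IsMateR D X (h ≫ P ◁ h' ≫ (α_ _ _ _).inv) (r' ≫ r ▷ P' ≫ (α_ _ _ _).hom) := by
  unfold IsMateR at *
  calc _ = h ▷ D ⊗≫ P ◁ (h' ▷ D ≫ (α_ _ _ _).hom ≫ P' ◁ ε_ D X ≫ (ρ_ P').hom) ⊗≫ 𝟙 _ := by
        monoidal
    _ = 𝟙 _ ⊗≫ (h ▷ D ≫ (P ⊗ X) ◁ r') ⊗≫ (P ◁ ε_ D X) ▷ P' ⊗≫ 𝟙 _ := by rw [H']; monoidal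
    _ = 𝟙 _ ⊗≫ X ◁ r' ⊗≫ (h ▷ D ≫ (α_ _ _ _).hom ≫ P ◁ ε_ D X ≫ (ρ_ P).hom) ▷ P' ⊗≫ 𝟙 _ := by
        rw [← whisker_exchange]; monoidal
    _ = _ := by rw [H]; monoidal

end IsMateR

/-- Transposition reverses composition, so it interchanges the two sides of the commutation
relation; being injective in both directions, it gives an equivalence. -/
lemma mate_comm_iff {P Q : T} {h : X ⊗ Q ⟶ X} {l : Q ⊗ D ⟶ D} {c : X ⟶ P ⊗ X} {r : D ⟶ D ⊗ P}
    (H : IsMateL D X h l) (H' : IsMateR D X c r) :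
    h ≫ c = c ▷ Q ≫ (α_ _ _ _).hom ≫ P ◁ h ↔ l ≫ r = Q ◁ r ≫ (α_ _ _ _).inv ≫ l ▷ P := by
  unfold IsMateL at H
  unfold IsMateR at H'
  have h1 : (h ≫ c) ▷ D ≫ (α_ _ _ _).hom ≫ P ◁ ε_ D X ≫ (ρ_ P).hom =
      (α_ _ _ _).hom ≫ X ◁ (Q ◁ r ≫ (α_ _ _ _).inv ≫ l ▷ P) ≫ (α_ _ _ _).inv ≫
        ε_ D X ▷ P ≫ (λ_ P).hom := by
    calc _ = h ▷ D ≫ (c ▷ D ≫ (α_ _ _ _).hom ≫ P ◁ ε_ D X ≫ (ρ_ P).hom) := by simp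
      _ = 𝟙 _ ⊗≫ (X ⊗ Q) ◁ r ⊗≫ (h ▷ D ≫ ε_ D X) ▷ P ⊗≫ 𝟙 _ := by
        rw [H', ← whisker_exchange_assoc]; monoidal
      _ = _ := by rw [H]; monoidal
  have h2 : (c ▷ Q ≫ (α_ _ _ _).hom ≫ P ◁ h) ▷ D ≫ (α_ _ _ _).hom ≫ P ◁ ε_ D X ≫ (ρ_ P).hom =
      (α_ _ _ _).hom ≫ X ◁ (l ≫ r) ≫ (α_ _ _ _).inv ≫ ε_ D X ▷ P ≫ (λ_ P).hom := by
    calc _ = 𝟙 _ ⊗≫ c ▷ Q ▷ D ⊗≫ P ◁ (h ▷ D ≫ ε_ D X) ⊗≫ 𝟙 _ := by monoidal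
      _ = 𝟙 _ ⊗≫ (c ▷ (Q ⊗ D) ≫ (P ⊗ X) ◁ l) ⊗≫ P ◁ ε_ D X ⊗≫ 𝟙 _ := by rw [H]; monoidal
      _ = 𝟙 _ ⊗≫ X ◁ l ≫ (c ▷ D ≫ (α_ _ _ _).hom ≫ P ◁ ε_ D X ≫ (ρ_ P).hom) := by
        rw [← whisker_exchange]; monoidal
      _ = _ := by rw [H']; monoidal
  constructor
  · intro e
    refine dual_hom_ext (X := X) ?_
    rw [← cancel_epi (α_ _ _ _).hom, ← h2, ← h1, e]
  · intro e
    refine hom_dual_ext (D := D) ?_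
    rw [h1, h2, e]

section linear

variable {k : Type u} [Field k] [Preadditive T] [Linear k T] [MonoidalPreadditive T]
  [MonoidalLinear k T] (D X)

/-- The transpose of `h : X ⊗ Q ⟶ X`. -/
noncomputable def mateL (Q : T) : (X ⊗ Q ⟶ X) →ₗ[k] (Q ⊗ D ⟶ D) where
  toFun h := tensorLeftHomEquiv (Q ⊗ D) D X (𝟙_ T) ((α_ _ _ _).inv ≫ h ▷ D ≫ ε_ D X) ≫ (ρ_ D).hom
  map_add' f g := by simp [tensorLeftHomEquiv]
  map_smul' c f := by simp [tensorLeftHomEquiv]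

lemma isMateL_mateL {Q : T} (h : X ⊗ Q ⟶ X) : IsMateL D X h (mateL (k := k) D X Q h) := by
  unfold IsMateL
  have h1 := (tensorLeftHomEquiv (Q ⊗ D) D X (𝟙_ T)).symm_apply_apply
    ((α_ _ _ _).inv ≫ h ▷ D ≫ ε_ D X)
  rw [← Iso.inv_comp_eq, ← h1]
  change X ◁ (_ : Q ⊗ D ⟶ D ⊗ 𝟙_ T) ≫ (α_ _ _ _).inv ≫ ε_ D X ▷ 𝟙_ T ≫ (λ_ _).hom =
    X ◁ (_ ≫ _) ≫ _
  monoidal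

/-- The inverse transpose of `l : Q ⊗ D ⟶ D`. -/
noncomputable def comateL (Q : T) : (Q ⊗ D ⟶ D) →ₗ[k] (X ⊗ Q ⟶ X) where
  toFun l := tensorRightHomEquiv (X ⊗ Q) D X (𝟙_ T) ((α_ _ _ _).hom ≫ X ◁ l ≫ ε_ D X) ≫ (λ_ X).hom
  map_add' f g := by simp [tensorRightHomEquiv]
  map_smul' c f := by simp [tensorRightHomEquiv]

lemma isMateL_comateL {Q : T} (l : Q ⊗ D ⟶ D) : IsMateL D X (comateL (k := k) D X Q l) l := by
  unfold IsMateL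
  have h1 := (tensorRightHomEquiv (X ⊗ Q) D X (𝟙_ T)).symm_apply_apply
    ((α_ _ _ _).hom ≫ X ◁ l ≫ ε_ D X)
  rw [← h1]
  change (_ ≫ _) ▷ D ≫ _ =
    (_ : X ⊗ Q ⟶ 𝟙_ T ⊗ X) ▷ D ≫ (α_ _ _ _).hom ≫ 𝟙_ T ◁ ε_ D X ≫ (ρ_ _).hom
  monoidal

/-- The transpose of `h : X ⟶ P ⊗ X`. -/
noncomputable def mateR (P : T) : (X ⟶ P ⊗ X) →ₗ[k] (D ⟶ D ⊗ P) where
  toFun h := tensorLeftHomEquiv D D X P (h ▷ D ≫ (α_ _ _ _).hom ≫ P ◁ ε_ D X ≫ (ρ_ P).hom)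
  map_add' f g := by simp [tensorLeftHomEquiv]
  map_smul' c f := by simp [tensorLeftHomEquiv]

lemma isMateR_mateR {P : T} (h : X ⟶ P ⊗ X) : IsMateR D X h (mateR (k := k) D X P h) :=
  ((tensorLeftHomEquiv D D X P).symm_apply_apply _).symm

/-- The inverse transpose of `r : D ⟶ D ⊗ P`. -/
noncomputable def comateR (P : T) : (D ⟶ D ⊗ P) →ₗ[k] (X ⟶ P ⊗ X) where
  toFun r := tensorRightHomEquiv X D X P (X ◁ r ≫ (α_ _ _ _).inv ≫ ε_ D X ▷ P ≫ (λ_ P).hom)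
  map_add' f g := by simp [tensorRightHomEquiv]
  map_smul' c f := by simp [tensorRightHomEquiv]

lemma isMateR_comateR {P : T} (r : D ⟶ D ⊗ P) : IsMateR D X (comateR (k := k) D X P r) r :=
  (tensorRightHomEquiv X D X P).symm_apply_apply _

end linear

end mates

/-! ### The module structure of the dual object. -/

section dualStructure

open HopfRep

variable {k : Type u} [Field k] {T : Type v} [Category.{w} T] [Preadditive T]
  [Linear k T] [MonoidalCategory T] [MonoidalPreadditive T] [MonoidalLinear k T]
  {𝒜 ℬ : Realization k T} {D X : T} [ExactPairing D X]

namespace BimodStr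

/-- The module structures of `X` and of its dual `D` are transposes of each other. -/
structure IsTranspose (S : BimodStr 𝒜 ℬ X) (S' : BimodStr ℬ 𝒜 D) : Prop where
  left (W : ℬ.Mod) (g : Module.Dual k W.carrier) : IsMateL D X (S.ract W g) (S'.lact W g)
  right (V : 𝒜.Mod) (v : V.carrier) : IsMateR D X (S.lcoact V v) (S'.rcoact V v)

/-- The transposed action and coaction on the dual. -/
noncomputable def dualActCoact (S : BimodStr 𝒜 ℬ X) : ActCoact ℬ 𝒜 D where
  lact W := mateL D X _ ∘ₗ S.ract W
  rcoact V := mateR D X _ ∘ₗ S.lcoact V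
  lact_nat {W W'} g f := (((isMateL_mateL (k := k) D X (S.ract W' f)).nat (ℬ.F.map g)).right_unique
    (by rw [S.ract_nat]; exact isMateL_mateL (k := k) D X _) :)
  rcoact_nat {V V'} g v := (((isMateR_mateR (k := k) D X (S.lcoact V v)).nat
    (𝒜.F.map g)).right_unique (by rw [S.lcoact_nat]; exact isMateR_mateR (k := k) D X _) :)
  lact_unit := ((isMateL_mateL (k := k) D X (S.ract (𝟙_ _) (LinearMap.id : k →ₗ[k] k))).nat
    (ε ℬ.F)).right_unique (by rw [S.ract_unit]; exact IsMateL.unit)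
  rcoact_unit := (isMateR_mateR (k := k) D X _).right_unique
    (by rw [S.lcoact_unit]; exact IsMateR.unit.nat (ε 𝒜.F))
  lact_tensor W W' g g' := ((isMateL_mateL (k := k) D X
    (S.ract (W ⊗ W') (dtens g g'))).nat (μ ℬ.F W W')).right_unique
    (by
      rw [S.ract_tensor]
      exact (isMateL_mateL (k := k) D X (S.ract W g)).tensor
        (isMateL_mateL (k := k) D X (S.ract W' g')))
  rcoact_tensor V V' v v' := (isMateR_mateR (k := k) D X _).right_unique
    (by
      have h := ((isMateR_mateR (k := k) D X (S.lcoact V v)).tensor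
        (isMateR_mateR (k := k) D X (S.lcoact V' v'))).nat (μ 𝒜.F V V')
      rw [S.lcoact_tensor]
      simpa only [Category.assoc, LinearMap.comp_apply] using h)
  lact_rcoact W V g v := (mate_comm_iff (isMateL_mateL (k := k) D X (S.ract W g))
    (isMateR_mateR (k := k) D X (S.lcoact V v))).1 (S.ract_lcoact V W v g)

/-- The inverse transposes of a module structure on the dual. -/
noncomputable def predualCoactAct (S' : BimodStr ℬ 𝒜 D) : CoactAct 𝒜 ℬ X where
  ract W := comateL D X _ ∘ₗ S'.lact W
  lcoact V := comateR D X _ ∘ₗ S'.rcoact V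
  ract_nat {W W'} g f := (((isMateL_comateL (k := k) D X (S'.lact W' f)).nat
    (ℬ.F.map g)).left_unique (by rw [S'.lact_nat]; exact isMateL_comateL (k := k) D X _) :)
  lcoact_nat {V V'} g v := (((isMateR_comateR (k := k) D X (S'.rcoact V v)).nat
    (𝒜.F.map g)).left_unique (by rw [S'.rcoact_nat]; exact isMateR_comateR (k := k) D X _) :)
  ract_unit := ((isMateL_comateL (k := k) D X (S'.lact (𝟙_ _) (LinearMap.id : k →ₗ[k] k))).nat
    (ε ℬ.F)).left_unique (by rw [S'.lact_unit]; exact IsMateL.unit)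
  lcoact_unit := (isMateR_comateR (k := k) D X _).left_unique
    (by rw [S'.rcoact_unit]; exact IsMateR.unit.nat (ε 𝒜.F))
  ract_tensor W W' g g' := ((isMateL_comateL (k := k) D X
    (S'.lact (W ⊗ W') (dtens g g'))).nat (μ ℬ.F W W')).left_unique
    (by
      rw [S'.lact_tensor]
      exact (isMateL_comateL (k := k) D X (S'.lact W g)).tensor
        (isMateL_comateL (k := k) D X (S'.lact W' g')))
  lcoact_tensor V V' v v' := (isMateR_comateR (k := k) D X _).left_unique
    (by
      have h := ((isMateR_comateR (k := k) D X (S'.rcoact V v)).tensor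
        (isMateR_comateR (k := k) D X (S'.rcoact V' v'))).nat (μ 𝒜.F V V')
      rw [S'.rcoact_tensor]
      simpa only [Category.assoc, LinearMap.comp_apply] using h)
  ract_lcoact V W v g := (mate_comm_iff (isMateL_comateL (k := k) D X (S'.lact W g))
    (isMateR_comateR (k := k) D X (S'.rcoact V v))).2 (S'.lact_rcoact W V g v)

/-- Transposing the right action and the left coaction of X needs only the rigidity pair of X. The
result is a left action and a right coaction on D, completed to a module structure by inverting the
coaction. -/
lemma exists_isTranspose (S : BimodStr 𝒜 ℬ X) (D : T) [ExactPairing D X] :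
    ∃ S' : BimodStr ℬ 𝒜 D, S.IsTranspose S' :=
  ⟨S.dualActCoact.toBimodStr, fun W g => isMateL_mateL (k := k) D X (S.ract W g), fun V v => by
    rw [ActCoact.toBimodStr_rcoact]
    exact isMateR_mateR (k := k) D X (S.lcoact V v)⟩

/-- The reverse construction, which supplies the adjoint on the other side. -/
lemma exists_isTranspose' (S' : BimodStr ℬ 𝒜 D) (X : T) [ExactPairing D X] :
    ∃ S : BimodStr 𝒜 ℬ X, S.IsTranspose S' :=
  ⟨S'.predualCoactAct.toBimodStr, fun W g => isMateL_comateL (k := k) D X (S'.lact W g),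
    fun V v => by
    rw [CoactAct.toBimodStr_lcoact]
    exact isMateR_comateR (k := k) D X (S'.rcoact V v)⟩

end BimodStr

namespace HopfBimod

/-- The transpose in the statement is written with the coaction for W* and the pairing of G(W*) with
G(W); by `ract_eq` these compose to the right action. -/
lemma isMateL_transposeLeft (X : HopfBimod 𝒜 ℬ) (D : T) [ExactPairing D X.obj] (W : ℬ.Mod)
    (g : Module.Dual k W.carrier) :
    IsMateL D X.obj (X.str.ract W g) (transposeLeft X D W g) := by
  have h := isMateL_mateL (k := k) D X.obj (X.str.ract W g)
  convert h using 1
  rw [BimodStr.ract_eq]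
  simp only [mateL, transposeLeft, LinearMap.coe_mk, AddHom.coe_mk, tensorLeftHomEquiv,
    Equiv.coe_fn_mk]
  monoidal

/-- Contracting the transposed coaction for V* with V gives the transposed trivialization; `ract_eq`
identifies the left side with the right action of the dual. -/
lemma isMateR_coact (X : HopfBimod 𝒜 ℬ) (D : T) [ExactPairing D X.obj] (V : 𝒜.Mod)
    (f : Module.Dual k V.carrier) (r : D ⟶ D ⊗ 𝒜.F.obj V.dual)
    (h : IsMateR D X.obj (X.str.lcoact V.dual f) r) :
    r ▷ 𝒜.F.obj V ≫ (α_ _ _ _).hom ≫ D ◁ 𝒜.pairing V ≫ (ρ_ D).hom =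
      transposeRight X D V f := by
  have h' := isMateR_mateR (k := k) D X.obj (X.str.lcoact V.dual f)
  rw [h.right_unique h']
  simp only [mateR, transposeRight, LinearMap.coe_mk, AddHom.coe_mk, tensorLeftHomEquiv,
    Equiv.coe_fn_mk]
  monoidal

lemma isDualStr_of_isTranspose (X : HopfBimod 𝒜 ℬ) (D : T) [ExactPairing D X.obj]
    (S : BimodStr ℬ 𝒜 D) (h : X.str.IsTranspose S) : IsDualStr X D S where
  lact_eq W g := (h.left W g).right_unique (isMateL_transposeLeft X D W g)
  ract_eq V f := by rw [S.ract_eq]; exact isMateR_coact X D V f _ (h.right V.dual f)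

end HopfBimod

end dualStructure

/-! ### Transposition expressed by the coevaluation. -/

section mateUnits

variable {T : Type v} [Category.{w} T] [MonoidalCategory T] {D X : T} [ExactPairing D X]

/-- By the snake identity both sides transpose to h itself. -/
lemma IsMateL.unit_eq {Q : T} {h : X ⊗ Q ⟶ X} {l : Q ⊗ D ⟶ D} (H : IsMateL D X h l) :
    η_ D X ▷ Q ≫ (α_ _ _ _).hom ≫ D ◁ h =
      (λ_ Q).hom ≫ (ρ_ Q).inv ≫ Q ◁ η_ D X ≫ (α_ _ _ _).inv ≫ l ▷ X := by
  refine dual_hom_ext (X := X) ?_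
  unfold IsMateL at H
  have h1 : X ◁ (η_ D X ▷ Q ≫ (α_ _ _ _).hom ≫ D ◁ h) ≫ (α_ _ _ _).inv ≫ ε_ D X ▷ X ≫
      (λ_ X).hom = X ◁ (λ_ Q).hom ≫ h := by
    calc _ = 𝟙 _ ⊗≫ (X ◁ η_ D X) ▷ Q ⊗≫ ((X ⊗ D) ◁ h ≫ ε_ D X ▷ X) ⊗≫ 𝟙 _ := by monoidal
      _ = 𝟙 _ ⊗≫ (X ◁ η_ D X ≫ (α_ _ _ _).inv ≫ ε_ D X ▷ X) ▷ Q ⊗≫ h := by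
        rw [whisker_exchange]; monoidal
      _ = _ := by rw [ExactPairing.coevaluation_evaluation]; monoidal
  have h2 : X ◁ ((λ_ Q).hom ≫ (ρ_ Q).inv ≫ Q ◁ η_ D X ≫ (α_ _ _ _).inv ≫ l ▷ X) ≫
      (α_ _ _ _).inv ≫ ε_ D X ▷ X ≫ (λ_ X).hom = X ◁ (λ_ Q).hom ≫ h := by
    calc _ = 𝟙 _ ⊗≫ (X ⊗ Q) ◁ η_ D X ⊗≫ ((α_ _ _ _).hom ≫ X ◁ l ≫ ε_ D X) ▷ X ⊗≫ 𝟙 _ := by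
          monoidal
      _ = 𝟙 _ ⊗≫ ((X ⊗ Q) ◁ η_ D X ≫ h ▷ (D ⊗ X)) ⊗≫ ε_ D X ▷ X ⊗≫ 𝟙 _ := by
        rw [← H]; monoidal
      _ = 𝟙 _ ⊗≫ h ⊗≫ (X ◁ η_ D X ≫ (α_ _ _ _).inv ≫ ε_ D X ▷ X) ⊗≫ 𝟙 _ := by
        rw [whisker_exchange]; monoidal
      _ = _ := by rw [ExactPairing.coevaluation_evaluation]; monoidal
  rw [h1, h2]

lemma IsMateR.unit_eq {P : T} {h : X ⟶ P ⊗ X} {r : D ⟶ D ⊗ P} (H : IsMateR D X h r) :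
    η_ D X ≫ r ▷ X ≫ (α_ _ _ _).hom = η_ D X ≫ D ◁ h := by
  refine dual_hom_ext (X := X) ?_
  unfold IsMateR at H
  have h1 : X ◁ (η_ D X ≫ r ▷ X ≫ (α_ _ _ _).hom) ≫ (α_ _ _ _).inv ≫ ε_ D X ▷ (P ⊗ X) ≫
      (λ_ _).hom = (ρ_ X).hom ≫ h := by
    calc _ = X ◁ η_ D X ⊗≫ (X ◁ r ≫ (α_ _ _ _).inv ≫ ε_ D X ▷ P ≫ (λ_ P).hom) ▷ X := by monoidal
      _ = 𝟙 _ ⊗≫ (X ◁ η_ D X ≫ h ▷ (D ⊗ X)) ⊗≫ P ◁ ε_ D X ▷ X ⊗≫ 𝟙 _ := by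
        rw [← H]; monoidal
      _ = 𝟙 _ ⊗≫ h ⊗≫ P ◁ (X ◁ η_ D X ≫ (α_ _ _ _).inv ≫ ε_ D X ▷ X) ⊗≫ 𝟙 _ := by
        rw [whisker_exchange]; monoidal
      _ = _ := by rw [ExactPairing.coevaluation_evaluation]; monoidal
  have h2 : X ◁ (η_ D X ≫ D ◁ h) ≫ (α_ _ _ _).inv ≫ ε_ D X ▷ (P ⊗ X) ≫ (λ_ _).hom =
      (ρ_ X).hom ≫ h := by
    calc _ = X ◁ η_ D X ⊗≫ ((X ⊗ D) ◁ h ≫ ε_ D X ▷ (P ⊗ X)) ⊗≫ 𝟙 _ := by monoidal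
      _ = (X ◁ η_ D X ≫ (α_ _ _ _).inv ≫ ε_ D X ▷ X) ⊗≫ h := by
        rw [whisker_exchange]; monoidal
      _ = _ := by rw [ExactPairing.coevaluation_evaluation]; monoidal
  rw [h1, h2]

end mateUnits

/-! ### Multiplication of an integral by matrix coefficients. -/

section integrals

open HopfRep

variable {k : Type u} [Field k] {A : Type u} [Ring A] [HopfAlgebra k A] [Module.Finite k A]
  {x : Module.Dual k A}

/-- The left side is the product in A* of x and the matrix coefficient φ(a) = f(av), namely
x(a₁)φ(a₂) = φ(x(a₁)a₂); for an integral it is φ(1)x(a). -/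
lemma HopfRep.mc_dtens_evOne_left (hx : ∀ a, leftHit x a = x a • (1 : A)) (V : HopfRep k A)
    (f : Module.Dual k V.carrier) (v : V.carrier) :
    (mc (V := coreg k A ⊗ V) (dtens (evOne k A) f)).lin (x ⊗ₜ[k] v) = f v • x := by
  ext a
  let p := Coalgebra.Repr.arbitrary k a
  have h := congrArg (fun b => f (V.ρ b v)) ((leftHit_repr (k := k) x p).symm.trans (hx a))
  simp only [map_sum, map_smul, LinearMap.sum_apply, LinearMap.smul_apply, map_one,
    Module.End.one_apply, smul_eq_mul] at h
  change dtens (evOne k A) f (tensorAct (coregAct k A) V.ρ a (x ⊗ₜ[k] v)) = f v * x a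
  rw [tensorAct_repr _ _ p, LinearMap.sum_apply, map_sum, mul_comm, ← h]
  refine Finset.sum_congr rfl fun i _ => ?_
  change x (1 * p.left i) * _ = _
  rw [one_mul]

lemma HopfRep.mc_dtens_evOne_right (hx : ∀ a, rightHit x a = x a • (1 : A)) (V : HopfRep k A)
    (f : Module.Dual k V.carrier) (v : V.carrier) :
    (mc (V := V ⊗ coreg k A) (dtens f (evOne k A))).lin (v ⊗ₜ[k] x) = f v • x := by
  ext a
  let p := Coalgebra.Repr.arbitrary k a
  have h := congrArg (fun b => f (V.ρ b v)) ((rightHit_repr (k := k) x p).symm.trans (hx a))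
  simp only [map_sum, map_smul, LinearMap.sum_apply, LinearMap.smul_apply, map_one,
    Module.End.one_apply, smul_eq_mul] at h
  change dtens f (evOne k A) (tensorAct V.ρ (coregAct k A) a (v ⊗ₜ[k] x)) = f v * x a
  rw [tensorAct_repr _ _ p, LinearMap.sum_apply, map_sum, mul_comm, ← h]
  refine Finset.sum_congr rfl fun i _ => ?_
  change _ * x (1 * p.right i) = _
  rw [one_mul, mul_comm]

end integrals

/-! ### The endomorphism e_B as coaction followed by action. -/

section balance

open HopfRep

variable {k : Type u} [Field k] {T : Type v} [Category.{w} T] [Preadditive T]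
  [Linear k T] [MonoidalCategory T] [MonoidalPreadditive T] [MonoidalLinear k T]
  {𝒜 ℬ 𝒞 : Realization k T}

namespace BimodStr

/-- The coaction is determined by the action, so it agrees with the formula through the copairing,
which is the form that occurs in `balancer`. -/
lemma toActStr_rcoact {X : T} (S : BimodStr 𝒜 ℬ X) (W : ℬ.Mod) (w : W.carrier) :
    S.toActStr.toBimodStr.rcoact W w = S.rcoact W w :=
  S.eq_rcoact fun f => S.toActStr.toBimodStr.rcoact_ract W w f

end BimodStr

namespace HopfBimod

section

variable (X : HopfBimod 𝒜 ℬ) (Y : HopfBimod ℬ 𝒞)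

/-- The endomorphism of `X ⊗ Y` given by the coaction on `X` for the functional `c` and the action
on `Y`. -/
noncomputable def balance (c : Module.Dual k ℬ.A) : X.obj ⊗ Y.obj ⟶ X.obj ⊗ Y.obj :=
  X.str.rcoact (coreg k ℬ.A) c ▷ Y.obj ≫ (α_ _ _ _).hom ≫
    X.obj ◁ Y.str.lact (coreg k ℬ.A) (evOne k ℬ.A)

lemma balance_smul (a : k) (c : Module.Dual k ℬ.A) :
    balance X Y (a • c) = a • balance X Y c := by
  have h := (X.str.rcoact (coreg k ℬ.A)).map_smul a c
  simp only [balance]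
  rw [h]
  simp

lemma balance_sum {ι : Type*} (s : Finset ι) (c : ι → Module.Dual k ℬ.A) :
    balance X Y (∑ i ∈ s, c i) = ∑ i ∈ s, balance X Y (c i) := by
  have h := map_sum (X.str.rcoact (coreg k ℬ.A)) c s
  simp only [balance]
  rw [h]
  simp only [sum_whiskerRight, Preadditive.sum_comp]

/-- Naturality along the matrix coefficient morphism of f reduces every module W to the coregular
one. -/
lemma rcoact_lact (W : ℬ.Mod) (w : W.carrier) (f : Module.Dual k W.carrier) :
    X.str.rcoact W w ▷ Y.obj ≫ (α_ _ _ _).hom ≫ X.obj ◁ Y.str.lact W f =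
      balance X Y ((mc f).lin w) := by
  have h := Y.str.lact_nat (mc f) (evOne k ℬ.A)
  rw [evOne_mc] at h
  rw [balance, ← X.str.rcoact_nat (mc f) w, ← h]
  simp

/-- The sum over a basis of W yields the character of W, and the weights dim(W) assemble the
characters into the regular one. -/
lemma balancer_eq [IsAlgClosed k] [CharZero k] (hA : Regular k ℬ.A) (I : IrrSystem k ℬ.A) :
    balancer I X Y = (Module.finrank k ℬ.A : k)⁻¹ • balance X Y (regularTrace k ℬ.A) := by
  rw [I.regularTrace_eq hA, balance_sum, balancer]
  congr 1
  refine Finset.sum_congr rfl fun j _ => ?_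
  rw [balance_smul, balance_sum]
  congr 1
  refine Finset.sum_congr rfl fun i _ => ?_
  rw [← rcoact_lact, ← X.str.toActStr_rcoact]
  change _ = ((ρ_ X.obj).inv ≫ X.obj ◁ ℬ.copairing (I.mod j) ≫ (α_ _ _ _).inv ≫
    X.str.ract (I.mod j).predual (Module.Dual.eval k _ _) ▷ ℬ.F.obj (I.mod j)) ▷ Y.obj ≫ _
  rw [MonoidalCategory.tensorHom_def]
  monoidal

/-- A morphism that is balanced absorbs the endomorphisms `balance`. -/
lemma balance_comp (c : Module.Dual k ℬ.A) {Z : T} (h : X.obj ⊗ Y.obj ⟶ Z)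
    (w : ∀ (W : ℬ.Mod) (f : Module.Dual k W.carrier), X.str.ract W f ▷ Y.obj ≫ h =
      (α_ _ _ _).hom ≫ X.obj ◁ Y.str.lact W f ≫ h) :
    balance X Y c ≫ h = c 1 • h := by
  have h1 := X.str.rcoact_ract (coreg k ℬ.A) c (evOne k ℬ.A)
  rw [balance, Category.assoc, Category.assoc, ← w, ← comp_whiskerRight_assoc, h1,
    MonoidalLinear.smul_whiskerRight, id_whiskerRight, Linear.smul_comp, Category.id_comp]
  rfl

/-- After the coaction at w the left side is f(w) times `balance X Y x`, and the right side is
`balance` at the product of x with the matrix coefficient of (f, w). These agree because x is an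
integral. -/
lemma balance_balanced {x : Module.Dual k ℬ.A} (hx : ∀ a, leftHit x a = x a • (1 : ℬ.A))
    (W : ℬ.Mod) (f : Module.Dual k W.carrier) :
    X.str.ract W f ▷ Y.obj ≫ balance X Y x =
      (α_ _ _ _).hom ≫ X.obj ◁ Y.str.lact W f ≫ balance X Y x := by
  refine X.str.rcoact_whiskerRight_ext fun w => ?_
  rw [← comp_whiskerRight_assoc, X.str.rcoact_ract]
  have h1 := rcoact_lact X Y (coreg k ℬ.A ⊗ W) (x ⊗ₜ[k] w) (dtens (evOne k ℬ.A) f)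
  rw [mc_dtens_evOne_left hx, balance_smul, X.str.rcoact_tensor] at h1
  have h2 := Y.str.lact_tensor (coreg k ℬ.A) W (evOne k ℬ.A) f
  rw [MonoidalLinear.smul_whiskerRight, id_whiskerRight, Linear.smul_comp, Category.id_comp, ← h1]
  calc _ = 𝟙 _ ⊗≫ X.str.rcoact W w ▷ Y.obj ⊗≫ X.str.rcoact (coreg k ℬ.A) x ▷ ℬ.F.obj W ▷ Y.obj ⊗≫
        X.obj ◁ (μ ℬ.F (coreg k ℬ.A) W ▷ Y.obj ≫
          Y.str.lact (coreg k ℬ.A ⊗ W) (dtens (evOne k ℬ.A) f)) := by monoidal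
    _ = 𝟙 _ ⊗≫ X.str.rcoact W w ▷ Y.obj ⊗≫ (X.str.rcoact (coreg k ℬ.A) x ▷ (ℬ.F.obj W ⊗ Y.obj) ≫
        (X.obj ⊗ ℬ.F.obj (coreg k ℬ.A)) ◁ Y.str.lact W f) ⊗≫
          X.obj ◁ Y.str.lact (coreg k ℬ.A) (evOne k ℬ.A) := by
        rw [h2]; monoidal
    _ = _ := by rw [← whisker_exchange, balance]; monoidal

lemma balance_lact (c : Module.Dual k ℬ.A) (V : 𝒜.Mod) (f : Module.Dual k V.carrier) :
    X.str.lact V f ▷ Y.obj ≫ balance X Y c =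
      (α_ _ _ _).hom ≫ 𝒜.F.obj V ◁ balance X Y c ≫ (α_ _ _ _).inv ≫ X.str.lact V f ▷ Y.obj := by
  rw [balance, ← comp_whiskerRight_assoc, X.str.lact_rcoact]
  calc _ = 𝟙 _ ⊗≫ 𝒜.F.obj V ◁ X.str.rcoact (coreg k ℬ.A) c ▷ Y.obj ⊗≫
        (X.str.lact V f ▷ (ℬ.F.obj (coreg k ℬ.A) ⊗ Y.obj) ≫
          X.obj ◁ Y.str.lact (coreg k ℬ.A) (evOne k ℬ.A)) := by monoidal
    _ = _ := by rw [← whisker_exchange]; monoidal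

end

end HopfBimod

end balance

/-! ### Linearity of ε and δ and their snake relations before passing to quotients. -/

section rigidityPair

open HopfRep

variable {k : Type u} [Field k] {T : Type v} [Category.{w} T] [Preadditive T]
  [Linear k T] [MonoidalCategory T] [MonoidalPreadditive T] [MonoidalLinear k T]
  {𝒜 ℬ 𝒞 : Realization k T}

namespace HopfBimod

section counit

variable (X : HopfBimod 𝒜 ℬ) (D : T) [ExactPairing D X.obj]

/-- The morphism `X ⊗ X* → 𝔄` given by the coaction on `X` for the functional `c`. -/
noncomputable def counitOf (c : Module.Dual k 𝒜.A) :
    X.obj ⊗ D ⟶ 𝒜.F.obj (coreg k 𝒜.A) :=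
  X.str.lcoact (coreg k 𝒜.A) c ▷ D ≫ (α_ _ _ _).hom ≫ _ ◁ ε_ D X.obj ≫ (ρ_ _).hom

lemma counitOf_smul (a : k) (c : Module.Dual k 𝒜.A) :
    counitOf X D (a • c) = a • counitOf X D c := by
  have h := (X.str.lcoact (coreg k 𝒜.A)).map_smul a c
  simp only [counitOf]
  rw [h]
  simp

lemma counitOf_sum {ι : Type*} (s : Finset ι) (c : ι → Module.Dual k 𝒜.A) :
    counitOf X D (∑ i ∈ s, c i) = ∑ i ∈ s, counitOf X D (c i) := by
  have h := map_sum (X.str.lcoact (coreg k 𝒜.A)) c s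
  simp only [counitOf]
  rw [h]
  simp only [sum_whiskerRight, Preadditive.sum_comp]

lemma lcoact_counit (V : 𝒜.Mod) (v : V.carrier) (p : V ⟶ coreg k 𝒜.A) :
    X.str.lcoact V v ▷ D ≫ (α_ _ _ _).hom ≫ 𝒜.F.obj V ◁ ε_ D X.obj ≫ (ρ_ _).hom ≫ 𝒜.F.map p =
      counitOf X D (p.lin v) := by
  rw [counitOf, ← X.str.lcoact_nat p v, ← rightUnitor_naturality, whisker_exchange_assoc]
  monoidal

/-- As for `balancer_eq`: the weighted sum of characters is the regular character. -/
lemma rigidityCounit_eq [IsAlgClosed k] [CharZero k] (hA : Regular k 𝒜.A) (I : IrrSystem k 𝒜.A) :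
    rigidityCounit X D I = counitOf X D (regularTrace k 𝒜.A) := by
  rw [I.regularTrace_eq hA, counitOf_sum, rigidityCounit]
  refine Finset.sum_congr rfl fun j _ => ?_
  rw [counitOf_smul, counitOf_sum]
  congr 1
  refine Finset.sum_congr rfl fun i _ => ?_
  exact lcoact_counit X D _ _ _

end counit

section pair

variable {X : HopfBimod 𝒜 ℬ} {D : HopfBimod ℬ 𝒜} [ExactPairing D.obj X.obj]
  {x c : Module.Dual k 𝒜.A}

lemma counitOf_eq (hD : X.str.IsTranspose D.str) (c : Module.Dual k 𝒜.A) : counitOf X D.obj c =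
    X.obj ◁ D.str.rcoact (coreg k 𝒜.A) c ≫ (α_ _ _ _).inv ≫ ε_ D.obj X.obj ▷ _ ≫ (λ_ _).hom :=
  hD.right (coreg k 𝒜.A) c

/-- The B-action commutes with the A-coaction and passes through ε_X to its transpose; any c will
do. -/
lemma counitOf_balanced (hD : X.str.IsTranspose D.str) (W : ℬ.Mod) (g : Module.Dual k W.carrier) :
    X.str.ract W g ▷ D.obj ≫ counitOf X D.obj c =
      (α_ _ _ _).hom ≫ X.obj ◁ D.str.lact W g ≫ counitOf X D.obj c := by
  have h := hD.left W g
  unfold IsMateL at h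
  rw [counitOf, ← comp_whiskerRight_assoc, X.str.ract_lcoact]
  calc _ = 𝟙 _ ⊗≫ X.str.lcoact (coreg k 𝒜.A) c ▷ ℬ.F.obj W ▷ D.obj ⊗≫
        𝒜.F.obj (coreg k 𝒜.A) ◁ (X.str.ract W g ▷ D.obj ≫ ε_ D.obj X.obj) ⊗≫ 𝟙 _ := by monoidal
    _ = 𝟙 _ ⊗≫ (X.str.lcoact (coreg k 𝒜.A) c ▷ (ℬ.F.obj W ⊗ D.obj) ≫
        (𝒜.F.obj (coreg k 𝒜.A) ⊗ X.obj) ◁ D.str.lact W g) ⊗≫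
          𝒜.F.obj (coreg k 𝒜.A) ◁ ε_ D.obj X.obj ⊗≫ 𝟙 _ := by rw [h]; monoidal
    _ = _ := by rw [← whisker_exchange]; monoidal

/-- Tested on the coaction at v, the two sides are `counitOf` at the product of the matrix
coefficient of (f, v) with x, and f(v) times `counitOf` at x. -/
lemma counitOf_lact (hx : ∀ a, rightHit x a = x a • (1 : 𝒜.A)) (V : 𝒜.Mod)
    (f : Module.Dual k V.carrier) :
    𝒜.F.obj V ◁ counitOf X D.obj x ≫ μ 𝒜.F V (coreg k 𝒜.A) ≫ 𝒜.F.map (mc (V := V ⊗ coreg k 𝒜.A)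
      (dtens f (evOne k 𝒜.A))) =
      (α_ _ _ _).inv ≫ X.str.lact V f ▷ D.obj ≫ counitOf X D.obj x := by
  rw [← cancel_epi (α_ _ _ _).hom, Iso.hom_inv_id_assoc]
  refine X.str.lcoact_whiskerRight_ext fun v => ?_
  have h := lcoact_counit X D.obj (V ⊗ coreg k 𝒜.A) (v ⊗ₜ[k] x) (mc (dtens f (evOne k 𝒜.A)))
  rw [mc_dtens_evOne_right hx, counitOf_smul, X.str.lcoact_tensor] at h
  rw [← comp_whiskerRight_assoc (X.str.lcoact V v), X.str.lcoact_lact,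
    MonoidalLinear.smul_whiskerRight, id_whiskerRight, Linear.smul_comp, Category.id_comp, ← h,
    counitOf]
  calc _ = X.str.lcoact V v ▷ D.obj ⊗≫ 𝒜.F.obj V ◁ X.str.lcoact (coreg k 𝒜.A) x ▷ D.obj ⊗≫
        ((𝒜.F.obj V ⊗ 𝒜.F.obj (coreg k 𝒜.A)) ◁ ε_ D.obj X.obj ≫ μ 𝒜.F V (coreg k 𝒜.A) ▷ _) ⊗≫
          𝒜.F.map (mc (V := V ⊗ coreg k 𝒜.A) (dtens f (evOne k 𝒜.A))) := by monoidal
    _ = _ := by rw [whisker_exchange]; monoidal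

/-- Written through the coaction on the dual by `counitOf_eq`, this is the mirror of
`counitOf_lact`, with x now the left factor. -/
lemma counitOf_ract (hD : X.str.IsTranspose D.str)
    (hx : ∀ a, leftHit x a = x a • (1 : 𝒜.A)) (V : 𝒜.Mod)
    (f : Module.Dual k V.carrier) :
    counitOf X D.obj x ▷ 𝒜.F.obj V ≫ μ 𝒜.F (coreg k 𝒜.A) V ≫ 𝒜.F.map (mc (V := coreg k 𝒜.A ⊗ V)
      (dtens (evOne k 𝒜.A) f)) =
      (α_ _ _ _).hom ≫ X.obj ◁ D.str.ract V f ≫ counitOf X D.obj x := by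
  rw [← cancel_epi (α_ _ _ _).inv, Iso.inv_hom_id_assoc]
  refine D.str.rcoact_whiskerLeft_ext fun v => ?_
  have h : X.obj ◁ D.str.rcoact (coreg k 𝒜.A ⊗ V) (x ⊗ₜ[k] v) ≫ (α_ _ _ _).inv ≫
      ε_ D.obj X.obj ▷ _ ≫ (λ_ _).hom ≫ 𝒜.F.map (mc (V := coreg k 𝒜.A ⊗ V)
        (dtens (evOne k 𝒜.A) f)) = f v • counitOf X D.obj x := by
    rw [← counitOf_smul, ← mc_dtens_evOne_left hx, counitOf_eq hD, ← D.str.rcoact_nat,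
      ← leftUnitor_naturality, ← whisker_exchange_assoc]
    monoidal
  rw [D.str.rcoact_tensor] at h
  rw [← MonoidalCategory.whiskerLeft_comp_assoc X.obj (D.str.rcoact V v), D.str.rcoact_ract,
    MonoidalLinear.whiskerLeft_smul, MonoidalCategory.whiskerLeft_id, Linear.smul_comp,
    Category.id_comp, ← h, counitOf_eq hD]
  calc _ = X.obj ◁ D.str.rcoact V v ⊗≫ X.obj ◁ D.str.rcoact (coreg k 𝒜.A) x ▷ 𝒜.F.obj V ⊗≫
        (ε_ D.obj X.obj ▷ (𝒜.F.obj (coreg k 𝒜.A) ⊗ 𝒜.F.obj V) ≫ _ ◁ μ 𝒜.F (coreg k 𝒜.A) V) ⊗≫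
          𝒜.F.map (mc (V := coreg k 𝒜.A ⊗ V) (dtens (evOne k 𝒜.A) f)) := by monoidal
    _ = _ := by rw [← whisker_exchange]; monoidal

variable (X D) in
/-- The morphism `𝔅 → X* ⊗ X` given by the action on `X*`. -/
noncomputable def unitOf : ℬ.F.obj (coreg k ℬ.A) ⟶ D.obj ⊗ X.obj :=
  (ρ_ _).inv ≫ _ ◁ η_ D.obj X.obj ≫ (α_ _ _ _).inv ≫
    D.str.lact (coreg k ℬ.A) (evOne k ℬ.A) ▷ X.obj

lemma map_unitOf (W : ℬ.Mod) (p : W ⟶ coreg k ℬ.A) :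
    ℬ.F.map p ≫ unitOf X D = (ρ_ _).inv ≫ _ ◁ η_ D.obj X.obj ≫ (α_ _ _ _).inv ≫
      D.str.lact W (evOne k ℬ.A ∘ₗ p.lin) ▷ X.obj := by
  rw [unitOf, ← D.str.lact_nat p, rightUnitor_inv_naturality_assoc, ← whisker_exchange_assoc]
  monoidal

lemma unitOf_lact (W : ℬ.Mod) (g : Module.Dual k W.carrier) :
    ℬ.F.obj W ◁ unitOf X D ≫ (α_ _ _ _).inv ≫ D.str.lact W g ▷ X.obj =
      μ ℬ.F W (coreg k ℬ.A) ≫ ℬ.F.map (mc (V := W ⊗ coreg k ℬ.A) (dtens g (evOne k ℬ.A))) ≫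
        unitOf X D := by
  rw [map_unitOf, evOne_mc]
  have h := D.str.lact_tensor W (coreg k ℬ.A) g (evOne k ℬ.A)
  rw [rightUnitor_inv_naturality_assoc, ← whisker_exchange_assoc,
    associator_inv_naturality_left_assoc, ← comp_whiskerRight, h, unitOf]
  monoidal

lemma unitOf_ract (hD : X.str.IsTranspose D.str) (W : ℬ.Mod) (g : Module.Dual k W.carrier) :
    unitOf X D ▷ ℬ.F.obj W ≫ (α_ _ _ _).hom ≫ D.obj ◁ X.str.ract W g =
      μ ℬ.F (coreg k ℬ.A) W ≫ ℬ.F.map (mc (V := coreg k ℬ.A ⊗ W) (dtens (evOne k ℬ.A) g)) ≫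
        unitOf X D := by
  rw [map_unitOf, evOne_mc]
  have h := D.str.lact_tensor (coreg k ℬ.A) W (evOne k ℬ.A) g
  have h1 := (hD.left W g).unit_eq
  rw [rightUnitor_inv_naturality_assoc, ← whisker_exchange_assoc,
    associator_inv_naturality_left_assoc, ← comp_whiskerRight, h, unitOf]
  calc _ = 𝟙 _ ⊗≫ ℬ.F.obj (coreg k ℬ.A) ◁ η_ D.obj X.obj ▷ ℬ.F.obj W ⊗≫
        (D.str.lact (coreg k ℬ.A) (evOne k ℬ.A) ▷ (X.obj ⊗ ℬ.F.obj W) ≫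
          D.obj ◁ X.str.ract W g) := by monoidal
    _ = 𝟙 _ ⊗≫ ℬ.F.obj (coreg k ℬ.A) ◁ (η_ D.obj X.obj ▷ ℬ.F.obj W ≫ (α_ _ _ _).hom ≫
        D.obj ◁ X.str.ract W g) ⊗≫ D.str.lact (coreg k ℬ.A) (evOne k ℬ.A) ▷ X.obj := by
        rw [← whisker_exchange]; monoidal
    _ = _ := by rw [h1]; monoidal

/-- On δ_X the coaction on D may be replaced by the coaction on X, which the following action
cancels to c(1). The B-action that turns δ_X into δ commutes with `balance`. -/
lemma unitOf_balance (hD : X.str.IsTranspose D.str) (c : Module.Dual k 𝒜.A) :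
    unitOf X D ≫ balance D X c = c 1 • unitOf X D := by
  have h1 : η_ D.obj X.obj ≫ balance D X c = c 1 • η_ D.obj X.obj := by
    have h := (hD.right (coreg k 𝒜.A) c).unit_eq
    rw [balance, reassoc_of% h, ← MonoidalCategory.whiskerLeft_comp, X.str.lcoact_lact]
    simp [evOne]
  rw [unitOf]
  simp only [Category.assoc]
  rw [balance_lact, Iso.inv_hom_id_assoc, ← MonoidalCategory.whiskerLeft_comp_assoc, h1]
  simp

/-- Once the B-action is moved to the end, the snake identity turns `counitOf` into the coaction on
D at c, and coaction followed by action is c(1). -/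
lemma unit_counit_left (hD : X.str.IsTranspose D.str) (c : Module.Dual k 𝒜.A) :
    unitOf X D ▷ D.obj ≫ (α_ _ _ _).hom ≫ D.obj ◁ counitOf X D.obj c ≫
      D.str.ract (coreg k 𝒜.A) (evOne k 𝒜.A) =
        c 1 • D.str.lact (coreg k ℬ.A) (evOne k ℬ.A) := by
  have h1 : (λ_ _).inv ≫ η_ D.obj X.obj ▷ D.obj ≫ (α_ _ _ _).hom ≫ D.obj ◁ counitOf X D.obj c =
      D.str.rcoact (coreg k 𝒜.A) c := by
    rw [counitOf_eq hD]
    exact (tensorLeftHomEquiv D.obj D.obj X.obj _).apply_symm_apply _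
  have h2 := D.str.lact_ract (coreg k ℬ.A) (coreg k 𝒜.A) (evOne k ℬ.A) (evOne k 𝒜.A)
  calc _ = 𝟙 _ ⊗≫ ℬ.F.obj (coreg k ℬ.A) ◁ η_ D.obj X.obj ▷ D.obj ⊗≫
        (D.str.lact (coreg k ℬ.A) (evOne k ℬ.A) ▷ (X.obj ⊗ D.obj) ≫
          D.obj ◁ counitOf X D.obj c) ≫ D.str.ract (coreg k 𝒜.A) (evOne k 𝒜.A) := by
        rw [unitOf]; monoidal
    _ = 𝟙 _ ⊗≫ ℬ.F.obj (coreg k ℬ.A) ◁ ((λ_ _).inv ≫ η_ D.obj X.obj ▷ D.obj ≫ (α_ _ _ _).hom ≫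
        D.obj ◁ counitOf X D.obj c) ⊗≫ (D.str.lact (coreg k ℬ.A) (evOne k ℬ.A) ▷
          𝒜.F.obj (coreg k 𝒜.A) ≫ D.str.ract (coreg k 𝒜.A) (evOne k 𝒜.A)) := by
        rw [← whisker_exchange]; monoidal
    _ = ℬ.F.obj (coreg k ℬ.A) ◁ (D.str.rcoact (coreg k 𝒜.A) c ≫
        D.str.ract (coreg k 𝒜.A) (evOne k 𝒜.A)) ≫
          D.str.lact (coreg k ℬ.A) (evOne k ℬ.A) := by rw [h1, h2]; monoidal
    _ = _ := by
      rw [D.str.rcoact_ract, MonoidalLinear.whiskerLeft_smul, MonoidalCategory.whiskerLeft_id,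
        Linear.smul_comp, Category.id_comp]
      rfl

/-- The B-action on D inside δ is first moved to X, `counitOf` being balanced; then the other snake
identity leaves the coaction on X. -/
lemma unit_counit_right (hD : X.str.IsTranspose D.str) (c : Module.Dual k 𝒜.A) :
    X.obj ◁ unitOf X D ≫ (α_ _ _ _).inv ≫ counitOf X D.obj c ▷ X.obj ≫
      X.str.lact (coreg k 𝒜.A) (evOne k 𝒜.A) =
        c 1 • X.str.ract (coreg k ℬ.A) (evOne k ℬ.A) := by
  have h1 : (ρ_ _).inv ≫ X.obj ◁ η_ D.obj X.obj ≫ (α_ _ _ _).inv ≫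
      counitOf X D.obj c ▷ X.obj = X.str.lcoact (coreg k 𝒜.A) c :=
    (tensorRightHomEquiv X.obj D.obj X.obj _).apply_symm_apply _
  have h2 := counitOf_balanced hD (c := c) (coreg k ℬ.A) (evOne k ℬ.A)
  calc _ = 𝟙 _ ⊗≫ (X.obj ⊗ ℬ.F.obj (coreg k ℬ.A)) ◁ η_ D.obj X.obj ⊗≫ ((α_ _ _ _).hom ≫
        X.obj ◁ D.str.lact (coreg k ℬ.A) (evOne k ℬ.A) ≫ counitOf X D.obj c) ▷ X.obj ≫
          X.str.lact (coreg k 𝒜.A) (evOne k 𝒜.A) := by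
        rw [unitOf]; monoidal
    _ = 𝟙 _ ⊗≫ ((X.obj ⊗ ℬ.F.obj (coreg k ℬ.A)) ◁ η_ D.obj X.obj ≫
        X.str.ract (coreg k ℬ.A) (evOne k ℬ.A) ▷ (D.obj ⊗ X.obj)) ⊗≫ counitOf X D.obj c ▷ X.obj ≫
          X.str.lact (coreg k 𝒜.A) (evOne k 𝒜.A) := by
        rw [← h2]; monoidal
    _ = X.str.ract (coreg k ℬ.A) (evOne k ℬ.A) ≫ ((ρ_ _).inv ≫ X.obj ◁ η_ D.obj X.obj ≫
        (α_ _ _ _).inv ≫ counitOf X D.obj c ▷ X.obj) ≫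
          X.str.lact (coreg k 𝒜.A) (evOne k 𝒜.A) := by
        rw [whisker_exchange]; monoidal
    _ = _ := by
      rw [h1, X.str.lcoact_lact, Linear.comp_smul, Category.comp_id]
      rfl

end pair

end HopfBimod

end rigidityPair

/-! ### Zigzags in a bicategory. -/

section zigzag

variable {B : Type*} [Bicategory B] {a b : B} {f : a ⟶ b} {g : b ⟶ a}

open Bicategory

lemma leftZigzag_eq (p : 𝟙 a ⟶ f ≫ g) (q : g ≫ f ⟶ 𝟙 b) :
    leftZigzag p q = p ▷ f ≫ (α_ f g f).hom ≫ f ◁ q := by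
  simp [leftZigzag, bicategoricalComp]

lemma rightZigzag_eq (p : 𝟙 a ⟶ f ≫ g) (q : g ≫ f ⟶ 𝟙 b) :
    rightZigzag p q = g ◁ p ≫ (α_ g f g).inv ≫ q ▷ g := by
  simp [rightZigzag, bicategoricalComp]

end zigzag

/-! ### The relative tensor product as an image, and the adjunction in M(T). -/

section adjunction

open HopfRep

variable {k : Type u} [Field k] {T : Type v} [Category.{w} T] [Preadditive T]
  [Linear k T] [MonoidalCategory T] [HasCoequalizers T] [RigidCategory T]
  [MonoidalPreadditive T] [MonoidalLinear k T]

lemma regularTrace_one_ne_zero (k : Type u) [Field k] [CharZero k] (A : Type u) [Ring A]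
    [HopfAlgebra k A] [Module.Finite k A] : regularTrace k A 1 ≠ 0 := by
  have : Nontrivial A := ⟨1, 0, fun h => by
    simpa using congrArg (Coalgebra.counit (R := k)) h⟩
  rw [regularTrace_one]
  exact_mod_cast (Module.finrank_pos (R := k) (M := A)).ne'

/-- The zigzag in relative tensor products, computed on representatives: each hypothesis describes a
structural morphism after precomposition with a projection. The scalars c of the unit and b of the
unit constraint are collected in front. -/
lemma smul_comp_zigzag_left {U D X V P Q M N R : T} {d : U ⟶ D ⊗ X} {p : D ⊗ X ⟶ P}
    {q : X ⊗ D ⟶ Q} {e' : Q ⟶ V} {e : X ⊗ D ⟶ V} (he : q ≫ e' = e) {p₁ : P ⊗ D ⟶ M} {a : M ⟶ N}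
    {q₁ : D ⊗ Q ⟶ N} (ha : p ▷ D ≫ p₁ ≫ a = (α_ _ _ _).hom ≫ D ◁ q ≫ q₁) {t : N ⟶ R}
    {r : D ⊗ V ⟶ R} (ht : q₁ ≫ t = (𝟙 D ⊗ₘ e') ≫ r) {l : R ⟶ D} {s : D ⊗ V ⟶ D} {b c : k}
    (hl : r ≫ l = b • s) {z : U ⊗ D ⟶ M} (hz : z = (c • (d ≫ p) ⊗ₘ 𝟙 D) ≫ p₁) :
    z ≫ a ≫ t ≫ l = (c * b) • (d ▷ D ≫ (α_ _ _ _).hom ≫ D ◁ e ≫ s) := by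
  rw [hz, MonoidalCategory.tensorHom_id, MonoidalLinear.smul_whiskerRight, comp_whiskerRight]
  simp only [Linear.smul_comp, Category.assoc, reassoc_of% ha, reassoc_of% ht, hl,
    MonoidalCategory.id_tensorHom, ← he, MonoidalCategory.whiskerLeft_comp, Linear.comp_smul,
    smul_smul]

lemma smul_comp_zigzag_right {U D X V P Q M N R : T} {d : U ⟶ D ⊗ X} {p : D ⊗ X ⟶ P}
    {q : X ⊗ D ⟶ Q} {e' : Q ⟶ V} {e : X ⊗ D ⟶ V} (he : q ≫ e' = e) {p₁ : X ⊗ P ⟶ M} {a : M ⟶ N}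
    {q₁ : Q ⊗ X ⟶ N} (ha : X ◁ p ≫ p₁ ≫ a = (α_ _ _ _).inv ≫ q ▷ X ≫ q₁) {t : N ⟶ R}
    {r : V ⊗ X ⟶ R} (ht : q₁ ≫ t = (e' ⊗ₘ 𝟙 X) ≫ r) {l : R ⟶ X} {s : V ⊗ X ⟶ X} {b c : k}
    (hl : r ≫ l = b • s) {z : X ⊗ U ⟶ M} (hz : z = (𝟙 X ⊗ₘ c • (d ≫ p)) ≫ p₁) :
    z ≫ a ≫ t ≫ l = (c * b) • (X ◁ d ≫ (α_ _ _ _).inv ≫ e ▷ X ≫ s) := by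
  rw [hz, MonoidalCategory.id_tensorHom, MonoidalLinear.whiskerLeft_smul,
    MonoidalCategory.whiskerLeft_comp]
  simp only [Linear.smul_comp, Category.assoc, reassoc_of% ha, reassoc_of% ht, hl,
    MonoidalCategory.tensorHom_id, ← he, comp_whiskerRight, Linear.comp_smul, smul_smul]

namespace HopfBimod

section

variable {𝒜 ℬ 𝒞 : Realization k T}

/-- A balanced morphism absorbs the balancer. -/
lemma balancer_comp [IsAlgClosed k] [CharZero k] (hA : Regular k ℬ.A) (I : IrrSystem k ℬ.A)
    (X : HopfBimod 𝒜 ℬ) (Y : HopfBimod ℬ 𝒞) {Z : T} (h : X.obj ⊗ Y.obj ⟶ Z)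
    (w : ∀ (W : ℬ.Mod) (f : Module.Dual k W.carrier), X.str.ract W f ▷ Y.obj ≫ h =
      (α_ _ _ _).hom ≫ X.obj ◁ Y.str.lact W f ≫ h) : balancer I X Y ≫ h = h := by
  rw [balancer_eq X Y hA, Linear.smul_comp, balance_comp X Y _ h w, smul_smul, ← regularTrace_one,
    inv_mul_cancel₀ (regularTrace_one_ne_zero k ℬ.A), one_smul]

lemma unitOf_balancer [IsAlgClosed k] [CharZero k] (hA : Regular k 𝒜.A) (I : IrrSystem k 𝒜.A)
    {X : HopfBimod 𝒜 ℬ} {D : HopfBimod ℬ 𝒜} [ExactPairing D.obj X.obj]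
    (hD : X.str.IsTranspose D.str) : unitOf X D ≫ balancer I D X = unitOf X D := by
  rw [balancer_eq D X hA, Linear.comp_smul, unitOf_balance hD, smul_smul, ← regularTrace_one,
    inv_mul_cancel₀ (regularTrace_one_ne_zero k 𝒜.A), one_smul]

/-- The balancer is itself balanced, so it factors through the projection and fixes itself. The
projection is balanced too and absorbs it, so the factorization is a section of the projection. -/
lemma balancer_image [IsAlgClosed k] [CharZero k] (hA : Regular k ℬ.A) (I : IrrSystem k ℬ.A)
    (X : HopfBimod 𝒜 ℬ) (Y : HopfBimod ℬ 𝒞) :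
    balancer I X Y ≫ balancer I X Y = balancer I X Y ∧
      ∃ i : (tensor X Y).obj ⟶ X.obj ⊗ Y.obj,
        prj X Y ≫ i = balancer I X Y ∧ i ≫ prj X Y = 𝟙 _ := by
  obtain ⟨Λ, hΛ⟩ := hA.exists_integral
  have := hA.isSemisimpleRing
  have hb (W : ℬ.Mod) (f : Module.Dual k W.carrier) :
      X.str.ract W f ▷ Y.obj ≫ balancer I X Y =
        (α_ _ _ _).hom ≫ X.obj ◁ Y.str.lact W f ≫ balancer I X Y := by
    rw [balancer_eq X Y hA]
    simp only [Linear.comp_smul, balance_balanced X Y (leftHit_regularTrace hΛ)]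
  obtain ⟨i, hi⟩ : ∃ i : (tensor X Y).obj ⟶ X.obj ⊗ Y.obj, prj X Y ≫ i = balancer I X Y :=
    ⟨tdesc X Y (balancer I X Y) (hb _ _), prj_tdesc _ _ _ _⟩
  refine ⟨balancer_comp hA I X Y _ hb, i, hi, ?_⟩
  rw [← cancel_epi (prj X Y), reassoc_of% hi, Category.comp_id]
  exact balancer_comp hA I X Y _ (proj_cond X Y)

end

lemma exists_adjunction (ω : Realization k T → kˣ) {𝒜 ℬ : MT ω} (X : HopfBimod 𝒜.alg ℬ.alg)
    (D : HopfBimod ℬ.alg 𝒜.alg) [ExactPairing D.obj X.obj] (hD : X.str.IsTranspose D.str)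
    {x : Module.Dual k 𝒜.alg.A} (hl : ∀ a, leftHit x a = x a • (1 : 𝒜.alg.A))
    (hr : ∀ a, rightHit x a = x a • (1 : 𝒜.alg.A)) (h1 : x 1 ≠ 0) :
    ∃ adj : Bicategory.Adjunction (B := MT ω) (a := ℬ) (b := 𝒜) D X,
      prj X D ≫ Hom.hom adj.counit = counitOf X D.obj x ∧
      Hom.hom adj.unit = ((ω ℬ.alg : k) / (x 1 * (ω 𝒜.alg : k))) • (unitOf X D ≫ prj D X) := by
  -- A zigzag produces c · ω_A · x(1) times the action of 𝔅, to be compared with the unit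
  -- constraint, ω_B times this action.
  let c : k := (ω ℬ.alg : k) / (x 1 * (ω 𝒜.alg : k))
  let κ : tensor X D ⟶ unit 𝒜.alg := descHom X D (unit 𝒜.alg) (counitOf X D.obj x)
    (counitOf_balanced hD _ _) (counitOf_lact hr) (counitOf_ract hD hl)
  let δ' : unit ℬ.alg ⟶ tensor D X :=
    { hom := c • (unitOf X D ≫ prj D X)
      left := fun W g => by
        have h1 := unitOf_lact (X := X) (D := D) W g
        have h2 := prj_lact D X W g
        have h3 : ℬ.alg.F.obj W ◁ (c • (unitOf X D ≫ prj D X)) ≫ (tensor D X).str.lact W g =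
            (μ ℬ.alg.F W (coreg k ℬ.alg.A) ≫ ℬ.alg.F.map (mc (V := W ⊗ coreg k ℬ.alg.A)
              (dtens g (evOne k ℬ.alg.A)))) ≫ (c • (unitOf X D ≫ prj D X)) := by
          simp only [MonoidalLinear.whiskerLeft_smul, MonoidalCategory.whiskerLeft_comp,
            Linear.smul_comp, Linear.comp_smul, Category.assoc, h2]
          rw [reassoc_of% h1]
        exact h3
      right := fun W g => by
        have h1 := unitOf_ract hD W g
        have h2 := prj_ract D X W g
        have h3 : (c • (unitOf X D ≫ prj D X)) ▷ ℬ.alg.F.obj W ≫ (tensor D X).str.ract W g =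
            (μ ℬ.alg.F (coreg k ℬ.alg.A) W ≫ ℬ.alg.F.map (mc (V := coreg k ℬ.alg.A ⊗ W)
              (dtens (evOne k ℬ.alg.A) g))) ≫ (c • (unitOf X D ≫ prj D X)) := by
          simp only [MonoidalLinear.smul_whiskerRight, comp_whiskerRight,
            Linear.smul_comp, Linear.comp_smul, Category.assoc, h2]
          rw [reassoc_of% h1]
        exact h3 }
  have hκ : prj X D ≫ κ.hom = counitOf X D.obj x := prj_descHom _ _ _ _ _ _ _
  have hc : c * (ω 𝒜.alg : k) * x 1 = ω ℬ.alg := by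
    have := (ω 𝒜.alg).ne_zero
    simp only [c]
    field_simp
  have hassoc {A B C E F G : T} (p : A ⟶ B) (q : B ⟶ C) (r : C ⟶ E) (s : E ⟶ F) (t : F ⟶ G) :
      p ≫ (q ≫ r ≫ s) ≫ t = (p ≫ q) ≫ r ≫ s ≫ t := by simp only [Category.assoc]
  refine ⟨⟨δ', κ, ?_, ?_⟩, hκ, rfl⟩
  · rw [leftZigzag_eq]
    -- With the right unit constraint moved to the left side, both sides are morphisms from 𝔅 ⊗_B D
    -- to D and may be compared on 𝔅 ⊗ D.
    refine (Iso.eq_comp_inv (rightIso (ω 𝒜.alg) D)).2 (prj_ext ?_)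
    have h : (prj (unit ℬ.alg) D ≫ (tensorMap δ' (𝟙 D)).hom) ≫ (assocHom D X D).hom ≫
        (tensorMap (𝟙 D) κ).hom ≫ (rightHom (ω 𝒜.alg) D).hom = (ω ℬ.alg : k) • D.actL := by
      refine Eq.trans (smul_comp_zigzag_left hκ (prj_assocHom D X D) (prj_tensorMap (𝟙 D) κ)
        (prj_rightHom (ω 𝒜.alg) D) (prj_tensorMap δ' (𝟙 D))) ?_
      exact (congrArg _ (unit_counit_left hD x)).trans
        ((smul_smul _ _ _).trans (congrArg (· • _) hc))
    exact (hassoc (prj (unit ℬ.alg) D) (tensorMap δ' (𝟙 D)).hom (assocHom D X D).hom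
      (tensorMap (𝟙 D) κ).hom (rightHom (ω 𝒜.alg) D).hom).trans
        (h.trans (prj_leftHom (ω ℬ.alg) D).symm)
  · rw [rightZigzag_eq]
    refine (Iso.eq_comp_inv (leftIso (ω 𝒜.alg) X)).2 (prj_ext ?_)
    have h : (prj X (unit ℬ.alg) ≫ (tensorMap (𝟙 X) δ').hom) ≫ assocInv X D X ≫
        (tensorMap κ (𝟙 X)).hom ≫ (leftHom (ω 𝒜.alg) X).hom = (ω ℬ.alg : k) • X.actR := by
      refine Eq.trans (smul_comp_zigzag_right hκ (prj_assocInv X D X) (prj_tensorMap κ (𝟙 X))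
        (prj_leftHom (ω 𝒜.alg) X) (prj_tensorMap (𝟙 X) δ')) ?_
      exact (congrArg _ (unit_counit_right hD x)).trans
        ((smul_smul _ _ _).trans (congrArg (· • _) hc))
    exact (hassoc (prj X (unit ℬ.alg)) (tensorMap (𝟙 X) δ').hom (assocInv X D X)
      (tensorMap κ (𝟙 X)).hom (leftHom (ω 𝒜.alg) X).hom).trans
        (h.trans (prj_rightHom (ω ℬ.alg) X).symm)

end HopfBimod

end adjunction

/-! ### The rigidity theorem. -/

theorem mainTheorem1 {k : Type u} [Field k] [IsAlgClosed k] [CharZero k]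
    {T : Type v} [Category.{w} T] [Abelian T] [Linear k T] [MonoidalCategory T]
    [MonoidalPreadditive T] [MonoidalLinear k T] [RigidCategory T]
    (hT : IsSemisimpleCategory k T) (ω : Realization k T → kˣ) :
    -- the bicategory of modules is rigid
    (∀ (𝒜 ℬ : MT ω) (X : 𝒜 ⟶ ℬ),
      (∃ Y : ℬ ⟶ 𝒜, Nonempty (Bicategory.Adjunction Y X)) ∧
        ∃ Y : ℬ ⟶ 𝒜, Nonempty (Bicategory.Adjunction X Y)) ∧
    -- the rigidity pair of a module `X` with dual object `Xd`
    (∀ (𝒜 ℬ : MT ω) (I𝒜 : IrrSystem k 𝒜.alg.A) (Iℬ : IrrSystem k ℬ.alg.A)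
      (X : HopfBimod 𝒜.alg ℬ.alg) (Xd : T) [ExactPairing Xd X.obj],
      ∃ S : BimodStr ℬ.alg 𝒜.alg Xd, HopfBimod.IsDualStr X Xd S ∧
        HopfBimod.balancer Iℬ X ⟨Xd, S⟩ ≫ HopfBimod.rigidityCounit X Xd I𝒜 =
          HopfBimod.rigidityCounit X Xd I𝒜 ∧
        HopfBimod.rigidityUnit X ⟨Xd, S⟩ ≫ HopfBimod.balancer I𝒜 ⟨Xd, S⟩ X =
          HopfBimod.rigidityUnit X ⟨Xd, S⟩ ∧
        ∃ adj : Bicategory.Adjunction (B := MT ω) (a := ℬ) (b := 𝒜) (HopfBimod.mk Xd S) X,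
          HopfBimod.prj X ⟨Xd, S⟩ ≫ HopfBimod.Hom.hom adj.counit =
            HopfBimod.rigidityCounit X Xd I𝒜 ∧
          HopfBimod.Hom.hom adj.unit =
            ((ω ℬ.alg : k) / ((Module.finrank k 𝒜.alg.A : k) * (ω 𝒜.alg : k))) •
              (HopfBimod.rigidityUnit X ⟨Xd, S⟩ ≫ HopfBimod.prj ⟨Xd, S⟩ X)) ∧
    -- the unit module of `𝒜` is the direct sum of the objects `F(V) ⊗ V*`
    (∀ (𝒜 : Realization k T) (I : IrrSystem k 𝒜.A),
      IsIso (biproduct.desc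
        (f := fun p : Σ j, Fin (Module.finrank k (I.mod j).carrier) => 𝒜.F.obj (I.mod p.1))
        (fun p => HopfBimod.unitMc 𝒜 ((Module.finBasis k (I.mod p.1).carrier).coord p.2)))) ∧
    -- the composite `X ⊗_ℬ Y` is the image of the idempotent `balancer` of `X ⊗ Y`
    (∀ (𝒜 ℬ 𝒞 : Realization k T) (I : IrrSystem k ℬ.A) (X : HopfBimod 𝒜 ℬ)
      (Y : HopfBimod ℬ 𝒞),
      HopfBimod.balancer I X Y ≫ HopfBimod.balancer I X Y = HopfBimod.balancer I X Y ∧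
        ∃ i : (HopfBimod.tensor X Y).obj ⟶ X.obj ⊗ Y.obj,
          HopfBimod.prj X Y ≫ i = HopfBimod.balancer I X Y ∧ i ≫ HopfBimod.prj X Y = 𝟙 _) := by
  have hreg (𝒜 : Realization k T) : HopfRep.Regular k 𝒜.A := fun _ _ f => 𝒜.exists_regular hT f
  have hadj {𝒜 ℬ : MT ω} (X : HopfBimod 𝒜.alg ℬ.alg) (D : HopfBimod ℬ.alg 𝒜.alg)
      [ExactPairing D.obj X.obj] (hD : X.str.IsTranspose D.str) :
      ∃ adj : Bicategory.Adjunction (B := MT ω) (a := ℬ) (b := 𝒜) D X,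
        HopfBimod.prj X D ≫ HopfBimod.Hom.hom adj.counit =
            HopfBimod.counitOf X D.obj (regularTrace k 𝒜.alg.A) ∧
          HopfBimod.Hom.hom adj.unit =
            ((ω ℬ.alg : k) / (regularTrace k 𝒜.alg.A 1 * (ω 𝒜.alg : k))) •
              (HopfBimod.unitOf X D ≫ HopfBimod.prj D X) := by
    obtain ⟨Λ, hΛ⟩ := (hreg 𝒜.alg).exists_integral
    have := (hreg 𝒜.alg).isSemisimpleRing
    exact HopfBimod.exists_adjunction ω X D hD (leftHit_regularTrace hΛ)
      (rightHit_regularTrace hΛ) (regularTrace_one_ne_zero k 𝒜.alg.A)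
  refine ⟨fun 𝒜 ℬ X => ⟨?_, ?_⟩, fun 𝒜 ℬ I𝒜 Iℬ X Xd _ => ?_,
    fun 𝒜 I => I.isIso_desc 𝒜 (hreg 𝒜), fun 𝒜 ℬ 𝒞 I X Y => HopfBimod.balancer_image (hreg ℬ) I X Y⟩
  -- For the left adjoint the given module plays the role of X and its left dual that of D.
  · obtain ⟨S, hS⟩ := BimodStr.exists_isTranspose (HopfBimod.str X) (ᘁ(HopfBimod.obj X))
    obtain ⟨adj, -⟩ := hadj X ⟨_, S⟩ hS
    exact ⟨_, ⟨adj⟩⟩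
  -- For the right adjoint the roles are exchanged: the given module is D, the dual of the object to
  -- be constructed.
  · obtain ⟨S, hS⟩ := BimodStr.exists_isTranspose' (HopfBimod.str X) ((HopfBimod.obj X)ᘁ)
    obtain ⟨adj, -⟩ := hadj ⟨_, S⟩ X hS
    exact ⟨_, ⟨adj⟩⟩
  · obtain ⟨S, hS⟩ := X.str.exists_isTranspose Xd
    obtain ⟨adj, h1, h2⟩ := hadj X ⟨Xd, S⟩ hS
    rw [regularTrace_one] at h2
    have h3 := HopfBimod.rigidityCounit_eq X Xd (hreg 𝒜.alg) I𝒜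
    refine ⟨S, HopfBimod.isDualStr_of_isTranspose X Xd S hS, ?_, ?_, adj, h1.trans h3.symm, h2⟩
    · rw [h3]
      exact HopfBimod.balancer_comp (hreg ℬ.alg) Iℬ X ⟨Xd, S⟩ _
        (HopfBimod.counitOf_balanced (D := ⟨Xd, S⟩) hS)
    · exact HopfBimod.unitOf_balancer (hreg 𝒜.alg) I𝒜 hS
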